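/- Let $B$ be a smooth $k$-manifold (Hausdorff, second countable) with a regular twisted Poisson structure: a smooth bivector field $\Pi$ of constant rank such that, for some closed 3-form $\eta_0$, $\{\{f,g\},h\}+\{\{g,h\},f\}+\{\{h,f\},g\}+\eta_0(X_f,X_g,X_h)=0$ for all $f,g,h\in C^\infty(B)$, where $\Pi^\sharp(\alpha)(\beta)=\Pi(\alpha,\beta)$, $\{f,g\}=\Pi(df,dg)$ and $X_f=-\Pi^\sharp(df)$. Its leaves are tangent to $\Pi^\sharp(T^*B)$; let $\nu^*\mathcal F\subset T^*B$ be the annihilator of $\Pi^\sharp(T^*B)$. Fix a period bundle $P$: a bundle of subgroups of $\nu^*\mathcal F$ that is locally of the form $\mathbb Z\,da_1\oplus\dots\oplus\mathbb Z\,da_n$ for smooth functions $a_i$ whose differentials form a frame of $\nu^*\mathcal F$. Fix a characteristic form $\Theta$: a smooth 2-form on $B$ with $\Theta(\Pi^\sharp\alpha,\Pi^\sharp\beta)=\Pi(\alpha,\beta)$, i.e. restricting to the almost symplectic form on every leaf. An ASCIR (almost symplectically complete isotropic realization) over $(B,\Pi)$ is a smooth manifold $M$ with a non-degenerate 2-form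 $\omega$ and a smooth surjective submersion $\pi:M\to B$ whose fibres are compact, connected and isotropic, such that $\pi$ is an almost Poisson map (for the almost Poisson structure on $M$ induced by $\omega$) and $d\omega=\pi^*\eta$ for some closed 3-form $\eta$ on $B$ (the twisting form). A covector $\alpha\in\nu_b^*\mathcal F$ acts on $\pi^{-1}(b)$ by the time-one flow $\varphi_b(\alpha)$ of the vector field $X$ with $\omega(X,\cdot)=\pi^*\alpha$. Let $\mathrm{ASCIR}(B,\Pi,P)$ be the class of ASCIRs for which the stabilizer of this action of $\nu^*\mathcal F$ is $P$; then $T=\nu^*\mathcal F/P$ acts on $M$. An isomorphism of ASCIRs is a diffeomorphism that covers the identity of $B$ and preserves the 2-forms; $\pi_0(\mathrm{ASCIR}(B,\Pi,P))$ denotes the set of isomorphism classes. For $(M_1,\omega_1),(M_2,\omega_2)\in\mathrm{ASCIR}(B,\Pi,P)$ with twisting forms $\eta_1,\eta_2$, a tensor product $M_1\otimes M_2$ is a quotient manifold $M_1\times_BM_2/T^-$, where $T^-$ is the anti-diagonal of $T\times_BT$, with its projection to $B$ and the 2-form that pulls back to $\pi_1^*\omega_1+\pi_2^*\omega_2-\pi'^*\Theta$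 on $M_1\times_BM_2$ (here $\pi_i: M_1\times_BM_2\to M_i$ and $\pi': M_1\times_BM_2\to B$ are the projections); it has twisting form $\eta_1+\eta_2-d\Theta$. Proposition. (1) Any two objects of $\mathrm{ASCIR}(B,\Pi,P)$ have a tensor product in $\mathrm{ASCIR}(B,\Pi,P)$. (2) Isomorphisms $f_1:M_1\to M_1'$ and $f_2:M_2\to M_2'$ induce an isomorphism $g:M_1\otimes M_2\to M_1'\otimes M_2'$, which is the unique one with $g([m_1,m_2])=[f_1(m_1),f_2(m_2)]$ for all $(m_1,m_2)\in M_1\times_BM_2$. In particular an isomorphism $M_1\cong M_1'$ induces $M_1\otimes M_2\cong M_1'\otimes M_2$. (3) Hence $\otimes$ descends to $\pi_0(\mathrm{ASCIR}(B,\Pi,P))$: there is exactly one binary operation on this set that sends $([M_1],[M_2])$ to $[M_1\otimes M_2]$ for all $M_1,M_2$. -/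

import Mathlib

open scoped Manifold ContDiff Topology

universe u v

noncomputable section

namespace Realization

/-! ### Differential forms on manifolds without boundary, modelled on `ℝᵐ` -/

section Forms

variable (m r : ℕ) (M : Type*) [TopologicalSpace M] [ChartedSpace (EuclideanSpace ℝ (Fin m)) M]

/-- Differential `r`-forms, with no smoothness imposed. -/
abbrev MForm : Type _ := ∀ x : M, (TangentSpace (𝓡 m) x) [⋀^Fin r]→L[ℝ] ℝ

variable {m r M}

/-- The expression of a form in the preferred chart around `x₀`: its pull-back under the inverse of
that chart (meaningful on the target of the chart). -/
def MForm.inChart (σ : MForm m r M) (x₀ : M) :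
    EuclideanSpace ℝ (Fin m) → (EuclideanSpace ℝ (Fin m)) [⋀^Fin r]→L[ℝ] ℝ :=
  fun y => (σ ((extChartAt (𝓡 m) x₀).symm y)).compContinuousLinearMap
    (mfderiv 𝓘(ℝ, EuclideanSpace ℝ (Fin m)) (𝓡 m) (extChartAt (𝓡 m) x₀).symm y)

/-- A form is smooth if all its chart expressions are. -/
def MForm.Smooth (σ : MForm m r M) : Prop :=
  ∀ x₀ : M, ContDiffOn ℝ ∞ (σ.inChart x₀) (extChartAt (𝓡 m) x₀).target

/-- The exterior derivative, computed at `x` in the preferred chart around `x`. -/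
def MForm.d (σ : MForm m r M) : MForm m (r + 1) M :=
  fun x => (extDeriv (σ.inChart x) (extChartAt (𝓡 m) x x)).compContinuousLinearMap
    (mfderiv (𝓡 m) 𝓘(ℝ, EuclideanSpace ℝ (Fin m)) (extChartAt (𝓡 m) x) x)

/-- The pull-back of a form under a map. -/
def MForm.pullback {m' : ℕ} {M' : Type*} [TopologicalSpace M']
    [ChartedSpace (EuclideanSpace ℝ (Fin m')) M'] (f : M' → M) (σ : MForm m r M) :
    MForm m' r M' :=
  fun x => (σ (f x)).compContinuousLinearMap (mfderiv (𝓡 m') (𝓡 m) f x)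

variable (m) in
/-- Cotangent vectors at `x`. -/
abbrev Covector (x : M) : Type := TangentSpace (𝓡 m) x →L[ℝ] ℝ

variable (m) in
/-- The differential of a real function at `x`. -/
def dFun (f : M → ℝ) (x : M) : Covector m x := mfderiv (𝓡 m) 𝓘(ℝ, ℝ) f x

variable (m) in
/-- A covector at `x`, regarded as a covector at a point `y` equal to `x`. -/
def Covector.at {x y : M} (h : y = x) (α : Covector m x) : Covector m y := h.symm ▸ α

variable (m) in
/-- A tangent vector at `x`, regarded as a tangent vector at a point `y` equal to `x`. -/
def tangentAt {x y : M} (h : y = x) (v : TangentSpace (𝓡 m) x) : TangentSpace (𝓡 m) y := h.symm ▸ v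

end Forms

/-! ### Regular twisted Poisson manifolds -/

section Base

variable (k : ℕ) (B : Type v) [TopologicalSpace B] [ChartedSpace (EuclideanSpace ℝ (Fin k)) B]

/-- A smooth bivector field `Π`, given by its skew map `Π♯ : T*B → TB`, `Π♯(α)(β) = Π(α, β)`. -/
structure Bivector where
  sharp : ∀ b : B, Covector k b →ₗ[ℝ] TangentSpace (𝓡 k) b
  skew : ∀ (b : B) (α β : Covector k b), β (sharp b α) = -α (sharp b β)
  smooth : ∀ f g : B → ℝ, ContMDiff (𝓡 k) 𝓘(ℝ, ℝ) ∞ f → ContMDiff (𝓡 k) 𝓘(ℝ, ℝ) ∞ g →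
    ContMDiff (𝓡 k) 𝓘(ℝ, ℝ) ∞ (fun b => dFun k g b (sharp b (dFun k f b)))

variable {k B}

namespace Bivector

variable (T : Bivector k B)

/-- `Π(α, β)`. -/
def eval (b : B) (α β : Covector k b) : ℝ := β (T.sharp b α)

/-- The bracket `{f, g} = Π(df, dg)`. -/
def bracket (f g : B → ℝ) : B → ℝ := fun b => T.eval b (dFun k f b) (dFun k g b)

/-- The Hamiltonian vector field `X_f = -Π♯(df)`. -/
def ham (f : B → ℝ) (b : B) : TangentSpace (𝓡 k) b := -T.sharp b (dFun k f b)

/-- `[Π, Π] = ∧³Π♯(η)`, expressed through the failure of the Jacobi identity. -/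
def IsTwistedBy (η : MForm k 3 B) : Prop :=
  ∀ f g h : B → ℝ, ContMDiff (𝓡 k) 𝓘(ℝ, ℝ) ∞ f → ContMDiff (𝓡 k) 𝓘(ℝ, ℝ) ∞ g →
    ContMDiff (𝓡 k) 𝓘(ℝ, ℝ) ∞ h → ∀ b : B,
      T.bracket (T.bracket f g) h b + T.bracket (T.bracket g h) f b
        + T.bracket (T.bracket h f) g b + η b ![T.ham f b, T.ham g b, T.ham h b] = 0

end Bivector

variable (k B) in
/-- A regular twisted Poisson structure on `B`: a bivector field of constant rank, twisted by some
closed 3-form. -/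
structure RegularTwistedPoisson extends Bivector k B where
  twisted : ∃ η : MForm k 3 B, η.Smooth ∧ η.d = 0 ∧ toBivector.IsTwistedBy η
  regular : ∃ rk : ℕ, ∀ b : B, Module.finrank ℝ (LinearMap.range (sharp b)) = rk

namespace RegularTwistedPoisson

variable (T : RegularTwistedPoisson k B)

/-- The tangent space at `b` of the almost symplectic leaf through `b`, namely `Π♯(T*_b B)`. -/
def leafTangent (b : B) : Submodule ℝ (TangentSpace (𝓡 k) b) := LinearMap.range (T.sharp b)

/-- The fibre at `b` of the conormal bundle `ν*ℱ` of the almost symplectic foliation. -/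
def conormal (b : B) : Submodule ℝ (Covector k b) where
  carrier := {α | ∀ v ∈ T.leafTangent b, α v = 0}
  add_mem' := fun {α β} hα hβ v hv => by
    rw [add_apply, hα v hv, hβ v hv, add_zero]
  zero_mem' := fun v _ => rfl
  smul_mem' := fun c α hα v hv => by
    rw [smul_apply, hα v hv, smul_zero]

/-- `Θ` is a characteristic form: it is a smooth 2-form restricting on every leaf to the almost
symplectic form of that leaf, that is, `Θ(Π♯α, Π♯β) = Π(α, β)`. -/
structure IsCharacteristicForm (Θ : MForm k 2 B) : Prop where
  smooth : Θ.Smooth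
  restrict : ∀ (b : B) (α β : Covector k b), Θ b ![T.sharp b α, T.sharp b β] = T.eval b α β

end RegularTwistedPoisson

/-- A period bundle (equivalently, a tropical affine structure transversal to the leaves): a bundle
of lattices in `ν*ℱ` which is locally `ℤ da₁ ⊕ ⋯ ⊕ ℤ daₙ` for smooth functions `a₁, …, aₙ` whose
differentials form a frame of `ν*ℱ`. -/
structure PeriodBundle (T : RegularTwistedPoisson k B) where
  fiber : ∀ b : B, AddSubgroup (Covector k b)
  locally_integral : ∀ b₀ : B, ∃ U : Set B, IsOpen U ∧ b₀ ∈ U ∧ ∃ (n : ℕ) (a : Fin n → B → ℝ),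
    (∀ i, ContMDiffOn (𝓡 k) 𝓘(ℝ, ℝ) ∞ (a i) U) ∧
    ∀ b ∈ U, LinearIndependent ℝ (fun i => dFun k (a i) b) ∧
      Submodule.span ℝ (Set.range fun i => dFun k (a i) b) = T.conormal b ∧
      fiber b = AddSubgroup.closure (Set.range fun i => dFun k (a i) b)

end Base

/-! ### Manifolds over `B` carrying a 2-form -/

section Over

variable (k : ℕ) (B : Type v) [TopologicalSpace B] [ChartedSpace (EuclideanSpace ℝ (Fin k)) B]

/-- A smooth manifold (Hausdorff, second countable, without boundary) with a smooth map to `B` and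
a smooth 2-form. -/
structure FormOver where
  carrier : Type u
  dim : ℕ
  [top : TopologicalSpace carrier]
  [charted : ChartedSpace (EuclideanSpace ℝ (Fin dim)) carrier]
  [manifold : IsManifold (𝓡 dim) ∞ carrier]
  [hausdorff : T2Space carrier]
  [secondCountable : SecondCountableTopology carrier]
  proj : carrier → B
  form : MForm dim 2 carrier
  smooth_proj : ContMDiff (𝓡 dim) (𝓡 k) ∞ proj
  smooth_form : form.Smooth

attribute [instance] FormOver.top FormOver.charted FormOver.manifold FormOver.hausdorff
  FormOver.secondCountable

variable {k B}

namespace FormOver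

/-- The differential of the projection. -/
def dproj (M : FormOver.{u} k B) (m : M.carrier) :
    TangentSpace (𝓡 M.dim) m →L[ℝ] TangentSpace (𝓡 k) (M.proj m) :=
  mfderiv (𝓡 M.dim) (𝓡 k) M.proj m

/-- `X = ω♯(π*α)`, that is, `ω(X, ·) = π*α`. -/
def IsSharp (M : FormOver.{u} k B) {m : M.carrier} (α : Covector k (M.proj m))
    (X : TangentSpace (𝓡 M.dim) m) : Prop :=
  ∀ w : TangentSpace (𝓡 M.dim) m, M.form m ![X, w] = α (M.dproj m w)

/-- `m' = φ_b(α)(m)`: the time-one flow of the vector field `ω♯(π*α)` on the fibre `π⁻¹(b)` takes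
`m` to `m'`. -/
def FlowsTo (M : FormOver.{u} k B) {b : B} (α : Covector k b) (m m' : M.carrier) : Prop :=
  ∃ (γ : ℝ → M.carrier) (h : ∀ t, M.proj (γ t) = b), γ 0 = m ∧ γ 1 = m' ∧
    ∀ t, ∃ X : TangentSpace (𝓡 M.dim) (γ t),
      HasMFDerivAt 𝓘(ℝ, ℝ) (𝓡 M.dim) γ t ((1 : ℝ →L[ℝ] ℝ).smulRight X) ∧
        M.IsSharp (Covector.at k (h t) α) X

/-- `η` is the twisting form of `M`: a closed 3-form with `dω = π*η`. -/
structure IsTwistingForm (M : FormOver.{u} k B) (η : MForm k 3 B) : Prop where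
  smooth : η.Smooth
  closed : η.d = 0
  eq : M.form.d = η.pullback M.proj

/-- Almost symplectomorphisms over the identity of `B`. -/
structure Iso (M N : FormOver.{u} k B) where
  toDiffeo : M.carrier ≃ₘ^∞⟮𝓡 M.dim, 𝓡 N.dim⟯ N.carrier
  proj_eq : ∀ m, N.proj (toDiffeo m) = M.proj m
  form_eq : N.form.pullback toDiffeo = M.form

/-- The identity. -/
def Iso.refl (M : FormOver.{u} k B) : Iso M M where
  toDiffeo := Diffeomorph.refl _ _ _
  proj_eq _ := rfl
  form_eq := by
    funext x
    ext v
    simp only [MForm.pullback, Diffeomorph.coe_refl, mfderiv_id]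
    rfl

/-- The composition. -/
def Iso.trans {M N L : FormOver.{u} k B} (f : Iso M N) (g : Iso N L) : Iso M L where
  toDiffeo := f.toDiffeo.trans g.toDiffeo
  proj_eq m := (g.proj_eq _).trans (f.proj_eq m)
  form_eq := by
    funext x
    have hf := f.toDiffeo.mdifferentiable (by simp) x
    have hg := g.toDiffeo.mdifferentiable (by simp) (f.toDiffeo x)
    have h1 := congrFun f.form_eq x
    have h2 := congrFun g.form_eq (f.toDiffeo x)
    rw [← h1]
    ext v
    simp only [MForm.pullback, Diffeomorph.coe_trans] at h2 ⊢
    rw [mfderiv_comp x hg hf, ← h2]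
    rfl

/-- The inverse. -/
def Iso.symm {M N : FormOver.{u} k B} (f : Iso M N) : Iso N M where
  toDiffeo := f.toDiffeo.symm
  proj_eq n := by
    rw [← f.proj_eq, Diffeomorph.apply_symm_apply]
  form_eq := by
    funext y
    have hs := f.toDiffeo.symm.mdifferentiable (by simp) y
    have hf := f.toDiffeo.mdifferentiable (by simp) (f.toDiffeo.symm y)
    have h1 := congrFun f.form_eq (f.toDiffeo.symm y)
    have hc := mfderiv_comp y hf hs
    have he : (f.toDiffeo : M.carrier → N.carrier) ∘ f.toDiffeo.symm = id := by
      funext z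
      simp
    rw [he, mfderiv_id] at hc
    have key : ∀ z : N.carrier, z = y → ∀ v : Fin 2 → EuclideanSpace ℝ (Fin N.dim),
        N.form z v = N.form y v := by
      rintro _ rfl _
      rfl
    ext v
    rw [← key _ (f.toDiffeo.apply_symm_apply y) v]
    simp only [MForm.pullback] at h1 ⊢
    rw [← h1]
    refine congrArg (N.form (f.toDiffeo (f.toDiffeo.symm y))) ?_
    funext i
    exact (congrArg (fun L : EuclideanSpace ℝ (Fin N.dim) →L[ℝ] EuclideanSpace ℝ (Fin N.dim) =>
      L (v i)) hc).symm

/-- The fibre product `M₁ ×_B M₂`. -/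
def FiberProduct (M₁ M₂ : FormOver.{u} k B) : Type u :=
  {p : M₁.carrier × M₂.carrier // M₁.proj p.1 = M₂.proj p.2}

/-- `(v₁, v₂)` is tangent to the fibre product at `p`. -/
def FiberProduct.IsTangent {M₁ M₂ : FormOver.{u} k B} (p : FiberProduct M₁ M₂)
    (v : TangentSpace (𝓡 M₁.dim) p.1.1 × TangentSpace (𝓡 M₂.dim) p.1.2) : Prop :=
  M₁.dproj p.1.1 v.1 = tangentAt k p.2 (M₂.dproj p.1.2 v.2)

/-- The value of `π₁*ω₁ + π₂*ω₂ - π'*Θ` on two tangent vectors of `M₁ ×_B M₂` at `p`. -/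
def FiberProduct.formValue (Θ : MForm k 2 B) {M₁ M₂ : FormOver.{u} k B} (p : FiberProduct M₁ M₂)
    (v w : TangentSpace (𝓡 M₁.dim) p.1.1 × TangentSpace (𝓡 M₂.dim) p.1.2) : ℝ :=
  M₁.form p.1.1 ![v.1, w.1] + M₂.form p.1.2 ![v.2, w.2]
    - Θ (M₁.proj p.1.1) ![M₁.dproj p.1.1 v.1, M₁.dproj p.1.1 w.1]

/-- The differential of a map `Q : M₁ × M₂ → N`. -/
def dprod {M₁ M₂ N : FormOver.{u} k B} (Q : M₁.carrier × M₂.carrier → N.carrier)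
    (x : M₁.carrier × M₂.carrier)
    (v : TangentSpace (𝓡 M₁.dim) x.1 × TangentSpace (𝓡 M₂.dim) x.2) :
    TangentSpace (𝓡 N.dim) (Q x) :=
  mfderiv ((𝓡 M₁.dim).prod (𝓡 M₂.dim)) (𝓡 N.dim) Q x v

/-- The map of fibre products induced by isomorphisms of the factors. -/
def FiberProduct.map {M₁ M₂ M₁' M₂' : FormOver.{u} k B} (f₁ : Iso M₁ M₁') (f₂ : Iso M₂ M₂')
    (p : FiberProduct M₁ M₂) : FiberProduct M₁' M₂' :=
  ⟨(f₁.toDiffeo p.1.1, f₂.toDiffeo p.1.2), by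
    rw [f₁.proj_eq, f₂.proj_eq]
    exact p.2⟩

/-- `p` and `p'` lie in the same orbit of `T⁻`, the anti-diagonal of `T ×_B T`, on `M₁ ×_B M₂`,
where `T = ν*ℱ / P` acts by the time-one flows. -/
def SameAntiOrbit (T : RegularTwistedPoisson k B) {M₁ M₂ : FormOver.{u} k B}
    (p p' : FiberProduct M₁ M₂) : Prop :=
  ∃ (b : B) (α : Covector k b), α ∈ T.conormal b ∧
    M₁.FlowsTo α p.1.1 p'.1.1 ∧ M₂.FlowsTo (-α) p.1.2 p'.1.2

/-- `q` exhibits `N` as the quotient manifold `M₁ ×_B M₂ / T⁻`, fibred over `B` in the natural way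
and carrying the form `ω₁ ⊕ ω₂ - π*Θ`: its fibres are the `T⁻`-orbits, it is a smooth submersion on
the submanifold `M₁ ×_B M₂` of `M₁ × M₂`, and the form of `N` pulls back to
`π₁*ω₁ + π₂*ω₂ - π'*Θ`. -/
structure IsTensorQuotient (T : RegularTwistedPoisson k B) (Θ : MForm k 2 B)
    (M₁ M₂ N : FormOver.{u} k B) (q : FiberProduct M₁ M₂ → N.carrier) : Prop where
  surjective : Function.Surjective q
  eq_iff : ∀ p p', q p = q p' ↔ SameAntiOrbit T p p'
  proj_eq : ∀ p, N.proj (q p) = M₁.proj p.1.1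
  /-- Near every point, `q` extends to a smooth map `Q` on an open subset of `M₁ × M₂`; the
  differential of `Q` on the vectors `(v₁, v₂)` tangent to the fibre product is that of `q`. -/
  smooth_and_form : ∀ p : FiberProduct M₁ M₂, ∃ (O : Set (M₁.carrier × M₂.carrier))
    (Q : M₁.carrier × M₂.carrier → N.carrier), IsOpen O ∧ p.1 ∈ O ∧
    ContMDiffOn ((𝓡 M₁.dim).prod (𝓡 M₂.dim)) (𝓡 N.dim) ∞ Q O ∧
    (∀ p' : FiberProduct M₁ M₂, p'.1 ∈ O → Q p'.1 = q p') ∧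
    ∀ v w, p.IsTangent v → p.IsTangent w →
      N.form (Q p.1) ![dprod Q p.1 v, dprod Q p.1 w] = p.formValue Θ v w
  /-- Through every point of the fibre product passes a smooth local section of `q`. -/
  submersion : ∀ p : FiberProduct M₁ M₂, ∃ (O : Set N.carrier)
    (s : N.carrier → M₁.carrier × M₂.carrier), IsOpen O ∧ q p ∈ O ∧ s (q p) = p.1 ∧
    ContMDiffOn (𝓡 N.dim) ((𝓡 M₁.dim).prod (𝓡 M₂.dim)) ∞ s O ∧
    ∀ y ∈ O, ∃ h : M₁.proj (s y).1 = M₂.proj (s y).2, q ⟨s y, h⟩ = y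
  /-- If `dωᵢ = π*ηᵢ`, then `N` has twisting form `η₁ + η₂ - dΘ`. -/
  twisting : ∀ η₁ η₂ : MForm k 3 B, M₁.IsTwistingForm η₁ → M₂.IsTwistingForm η₂ →
    N.IsTwistingForm (η₁ + η₂ - Θ.d)

/-- `M` is an almost symplectically complete isotropic realization of the regular twisted Poisson
manifold `B`, with period bundle `P`. -/
structure IsASCIR (T : RegularTwistedPoisson k B) (P : PeriodBundle T)
    (M : FormOver.{u} k B) : Prop where
  surjective : Function.Surjective M.proj
  submersion : ∀ m, Function.Surjective (M.dproj m)
  compact_fiber : ∀ b, IsCompact (M.proj ⁻¹' {b})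
  connected_fiber : ∀ b, IsConnected (M.proj ⁻¹' {b})
  nondegenerate : ∀ m (v : TangentSpace (𝓡 M.dim) m), (∀ w, M.form m ![v, w] = 0) → v = 0
  isotropic : ∀ m (v w : TangentSpace (𝓡 M.dim) m), M.dproj m v = 0 → M.dproj m w = 0 →
    M.form m ![v, w] = 0
  /-- `π` is an almost Poisson map: `Π_M(π*α, π*β) = Π(α, β)`, where the bivector of `M` is
  `Π_M(π*α, π*β) = ω(ω♯(π*α), ω♯(π*β))`. -/
  almostPoisson : ∀ m (α β : Covector k (M.proj m)) (X Y : TangentSpace (𝓡 M.dim) m),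
    M.IsSharp α X → M.IsSharp β Y → M.form m ![X, Y] = T.eval (M.proj m) α β
  twisting : ∃ η : MForm k 3 B, M.IsTwistingForm η
  /-- `P` is the stabilizer of the action of `ν*ℱ` on `M` by time-one flows. -/
  period : ∀ b (α : Covector k b), α ∈ P.fiber b ↔
    α ∈ T.conormal b ∧ ∀ m, M.proj m = b → M.FlowsTo α m m

end FormOver

/-- The objects of the category `ASCIR(B, Π, P)`. -/
def ASCIR (T : RegularTwistedPoisson k B) (P : PeriodBundle T) : Type (max (u + 1) v) :=
  {M : FormOver.{u} k B // M.IsASCIR T P}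

namespace ASCIR

variable {T : RegularTwistedPoisson k B} {P : PeriodBundle T}

variable (T P) in
instance isoSetoid : Setoid (ASCIR.{u, v} T P) where
  r M N := Nonempty (FormOver.Iso M.1 N.1)
  iseqv :=
    { refl := fun M => ⟨FormOver.Iso.refl M.1⟩
      symm := fun ⟨f⟩ => ⟨f.symm⟩
      trans := fun ⟨f⟩ ⟨g⟩ => ⟨f.trans g⟩ }

variable (T P) in
/-- `π₀(ASCIR(B, Π, P))`: isomorphism classes of ASCIRs over the identity of `B`. -/
def IsoClasses : Type (max (u + 1) v) := Quotient (isoSetoid.{u, v} T P)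

/-- The isomorphism class of an ASCIR. -/
def cls (M : ASCIR.{u} T P) : IsoClasses.{u} T P := Quotient.mk _ M

/-- `N = M₁ ⊗ M₂`, relative to the characteristic form `Θ`. -/
def IsTensorProduct (Θ : MForm k 2 B) (M₁ M₂ N : ASCIR.{u} T P) : Prop :=
  ∃ q, FormOver.IsTensorQuotient T Θ M₁.1 M₂.1 N.1 q

end ASCIR

end Over

end Realization

end

open Realization

/-! ### Calculus of alternating forms on vector spaces. -/

namespace Realization

section VectorSpace

open ContinuousAlternatingMap hiding map_sum
open Set

variable {E F G K : Type*} [NormedAddCommGroup E] [NormedSpace ℝ E]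
  [NormedAddCommGroup F] [NormedSpace ℝ F] [NormedAddCommGroup G] [NormedSpace ℝ G]
  [NormedAddCommGroup K] [NormedSpace ℝ K]

/-! The fibres of every realization with period bundle P are torsors under T = ν*ℱ/P. A local
section σ of M₂ therefore identifies M₁ with M₁ ⊗ M₂ over its domain by m ↦ [m, σ(π m)]. In this
picture the form of the tensor product is ω₁ + π*(σ*ω₂ - Θ). The proof constructs M₁ ⊗ M₂ by gluing
these pieces of M₁ along changes of section.

The torsor structure requires an honest smooth action, obtained without a flow theorem. Over a frame
da₁, …, daₙ of ν*ℱ, isotropy of the fibres and the horizontality of dω give, by a relative Poincaré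
lemma, a fibrewise primitive of ω (`exists_fiber_primitive`). Its components in the frame are fibre
coordinates in which the field ω♯(π*daᵢ) is ∂/∂tᵢ and ω is translation invariant
(`exists_fiber_box`, `IsASCIR.exists_isBox`). Compactness and connectedness of the fibres give such
boxes of uniform size over a neighbourhood in B, so small translations exist everywhere there and
compose to an action of ℝⁿ (`exists_additive_extension`, `IsASCIR.exists_isAction`). Its orbits are
open in the connected fibres, hence it is transitive on them (`exists_action_eq`), and its
stabilizers are given by P (`action_eq_self_iff`).

Translating a map f into M by a variable amount τ changes f*ω only by terms built from dτ and the
base covectors daᵢ (`form_tder_action`). On the anti-diagonal the corrections from the two factors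
have opposite signs and cancel. Hence ω₁ ⊕ ω₂ - Θ descends to the quotient, and the forms on the
glued pieces agree (`exists_local_lift`, `form_transition`).

Both σ*ω₂ and Θ restrict to the leafwise almost symplectic form (`form_section_leaf`), so their
difference vanishes on pairs of leaf vectors. Adding its pull-back to ω₁ preserves non-degeneracy,
isotropy of the fibres, the almost Poisson property and the Hamiltonian fields of conormal
covectors, hence the period bundle (`isASCIR_tensor`). The twisting form follows from σ*π*η₂ = η₂.

Functoriality uses only the defining properties of the quotient: a pair of isomorphisms maps orbits
to orbits, and local sections of the quotient map show that the induced map is smooth and preserves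
the forms (`exists_map`). Uniqueness is surjectivity of the quotient map, and the operation on
classes follows. -/

theorem contDiffAt_clm [FiniteDimensional ℝ E] {N : WithTop ℕ∞} {f : G → E →L[ℝ] F} {x : G}
    (h : ∀ e, ContDiffAt ℝ N (fun y => f y e) x) : ContDiffAt ℝ N f x := by
  let e₁ := ContinuousLinearEquiv.ofFinrankEq
    (Module.finrank_fin_fun ℝ (n := Module.finrank ℝ E)).symm
  let e₂ := (e₁.arrowCongr (1 : F ≃L[ℝ] F)).trans
    (ContinuousLinearEquiv.piRing (Fin (Module.finrank ℝ E)))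
  rw [← Function.id_comp f, ← e₂.symm_comp_self]
  exact e₂.symm.contDiff.contDiffAt.comp x (contDiffAt_pi.mpr fun i => h _)

/-- In finite dimension a form is as smooth as its values on constant vectors. -/
theorem contDiffAt_form [FiniteDimensional ℝ E] {N : WithTop ℕ∞} {r : ℕ}
    {f : F → E [⋀^Fin r]→L[ℝ] G} {x : F}
    (h : ∀ v : Fin r → E, ContDiffAt ℝ N (fun y => f y v) x) : ContDiffAt ℝ N f x := by
  induction r with
  | zero =>
    have h0 := (constOfIsEmptyLIE ℝ E G (Fin 0)).contDiff.contDiffAt.comp x (h ![])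
    refine h0.congr_of_eventuallyEq (Filter.Eventually.of_forall fun y => ?_)
    ext v
    simp [Subsingleton.elim v ![]]
  | succ r ih =>
    have h1 : ContDiffAt ℝ N (fun y => (f y).curryLeft) x := by
      exact contDiffAt_clm (F := E [⋀^Fin r]→L[ℝ] G) fun e =>
        ih (f := fun y => (f y).curryLeft e) fun v => h _
    have h2 := (alternatizeUncurryFinCLM ℝ E G (n := r)).contDiff.contDiffAt.comp x h1
    -- Alternatizing the curried form returns r + 1 copies of it, one for each slot, whence the
    -- normalization.
    have h3 := h2.const_smul (((r : ℝ) + 1)⁻¹)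
    refine h3.congr_of_eventuallyEq (Filter.Eventually.of_forall fun y => ?_)
    have h5 : alternatizeUncurryFinCLM ℝ E G (f y).curryLeft = (r + 1) • f y :=
      alternatizeUncurryFin_curryLeft _
    have h6 : ((r : ℝ) + 1) ≠ 0 := by positivity
    simp only [Function.comp, h5]
    rw [← Nat.cast_smul_eq_nsmul ℝ, smul_smul]
    push_cast
    rw [inv_mul_cancel₀ h6, one_smul]

/-- Currying off one argument at a time reduces this to the smoothness of evaluating a linear map.
Finite dimension is not needed here. -/
theorem contDiffAt_form_apply {N : WithTop ℕ∞} {r : ℕ}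
    {f : F → E [⋀^Fin r]→L[ℝ] G} {g : F → Fin r → E} {x : F} (hf : ContDiffAt ℝ N f x)
    (hg : ContDiffAt ℝ N g x) : ContDiffAt ℝ N (fun y => f y (g y)) x := by
  induction r with
  | zero =>
    have := (apply ℝ E G (![] : Fin 0 → E)).contDiff.contDiffAt.comp x hf
    refine this.congr_of_eventuallyEq (Filter.Eventually.of_forall fun y => ?_)
    simp [Subsingleton.elim (g y) ![]]
  | succ r ih =>
    have hc : ContDiff ℝ N (fun A : E [⋀^Fin (r + 1)]→L[ℝ] G => A.curryLeft) :=
      @ContinuousLinearMap.contDiff ℝ (E [⋀^Fin (r + 1)]→L[ℝ] G)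
        (E →L[ℝ] E [⋀^Fin r]→L[ℝ] G) _ _ _ _ _ N (curryLeftLI (𝕜 := ℝ) (E := E) (F := G)
        (n := r)).toContinuousLinearMap
    have h1 := hc.contDiffAt.comp x hf
    have h2 := ih (h1.clm_apply (contDiffAt_pi.1 hg 0))
      (g := fun y => Fin.tail (g y)) (contDiffAt_pi.2 fun i => contDiffAt_pi.1 hg i.succ)
    refine h2.congr_of_eventuallyEq (Filter.Eventually.of_forall fun y => ?_)
    simp [Matrix.vecCons]

theorem contDiffAt_form_comp [FiniteDimensional ℝ E] {N : WithTop ℕ∞} {r : ℕ}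
    {f : F → K [⋀^Fin r]→L[ℝ] G} {g : F → E →L[ℝ] K} {x : F} (hf : ContDiffAt ℝ N f x)
    (hg : ContDiffAt ℝ N g x) :
    ContDiffAt ℝ N (fun y => (f y).compContinuousLinearMap (g y)) x :=
  contDiffAt_form fun v => contDiffAt_form_apply (g := fun y i => g y (v i)) hf
    (contDiffAt_pi.2 fun _ => hg.clm_apply contDiffAt_const)

/-- The exterior derivative of a 2-form, on constant vectors. -/
theorem extDeriv_two_apply {A : E → E [⋀^Fin 2]→L[ℝ] ℝ} {x : E}
    (u v w : E) : extDeriv A x ![u, v, w] =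
      fderiv ℝ A x u ![v, w] - fderiv ℝ A x v ![u, w] + fderiv ℝ A x w ![u, v] := by
  have e0 : (0 : Fin 3).removeNth ![u, v, w] = ![v, w] := by
    ext i; fin_cases i <;> rfl
  have e1 : (1 : Fin 3).removeNth ![u, v, w] = ![u, w] := by
    ext i; fin_cases i <;> rfl
  have e2 : (2 : Fin 3).removeNth ![u, v, w] = ![u, v] := by
    ext i; fin_cases i <;> rfl
  rw [extDeriv, alternatizeUncurryFin_apply, Fin.sum_univ_three, e0, e1, e2]
  simp [sub_eq_add_neg]

theorem form_swap (A : E [⋀^Fin 2]→L[ℝ] ℝ) (u v : E) : A ![u, v] = -A ![v, u] := by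
  have h := A.toAlternatingMap.map_swap ![v, u] (i := 0) (j := 1) (by simp)
  have e : ![v, u] ∘ Equiv.swap (0 : Fin 2) 1 = ![u, v] := by
    ext i; fin_cases i <;> rfl
  rw [e] at h
  exact h

/-- A 2-form as a bilinear map. -/
noncomputable def pairing : (E [⋀^Fin 2]→L[ℝ] ℝ) →L[ℝ] E →L[ℝ] E →L[ℝ] ℝ :=
  ((ContinuousLinearMap.compL ℝ E (E [⋀^Fin 1]→L[ℝ] ℝ) (E →L[ℝ] ℝ)
    ((ContinuousLinearMap.compL ℝ E (E [⋀^Fin 0]→L[ℝ] ℝ) ℝ (apply ℝ E ℝ ![])).comp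
      curryLeftLI.toContinuousLinearMap))).comp curryLeftLI.toContinuousLinearMap

theorem pairing_apply (A : E [⋀^Fin 2]→L[ℝ] ℝ) (u v : E) : pairing A u v = A ![u, v] := rfl

end VectorSpace
end Realization

/-! ### Integrals depending on parameters and the smooth inverse function theorem. -/

namespace Realization

section VectorSpace

open Set

/-- Differentiation under the integral sign over `[0, 1]`, for an integrand which is `C¹` around the
compact set of integration. -/
theorem hasFDerivAt_integral_unitInterval {E F : Type*} [NormedAddCommGroup E] [NormedSpace ℝ E]
    [FiniteDimensional ℝ E] [NormedAddCommGroup F] [NormedSpace ℝ F] [CompleteSpace F]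
    {g : E × ℝ → F} {U : Set E} (hU : IsOpen U)
    (hg : ∀ z ∈ U, ∀ s ∈ Icc (0 : ℝ) 1, ContDiffAt ℝ 1 g (z, s)) {z : E} (hz : z ∈ U) :
    HasFDerivAt (fun z => ∫ s in (0 : ℝ)..1, g (z, s))
      (∫ s in (0 : ℝ)..1, (fderiv ℝ g (z, s)).comp (ContinuousLinearMap.inl ℝ E ℝ)) z := by
  obtain ⟨r, hr, hrU⟩ := Metric.isOpen_iff.1 hU z hz
  have hsub : Metric.closedBall z (r / 2) ⊆ U :=
    (Metric.closedBall_subset_ball (by linarith)).trans hrU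
  -- On this compact set the partial derivative is bounded, and the constant bound is the dominating
  -- function.
  have hc : IsCompact (Metric.closedBall z (r / 2) ×ˢ Icc (0 : ℝ) 1) :=
    (isCompact_closedBall _ _).prod isCompact_Icc
  have hcont : ∀ z ∈ U, ContinuousOn (fun s => g (z, s)) (Icc 0 1) := fun z hz s hs =>
    ((hg z hz s hs).continuousAt.comp (f := fun s => (z, s)) (by fun_prop)).continuousWithinAt
  have hdat : ∀ z ∈ U, ∀ s ∈ Icc (0 : ℝ) 1, ContinuousAt
      (fun p => (fderiv ℝ g p).comp (ContinuousLinearMap.inl ℝ E ℝ)) (z, s) := fun z hz s hs =>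
    ((hg z hz s hs).fderiv_right (m := 0) (by simp)).continuousAt.clm_comp continuousAt_const
  have hdc : ContinuousOn (fun p => (fderiv ℝ g p).comp (ContinuousLinearMap.inl ℝ E ℝ))
      (Metric.closedBall z (r / 2) ×ˢ Icc (0 : ℝ) 1) := fun p hp =>
    (hdat p.1 (hsub hp.1) p.2 hp.2).continuousWithinAt
  obtain ⟨C, hC⟩ := hc.exists_bound_of_continuousOn hdc
  have hI : uIoc (0 : ℝ) 1 = Ioc 0 1 := uIoc_of_le zero_le_one
  have hI' : Ioc (0 : ℝ) 1 ⊆ Icc 0 1 := Ioc_subset_Icc_self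
  refine intervalIntegral.hasFDerivAt_integral_of_dominated_of_fderiv_le
    (F' := fun z s => (fderiv ℝ g (z, s)).comp (ContinuousLinearMap.inl ℝ E ℝ))
    (s := Metric.ball z (r / 2)) (bound := fun _ => C) (Metric.ball_mem_nhds _ (by linarith))
    ?_ ?_ ?_ ?_ ?_ ?_
  · filter_upwards [hU.mem_nhds hz] with z hz
    rw [hI]
    exact ((hcont z hz).mono hI').aestronglyMeasurable measurableSet_Ioc
  · apply ContinuousOn.intervalIntegrable
    rw [uIcc_of_le zero_le_one]
    exact hcont z hz
  · rw [hI]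
    refine ContinuousOn.aestronglyMeasurable (fun s hs => ?_) measurableSet_Ioc
    exact ((hdat z hz s (hI' hs)).comp (f := fun s => (z, s)) (by fun_prop)).continuousWithinAt
  · refine Filter.Eventually.of_forall fun s hs z' hz' => hC (z', s) ⟨?_, hI' (hI ▸ hs)⟩
    exact Metric.ball_subset_closedBall hz'
  · simp
  · refine Filter.Eventually.of_forall fun s hs z' hz' => ?_
    have h1 := ((hg z' (hsub (Metric.ball_subset_closedBall hz')) s
      (hI' (hI ▸ hs))).differentiableAt (by simp)).hasFDerivAt
    exact h1.comp z' (hasFDerivAt_prodMk_left z' s)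

/-- The derivative of the integral is an integral of the same kind with values in `E →L[ℝ] F`, so
the order of smoothness rises by induction. Both spaces share a universe so that this new target is
again admissible. -/
theorem contDiffOn_integral_unitInterval {E : Type u} [NormedAddCommGroup E] [NormedSpace ℝ E]
    [FiniteDimensional ℝ E] {F : Type u} [NormedAddCommGroup F] [NormedSpace ℝ F] [CompleteSpace F]
    {g : E × ℝ → F} {U : Set E} (hU : IsOpen U)
    (hg : ∀ z ∈ U, ∀ s ∈ Icc (0 : ℝ) 1, ContDiffAt ℝ ∞ g (z, s)) :
    ContDiffOn ℝ ∞ (fun z => ∫ s in (0 : ℝ)..1, g (z, s)) U := by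
  rw [contDiffOn_infty]
  intro n
  induction n generalizing F with
  | zero =>
    refine contDiffOn_zero.2 fun z hz => ?_
    exact (hasFDerivAt_integral_unitInterval hU (fun z hz s hs =>
      (hg z hz s hs).of_le (by exact_mod_cast le_top)) hz).continuousAt.continuousWithinAt
  | succ n ih =>
    have hd : ∀ z ∈ U, HasFDerivAt _ _ z := fun z hz => hasFDerivAt_integral_unitInterval hU
      (fun z hz s hs => (hg z hz s hs).of_le (by exact_mod_cast le_top)) hz
    push_cast
    rw [contDiffOn_succ_iff_fderiv_of_isOpen hU]
    refine ⟨fun z hz => (hd z hz).differentiableAt.differentiableWithinAt, by simp, ?_⟩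
    refine (ih (F := E →L[ℝ] F)
      (g := fun p => (fderiv ℝ g p).comp (ContinuousLinearMap.inl ℝ E ℝ)) ?_).congr
      fun z hz => (hd z hz).fderiv
    exact fun z hz s hs => ((hg z hz s hs).fderiv_right (m := ∞) (by simp)).clm_comp
      contDiffAt_const

/-- The inverse function theorem for smooth functions, with a smooth inverse on the whole target. -/
theorem exists_openPartialHomeomorph {E F : Type*} [NormedAddCommGroup E] [NormedSpace ℝ E]
    [FiniteDimensional ℝ E] [NormedAddCommGroup F] [NormedSpace ℝ F] [FiniteDimensional ℝ F]
    {f : E → F} {U : Set E} (hU : IsOpen U)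
    (hf : ContDiffOn ℝ ∞ f U) {x : E} (hx : x ∈ U)
    (hb : Function.Bijective (fderiv ℝ f x)) :
    ∃ e : OpenPartialHomeomorph E F, x ∈ e.source ∧ e.source ⊆ U ∧ (∀ y, e y = f y) ∧
      ContDiffOn ℝ ∞ e.symm e.target ∧
      ∀ y ∈ e.source, Function.Bijective (fderiv ℝ f y) := by
  have hequiv : ∀ L : E →L[ℝ] F, Function.Bijective L →
      L ∈ range ((↑) : (E ≃L[ℝ] F) → E →L[ℝ] F) := fun L hL =>
    ⟨(LinearEquiv.ofBijective (L : E →ₗ[ℝ] F) hL).toContinuousLinearEquiv, by ext; rfl⟩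
  obtain ⟨L, hL⟩ := hequiv _ hb
  have hd : ∀ y ∈ U, ContDiffAt ℝ ∞ f y := fun y hy => hf.contDiffAt (hU.mem_nhds hy)
  have hfx : HasFDerivAt f (L : E →L[ℝ] F) x := by
    rw [hL]
    exact ((hd x hx).differentiableAt (by simp)).hasFDerivAt
  let e₀ := (hd x hx).toOpenPartialHomeomorph f hfx (by simp)
  -- The source is cut down to the points with invertible derivative. There the inverse is smooth,
  -- so it is smooth on the whole target and not only at the image of `x`.
  have hV : IsOpen (U ∩ fderiv ℝ f ⁻¹' range ((↑) : (E ≃L[ℝ] F) → E →L[ℝ] F)) :=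
    (hf.continuousOn_fderiv_of_isOpen hU (by simp)).isOpen_inter_preimage hU
      ContinuousLinearEquiv.isOpen
  let e := e₀.restrOpen _ hV
  have hes : e.source = e₀.source ∩ _ := e₀.restrOpen_source _ hV
  refine ⟨e, ?_, ?_, fun y => rfl, ?_, ?_⟩
  · rw [hes]
    exact ⟨(hd x hx).mem_toOpenPartialHomeomorph_source hfx (by simp), hx, L, hL⟩
  · rw [hes]
    exact fun y hy => hy.2.1
  · intro y hy
    have hy' : e.symm y ∈ e.source := e.map_target hy
    rw [hes] at hy'
    obtain ⟨-, hyU, L', hL'⟩ := hy'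
    refine ContDiffAt.contDiffWithinAt ?_
    refine e.contDiffAt_symm (f₀' := L') hy ?_ (hd _ hyU)
    rw [hL']
    exact ((hd _ hyU).differentiableAt (by simp)).hasFDerivAt
  · intro y hy
    rw [hes] at hy
    obtain ⟨-, hyU, L', hL'⟩ := hy
    rw [← hL']
    exact L'.bijective

end VectorSpace
end Realization

/-! ### The relative Poincaré lemma and fibrewise primitives of 2-forms. -/

namespace Realization

section VectorSpace

open Set

theorem minSmoothness_two_le : minSmoothness ℝ 2 ≤ (∞ : WithTop ℕ∞) := by
  rw [minSmoothness_of_isRCLikeNormedField]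
  exact WithTop.coe_le_coe.2 le_top

section Mixed

variable {G K F : Type u} [NormedAddCommGroup G] [NormedSpace ℝ G] [FiniteDimensional ℝ G]
  [NormedAddCommGroup K] [NormedSpace ℝ K] [FiniteDimensional ℝ K]
  [NormedAddCommGroup F] [NormedSpace ℝ F] [CompleteSpace F]

/-- The Poincaré lemma for 1-forms along the second factor, smoothly in the first factor. -/
theorem exists_relative_primitive {β : G × K → K →L[ℝ] F} {z₀ : G × K} {r : ℝ}
    (hβ : ∀ z ∈ Metric.ball z₀ r, ContDiffAt ℝ ∞ β z)
    (hsymm : ∀ z ∈ Metric.ball z₀ r, ∀ a b : K, fderiv ℝ β z (0, a) b = fderiv ℝ β z (0, b) a) :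
    ∃ θ : G × K → F, ContDiffOn ℝ ∞ θ (Metric.ball z₀ r) ∧
      ∀ z ∈ Metric.ball z₀ r, ∀ v : K, fderiv ℝ θ z (0, v) = β z v := by
  have hb : Metric.ball z₀ r = Metric.ball z₀.1 r ×ˢ Metric.ball z₀.2 r :=
    (ball_prod_same z₀.1 z₀.2 r).symm
  -- The primitive is the integral of β along the segment from the centre in the second factor, with
  -- the first factor frozen.
  let g : (G × K) × ℝ → F := fun p =>
    β (p.1.1, AffineMap.lineMap z₀.2 p.1.2 p.2) (p.1.2 - z₀.2)
  have hmem : ∀ z ∈ Metric.ball z₀ r, ∀ s ∈ Icc (0 : ℝ) 1,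
      (z.1, AffineMap.lineMap z₀.2 z.2 s) ∈ Metric.ball z₀ r := fun z hz s hs => by
    rw [hb] at hz ⊢
    refine ⟨hz.1, (convex_ball z₀.2 r).lineMap_mem (Metric.mem_ball_self ?_) hz.2 hs⟩
    exact dist_nonneg.trans_lt hz.2
  have hg : ∀ z ∈ Metric.ball z₀ r, ∀ s ∈ Icc (0 : ℝ) 1, ContDiffAt ℝ ∞ g (z, s) := by
    intro z hz s hs
    refine ContDiffAt.clm_apply ?_ (by fun_prop)
    refine (hβ _ (hmem z hz s hs)).comp (z, s)
      (f := fun p : (G × K) × ℝ => (p.1.1, AffineMap.lineMap z₀.2 p.1.2 p.2)) ?_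
    simp only [AffineMap.lineMap_apply, vsub_eq_sub, vadd_eq_add]
    fun_prop
  have hθ := contDiffOn_integral_unitInterval Metric.isOpen_ball hg
  refine ⟨_, hθ, fun z hz v => ?_⟩
  have hz' := hz
  rw [hb] at hz'
  have hline : ∀ y ∈ Metric.ball z₀.2 r, (z.1, y) ∈ Metric.ball z₀ r := fun y hy => by
    rw [hb]
    exact ⟨hz'.1, hy⟩
  have hdβ : ∀ y ∈ Metric.ball z₀.2 r, HasFDerivAt (fun y => β (z.1, y))
      ((fderiv ℝ β (z.1, y)).comp (ContinuousLinearMap.inr ℝ G K)) y := fun y hy =>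
    ((hβ _ (hline y hy)).differentiableAt (by simp)).hasFDerivAt.comp y
      (hasFDerivAt_prodMk_right _ _)
  -- For fixed first coordinate this is the Poincaré lemma on a convex set. The parametric integral
  -- supplies joint smoothness, and uniqueness of derivatives matches the two.
  have hP := (convex_ball z₀.2 r).hasFDerivWithinAt_curveIntegral_segment_of_hasFDerivWithinAt_symmetric
    (fun y hy => (hdβ y hy).hasFDerivWithinAt) (fun y hy a _ b _ => hsymm _ (hline y hy) a b)
    (Metric.mem_ball_self (dist_nonneg.trans_lt hz'.2)) hz'.2
  have hP' := hP.hasFDerivAt (Metric.isOpen_ball.mem_nhds hz'.2)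
  have hθ' := HasFDerivAt.comp (f := fun y => (z.1, y)) z.2
    ((hθ.contDiffAt (Metric.isOpen_ball.mem_nhds hz)).differentiableAt (by simp)).hasFDerivAt
    (hasFDerivAt_prodMk_right z.1 z.2)
  have he : (fun y => ∫ᶜ x in .segment z₀.2 y, β (z.1, x)) =
      (fun z => ∫ s in (0 : ℝ)..1, g (z, s)) ∘ fun y => (z.1, y) := by
    funext y
    simp only [curveIntegral_segment, Function.comp, g]
  rw [he] at hP'
  exact congrArg (fun L => L v) (hθ'.unique hP')

/-- The mixed part of a 2-form on a product. -/
noncomputable def mixedPart (A : (G × K) [⋀^Fin 2]→L[ℝ] ℝ) : K →L[ℝ] G →L[ℝ] ℝ :=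
  (((pairing A).comp (ContinuousLinearMap.inr ℝ G K)).flip.comp
    (ContinuousLinearMap.inl ℝ G K)).flip

theorem contDiffAt_mixedPart {A : G × K → (G × K) [⋀^Fin 2]→L[ℝ] ℝ} {z : G × K}
    (hA : ContDiffAt ℝ ∞ A z) : ContDiffAt ℝ ∞ (fun z => mixedPart (A z)) z :=
  contDiffAt_clm fun v => contDiffAt_clm fun w =>
    contDiffAt_form_apply (g := fun _ => ![(0, v), (w, 0)]) hA contDiffAt_const

theorem fderiv_mixedPart {A : G × K → (G × K) [⋀^Fin 2]→L[ℝ] ℝ} {z : G × K}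
    (hA : ContDiffAt ℝ ∞ A z) (u : G × K) (v : K) (w : G) :
    fderiv ℝ (fun z => mixedPart (A z)) z u v w = fderiv ℝ A z u ![(0, v), (w, 0)] := by
  have h1 := (((contDiffAt_mixedPart hA).differentiableAt (by simp)).hasFDerivAt.clm_apply
    (hasFDerivAt_const v z)).clm_apply (hasFDerivAt_const w z)
  have h2 := (hA.differentiableAt (by simp)).hasFDerivAt.continuousAlternatingMap_apply_const
    ![((0 : G), v), (w, (0 : K))]
  have h3 := congrArg (fun L => L u) (h1.unique h2)
  simpa using h3

/-- The relative Poincaré lemma for the mixed part of a 2-form on a product. -/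
theorem exists_fiber_primitive_prod {A : G × K → (G × K) [⋀^Fin 2]→L[ℝ] ℝ} {z₀ : G × K} {r : ℝ}
    (hA : ContDiffOn ℝ ∞ A (Metric.ball z₀ r))
    (hiso : ∀ z ∈ Metric.ball z₀ r, ∀ u v : K, A z ![(0, u), (0, v)] = 0)
    (hcl : ∀ z ∈ Metric.ball z₀ r, ∀ u v w : G × K, u.1 = 0 → extDeriv A z ![u, v, w] = 0) :
    ∃ θ : G × K → G →L[ℝ] ℝ, ContDiffOn ℝ ∞ θ (Metric.ball z₀ r) ∧
      ∀ z ∈ Metric.ball z₀ r, ∀ (v : K) (w : G), fderiv ℝ θ z (0, v) w = A z ![(0, v), (w, 0)] := by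
  have hAd : ∀ z ∈ Metric.ball z₀ r, ContDiffAt ℝ ∞ A z := fun z hz =>
    hA.contDiffAt (Metric.isOpen_ball.mem_nhds hz)
  obtain ⟨θ, hθ, h⟩ := exists_relative_primitive (β := fun z => mixedPart (A z)) (z₀ := z₀) (r := r)
    (fun z hz => contDiffAt_mixedPart (hAd z hz)) (fun z hz a b => by
      ext e
      rw [fderiv_mixedPart (hAd z hz), fderiv_mixedPart (hAd z hz)]
      have h1 := hcl z hz (0, a) (0, b) (e, 0) rfl
      rw [extDeriv_two_apply] at h1
      -- Isotropy makes this coefficient vanish identically, so the closedness identity retains only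
      -- the two terms that express symmetry along the fibre.
      have h2 : fderiv ℝ A z (e, 0) ![(0, a), (0, b)] = 0 := by
        have h3 := ((hAd z hz).differentiableAt
          (by simp)).hasFDerivAt.continuousAlternatingMap_apply_const ![((0 : G), a), ((0 : G), b)]
        have h4 : (fun _ => (0 : ℝ)) =ᶠ[𝓝 z] fun z => A z ![(0, a), (0, b)] := by
          filter_upwards [Metric.isOpen_ball.mem_nhds hz] with x hx
          exact (hiso x hx a b).symm
        have h5 := congrArg (fun L => L (e, 0))
          ((h3.congr_of_eventuallyEq h4).unique (hasFDerivAt_const (0 : ℝ) _))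
        simpa using h5
      rw [h2, add_zero, sub_eq_zero] at h1
      exact h1)
  exact ⟨θ, hθ, fun z hz v w => by rw [h z hz]; rfl⟩

end Mixed

section Submersion

variable {E G : Type u} [NormedAddCommGroup E] [NormedSpace ℝ E] [FiniteDimensional ℝ E]
  [NormedAddCommGroup G] [NormedSpace ℝ G] [FiniteDimensional ℝ G]

set_option maxHeartbeats 1000000 in
/-- The fibrewise primitive of a 2-form whose fibres are isotropic and whose exterior derivative is
horizontal. -/
theorem exists_fiber_primitive {U : Set E} (hU : IsOpen U) {p : E → G} (hp : ContDiffOn ℝ ∞ p U)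
    {A : E → E [⋀^Fin 2]→L[ℝ] ℝ} (hA : ContDiffOn ℝ ∞ A U)
    (hiso : ∀ x ∈ U, ∀ u v, fderiv ℝ p x u = 0 → fderiv ℝ p x v = 0 → A x ![u, v] = 0)
    (hcl : ∀ x ∈ U, ∀ u v w, fderiv ℝ p x u = 0 → extDeriv A x ![u, v, w] = 0)
    {x₀ : E} (hx₀ : x₀ ∈ U) (hsurj : Function.Surjective (fderiv ℝ p x₀)) :
    ∃ (V : Set E) (θ : E → G →L[ℝ] ℝ), IsOpen V ∧ x₀ ∈ V ∧ V ⊆ U ∧ ContDiffOn ℝ ∞ θ V ∧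
      ∀ x ∈ V, ∀ v w, fderiv ℝ p x v = 0 → fderiv ℝ θ x v (fderiv ℝ p x w) = A x ![v, w] := by
  let K := LinearMap.ker (fderiv ℝ p x₀ : E →ₗ[ℝ] G)
  obtain ⟨L₀, hL₀⟩ := K.exists_isCompl
  -- Together with `p`, a projection to the kernel of its derivative straightens the submersion to a
  -- product projection near the point.
  let L : E →L[ℝ] K := LinearMap.toContinuousLinearMap (K.projectionOnto L₀ hL₀)
  have hLK : ∀ v : K, L v = v := fun v => Submodule.projectionOnto_apply_left hL₀ v
  have hpd : ∀ x ∈ U, ContDiffAt ℝ ∞ p x := fun x hx => hp.contDiffAt (hU.mem_nhds hx)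
  have hfd : ∀ x ∈ U, HasFDerivAt (fun x => (p x, L x)) ((fderiv ℝ p x).prod L) x := fun x hx =>
    ((hpd x hx).differentiableAt (by simp)).hasFDerivAt.prodMk L.hasFDerivAt
  have hf : ContDiffOn ℝ ∞ (fun x => (p x, L x)) U := hp.prodMk L.contDiff.contDiffOn
  have hbij : Function.Bijective (fderiv ℝ (fun x => (p x, L x)) x₀) := by
    rw [(hfd x₀ hx₀).fderiv]
    constructor
    · rw [injective_iff_map_eq_zero]
      intro v hv
      have h1 : fderiv ℝ p x₀ v = 0 := congrArg Prod.fst hv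
      have h2 : L v = 0 := congrArg Prod.snd hv
      have h3 := hLK ⟨v, h1⟩
      rw [h2] at h3
      exact (congrArg Subtype.val h3).symm
    · rintro ⟨g, κ⟩
      obtain ⟨v, rfl⟩ := hsurj g
      refine ⟨v + ((κ - L v : K) : E), ?_⟩
      have h1 : fderiv ℝ p x₀ ((κ - L v : K) : E) = 0 := (κ - L v).2
      ext1
      · simp only [ContinuousLinearMap.prod_apply, map_add, h1, Prod.fst_add, add_zero]
      · simp only [ContinuousLinearMap.prod_apply, map_add, hLK, Prod.snd_add, add_sub_cancel]
  obtain ⟨e, hxe, heU, hef, hesm, -⟩ := exists_openPartialHomeomorph hU hf hx₀ hbij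
  have hef' : (e : E → G × K) = fun x => (p x, L x) := funext hef
  have hzt : e x₀ ∈ e.target := e.map_source hxe
  obtain ⟨r, hr, hrt⟩ := Metric.isOpen_iff.1 e.open_target _ hzt
  have hsd : ∀ z ∈ e.target, ContDiffAt ℝ ∞ e.symm z := fun z hz =>
    hesm.contDiffAt (e.open_target.mem_nhds hz)
  have hsU : ∀ z ∈ e.target, e.symm z ∈ U := fun z hz => heU (e.map_target hz)
  have hinv : ∀ z ∈ e.target, ∀ u, fderiv ℝ p (e.symm z) (fderiv ℝ e.symm z u) = u.1 ∧
      L (fderiv ℝ e.symm z u) = u.2 := by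
    intro z hz u
    have h1 := (hfd _ (hsU z hz)).comp z ((hsd z hz).differentiableAt (by simp)).hasFDerivAt
    have h2 : id =ᶠ[𝓝 z] (fun x => (p x, L x)) ∘ e.symm := by
      filter_upwards [e.open_target.mem_nhds hz] with y hy
      have := e.right_inv hy
      rw [hef'] at this
      exact this.symm
    have h3 := congrArg (fun M => M u) ((h1.congr_of_eventuallyEq h2).unique (hasFDerivAt_id z))
    exact ⟨congrArg Prod.fst h3, congrArg Prod.snd h3⟩
  let A' : G × K → (G × K) [⋀^Fin 2]→L[ℝ] ℝ := fun z =>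
    (A (e.symm z)).compContinuousLinearMap (fderiv ℝ e.symm z)
  have hAd : ∀ x ∈ U, ContDiffAt ℝ ∞ A x := fun x hx => hA.contDiffAt (hU.mem_nhds hx)
  obtain ⟨θ, hθ, hθA⟩ := exists_fiber_primitive_prod (A := A') (z₀ := e x₀) (r := r)
    (fun z hz => ContDiffAt.contDiffWithinAt <| contDiffAt_form_comp
      ((hAd _ (hsU z (hrt hz))).comp z (hsd z (hrt hz)))
      ((hsd z (hrt hz)).fderiv_right (m := ∞) (by simp)))
    (fun z hz u v => by
      have h1 := hinv z (hrt hz) (0, u)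
      have h2 := hinv z (hrt hz) (0, v)
      have h3 := hiso _ (hsU z (hrt hz)) _ _ h1.1 h2.1
      rw [← h3]
      simp only [A', ContinuousAlternatingMap.compContinuousLinearMap_apply]
      congr 1
      ext i; fin_cases i <;> rfl)
    (fun z hz u v w hu => by
      have h1 := hinv z (hrt hz) u
      rw [extDeriv_pullback ((hAd _ (hsU z (hrt hz))).differentiableAt (by simp))
        (hsd z (hrt hz)) minSmoothness_two_le]
      have h3 := hcl _ (hsU z (hrt hz)) _ (fderiv ℝ e.symm z v) (fderiv ℝ e.symm z w)
        (h1.1.trans hu)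
      rw [← h3]
      simp only [ContinuousAlternatingMap.compContinuousLinearMap_apply]
      congr 1
      ext i; fin_cases i <;> rfl)
  have hed : ∀ x ∈ e.source, ContDiffAt ℝ ∞ e x := fun x hx => by
    rw [hef']
    exact hf.contDiffAt (hU.mem_nhds (heU hx))
  have hVo : IsOpen (e.source ∩ e ⁻¹' Metric.ball (e x₀) r) :=
    e.isOpen_inter_preimage Metric.isOpen_ball
  refine ⟨_, θ ∘ e, hVo, ⟨hxe, Metric.mem_ball_self hr⟩, fun x hx => heU hx.1, ?_, ?_⟩
  · intro x hx
    exact ((hθ.contDiffAt (Metric.isOpen_ball.mem_nhds hx.2)).comp x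
      (hed x hx.1)).contDiffWithinAt
  · intro x hx v w hv
    have hxU := heU hx.1
    have h1 := ((hθ.contDiffAt (Metric.isOpen_ball.mem_nhds hx.2)).differentiableAt
      (by simp)).hasFDerivAt.comp x ((hed x hx.1).differentiableAt (by simp)).hasFDerivAt
    have h2 : fderiv ℝ e x = (fderiv ℝ p x).prod L := by
      rw [hef']
      exact (hfd x hxU).fderiv
    rw [h1.fderiv, h2]
    have hxs : e.symm (e x) = x := e.left_inv hx.1
    have h3 := hinv (e x) (e.map_source hx.1)
    rw [hxs] at h3
    have h4 := hθA (e x) hx.2 (L v) (fderiv ℝ p x w)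
    simp only [ContinuousLinearMap.comp_apply, ContinuousLinearMap.prod_apply, hv]
    rw [h4]
    simp only [A', ContinuousAlternatingMap.compContinuousLinearMap_apply, hxs]
    -- injectivity of `(Dp, L)` at `x`
    have hinj : ∀ a, fderiv ℝ p x a = 0 → L a = 0 → a = 0 := by
      intro a ha hLa
      have hc := ((hsd (e x) (e.map_source hx.1)).differentiableAt (by simp)).hasFDerivAt.comp x
        ((hed x hx.1).differentiableAt (by simp)).hasFDerivAt
      have hid : id =ᶠ[𝓝 x] e.symm ∘ e := by
        filter_upwards [e.open_source.mem_nhds hx.1] with y hy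
        exact (e.left_inv hy).symm
      have h5 := congrArg (fun M => M a) ((hc.congr_of_eventuallyEq hid).unique (hasFDerivAt_id x))
      simp only [ContinuousLinearMap.comp_apply, h2, ContinuousLinearMap.prod_apply, ha, hLa] at h5
      have h6 : ((0 : G), (0 : K)) = 0 := rfl
      rw [h6, map_zero] at h5
      exact h5.symm
    have hv' : fderiv ℝ e.symm (e x) (0, L v) = v := by
      rw [← sub_eq_zero]
      apply hinj
      · rw [map_sub, (h3 _).1, hv, sub_zero]
      · rw [map_sub, (h3 _).2, sub_self]
    -- Against a vertical vector the form sees only the image of `w` in the base: two lifts differ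
    -- by a vertical vector, and the fibres are isotropic.
    have hw' : A x ![v, fderiv ℝ e.symm (e x) (fderiv ℝ p x w, 0) - w] = 0 := by
      refine hiso x hxU _ _ hv ?_
      rw [map_sub, (h3 _).1, sub_self]
    rw [← pairing_apply, map_sub, sub_eq_zero, pairing_apply, pairing_apply] at hw'
    rw [← hw']
    congr 1
    ext i; fin_cases i
    · exact hv'
    · rfl

end Submersion

end VectorSpace
end Realization

/-! ### Fibre coordinates dual to a frame of exact 1-forms. -/

namespace Realization

section VectorSpace

open Set

variable {E G : Type u} [NormedAddCommGroup E] [NormedSpace ℝ E] [FiniteDimensional ℝ E]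
  [NormedAddCommGroup G] [NormedSpace ℝ G] {n : ℕ}

/-- The covector `∑ cᵢ daᵢ`. -/
noncomputable def frameCovector (a : Fin n → G → ℝ) (y : G) : (Fin n → ℝ) →L[ℝ] G →L[ℝ] ℝ :=
  ∑ i, (ContinuousLinearMap.proj (R := ℝ) (φ := fun _ : Fin n => ℝ) i).smulRight (fderiv ℝ (a i) y)

theorem frameCovector_apply (a : Fin n → G → ℝ) (y : G) (c : Fin n → ℝ) :
    frameCovector a y c = ∑ i, c i • fderiv ℝ (a i) y := by
  simp [frameCovector]

theorem contDiffOn_frameCovector {a : Fin n → G → ℝ} {V : Set G} (hV : IsOpen V)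
    (ha : ∀ i, ContDiffOn ℝ ∞ (a i) V) : ContDiffOn ℝ ∞ (frameCovector a) V := by
  refine ContDiffOn.congr (f := fun y => ∑ i, (ContinuousLinearMap.smulRightL ℝ (Fin n → ℝ)
    (G →L[ℝ] ℝ) (ContinuousLinearMap.proj (R := ℝ) (φ := fun _ : Fin n => ℝ) i))
      (fderiv ℝ (a i) y)) ?_ (fun y _ => rfl)
  refine ContDiffOn.sum fun i _ => ?_
  exact (ContinuousLinearMap.contDiff _).comp_contDiffOn ((ha i).fderiv_of_isOpen hV (by simp))

variable [FiniteDimensional ℝ G]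

/-- Coordinates in which the vector fields dual to the forms `daᵢ` are constant. -/
theorem exists_fiber_coordinates {U : Set E} (hU : IsOpen U) {p : E → G} (hp : ContDiffOn ℝ ∞ p U)
    {A : E → E [⋀^Fin 2]→L[ℝ] ℝ} (hA : ContDiffOn ℝ ∞ A U)
    (hiso : ∀ x ∈ U, ∀ u v, fderiv ℝ p x u = 0 → fderiv ℝ p x v = 0 → A x ![u, v] = 0)
    (hcl : ∀ x ∈ U, ∀ u v w, fderiv ℝ p x u = 0 → extDeriv A x ![u, v, w] = 0)
    (hsurj : ∀ x ∈ U, Function.Surjective (fderiv ℝ p x))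
    {V : Set G} (hV : IsOpen V) (hpV : MapsTo p U V) {a : Fin n → G → ℝ}
    (ha : ∀ i, ContDiffOn ℝ ∞ (a i) V) {x₀ : E} (hx₀ : x₀ ∈ U)
    (hli : Function.Injective (frameCovector a (p x₀))) :
    ∃ (W : Set E) (t : E → Fin n → ℝ), IsOpen W ∧ x₀ ∈ W ∧ W ⊆ U ∧ ContDiffOn ℝ ∞ t W ∧
      ∀ x ∈ W, ∀ v c, fderiv ℝ p x v = 0 →
        (∀ w, A x ![v, w] = frameCovector a (p x) c (fderiv ℝ p x w)) → fderiv ℝ t x v = c := by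
  obtain ⟨W₀, θ, hW₀, hxW₀, hWU, hθ, hθA⟩ :=
    exists_fiber_primitive hU hp hA hiso hcl hx₀ (hsurj x₀ hx₀)
  -- A left inverse of the frame at one point composes with nearby frames to an invertible
  -- endomorphism. Correcting by its inverse reads off the components of the primitive θ in the
  -- frame at every nearby point.
  obtain ⟨R₀, hR₀⟩ := LinearMap.exists_leftInverse_of_injective
    (frameCovector a (p x₀) : (Fin n → ℝ) →ₗ[ℝ] G →L[ℝ] ℝ) (LinearMap.ker_eq_bot.2 hli)
  let R : (G →L[ℝ] ℝ) →L[ℝ] Fin n → ℝ := LinearMap.toContinuousLinearMap R₀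
  let S : G → (Fin n → ℝ) →L[ℝ] Fin n → ℝ := fun y => R.comp (frameCovector a y)
  have hS₀ : S (p x₀) = 1 := by
    ext1 c
    exact congrArg (fun L => L c) hR₀
  have hS : ContDiffOn ℝ ∞ S V :=
    contDiffOn_const.clm_comp (contDiffOn_frameCovector hV ha)
  have hW : IsOpen (W₀ ∩ (fun x => S (p x)) ⁻¹' {L | IsUnit L}) :=
    ((hS.continuousOn.comp hp.continuousOn hpV).mono hWU).isOpen_inter_preimage hW₀ Units.isOpen
  have hJ : ∀ y ∈ V, IsUnit (S y) → ContDiffAt ℝ ∞ (fun y => Ring.inverse (S y)) y := by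
    rintro y hy ⟨L, hL⟩
    have h1 := contDiffAt_ringInverse ℝ (n := ∞) L
    rw [hL] at h1
    exact h1.comp y (hS.contDiffAt (hV.mem_nhds hy))
  have hpd : ∀ x ∈ U, ContDiffAt ℝ ∞ p x := fun x hx => hp.contDiffAt (hU.mem_nhds hx)
  have hJp : ∀ x ∈ W₀, IsUnit (S (p x)) → ContDiffAt ℝ ∞ (fun x => Ring.inverse (S (p x))) x :=
    fun x hx hu => (hJ _ (hpV (hWU hx)) hu).comp x (hpd x (hWU hx))
  have hRθ : ∀ x ∈ W₀, ContDiffAt ℝ ∞ (fun x => R (θ x)) x := fun x hx =>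
    R.contDiff.contDiffAt.comp x (hθ.contDiffAt (hW₀.mem_nhds hx))
  refine ⟨_, fun x => Ring.inverse (S (p x)) (R (θ x)), hW, ⟨hxW₀, ?_⟩, fun x hx => hWU hx.1,
    fun x hx => ((hJp x hx.1 hx.2).clm_apply (hRθ x hx.1)).contDiffWithinAt, ?_⟩
  · change IsUnit (S (p x₀))
    rw [hS₀]
    exact isUnit_one
  · intro x hx v c hv hc
    have hu : IsUnit (S (p x)) := hx.2
    have h1 := ((hJp x hx.1 hu).differentiableAt (by simp)).hasFDerivAt.clm_apply
      ((hRθ x hx.1).differentiableAt (by simp)).hasFDerivAt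
    -- The correcting factor depends on the base point alone, so it is constant in vertical
    -- directions.
    have h2 : fderiv ℝ (fun x => Ring.inverse (S (p x))) x v = 0 := by
      have h3 := (((hJ _ (hpV (hWU hx.1)) hu).differentiableAt (by simp)).hasFDerivAt.comp x
        ((hpd x (hWU hx.1)).differentiableAt (by simp)).hasFDerivAt).fderiv
      have h4 := congrArg (fun L => L v) h3
      simp only [ContinuousLinearMap.comp_apply, hv, map_zero] at h4
      exact h4
    have h5 : fderiv ℝ (fun x => R (θ x)) x v = R (fderiv ℝ θ x v) := by
      have h3 := (R.hasFDerivAt.comp x ((hθ.contDiffAt (hW₀.mem_nhds hx.1)).differentiableAt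
        (by simp)).hasFDerivAt).fderiv
      exact congrArg (fun L => L v) h3
    have h6 : fderiv ℝ θ x v = frameCovector a (p x) c := by
      ext e
      obtain ⟨w, rfl⟩ := hsurj x (hWU hx.1) e
      rw [hθA x hx.1 v w hv, hc]
    rw [h1.fderiv]
    simp only [add_apply, ContinuousLinearMap.comp_apply,
      ContinuousLinearMap.flip_apply, h2, h5, h6, zero_apply, add_zero]
    change Ring.inverse (S (p x)) (S (p x) c) = c
    have h7 := Ring.inverse_mul_cancel _ hu
    exact congrArg (fun L => L c) h7

/-- Near every point, fibre coordinates `t` complete `p` to a coordinate system, in which the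
2-form is invariant under translations along the fibres. -/
theorem exists_fiber_box {U : Set E} (hU : IsOpen U) {p : E → G} (hp : ContDiffOn ℝ ∞ p U)
    {A : E → E [⋀^Fin 2]→L[ℝ] ℝ} (hA : ContDiffOn ℝ ∞ A U)
    (hiso : ∀ x ∈ U, ∀ u v, fderiv ℝ p x u = 0 → fderiv ℝ p x v = 0 → A x ![u, v] = 0)
    (hcl : ∀ x ∈ U, ∀ u v w, fderiv ℝ p x u = 0 → extDeriv A x ![u, v, w] = 0)
    (hsurj : ∀ x ∈ U, Function.Surjective (fderiv ℝ p x))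
    {V : Set G} (hV : IsOpen V) (hpV : MapsTo p U V) {a : Fin n → G → ℝ}
    (ha : ∀ i, ContDiffOn ℝ ∞ (a i) V)
    (hnd : ∀ x ∈ U, ∀ v, (∀ w, A x ![v, w] = 0) → v = 0)
    (hsh : ∀ x ∈ U, ∀ v, fderiv ℝ p x v = 0 →
      ∃ c, ∀ w, A x ![v, w] = frameCovector a (p x) c (fderiv ℝ p x w))
    (hex : ∀ x ∈ U, ∀ c, ∃ v, fderiv ℝ p x v = 0 ∧
      ∀ w, A x ![v, w] = frameCovector a (p x) c (fderiv ℝ p x w))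
    {x₀ : E} (hx₀ : x₀ ∈ U) (hli : Function.Injective (frameCovector a (p x₀))) :
    ∃ e : OpenPartialHomeomorph E (G × (Fin n → ℝ)), x₀ ∈ e.source ∧ e.source ⊆ U ∧
      ContDiffOn ℝ ∞ e e.source ∧ ContDiffOn ℝ ∞ e.symm e.target ∧
      (∀ x ∈ e.source, (e x).1 = p x) ∧
      (∀ x ∈ e.source, ∀ v c, fderiv ℝ p x v = 0 →
        (∀ w, A x ![v, w] = frameCovector a (p x) c (fderiv ℝ p x w)) →
          fderiv ℝ e x v = (0, c)) ∧
      ∀ (y : G) (s h : Fin n → ℝ), (∀ τ ∈ Icc (0 : ℝ) 1, (y, s + τ • h) ∈ e.target) →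
        (A (e.symm (y, s + h))).compContinuousLinearMap (fderiv ℝ e.symm (y, s + h)) =
          (A (e.symm (y, s))).compContinuousLinearMap (fderiv ℝ e.symm (y, s)) := by
  obtain ⟨W, t, hW, hxW, hWU, ht, htA⟩ :=
    exists_fiber_coordinates hU hp hA hiso hcl hsurj hV hpV ha hx₀ hli
  have hpd : ∀ x ∈ U, ContDiffAt ℝ ∞ p x := fun x hx => hp.contDiffAt (hU.mem_nhds hx)
  have htd : ∀ x ∈ W, ContDiffAt ℝ ∞ t x := fun x hx => ht.contDiffAt (hW.mem_nhds hx)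
  have hfd : ∀ x ∈ W, HasFDerivAt (fun x => (p x, t x)) ((fderiv ℝ p x).prod (fderiv ℝ t x)) x :=
    fun x hx => ((hpd x (hWU hx)).differentiableAt (by simp)).hasFDerivAt.prodMk
      ((htd x hx).differentiableAt (by simp)).hasFDerivAt
  have hbij : Function.Bijective (fderiv ℝ (fun x => (p x, t x)) x₀) := by
    rw [(hfd x₀ hxW).fderiv]
    constructor
    · rw [injective_iff_map_eq_zero]
      intro v hv
      have h1 : fderiv ℝ p x₀ v = 0 := congrArg Prod.fst hv
      have h2 : fderiv ℝ t x₀ v = 0 := congrArg Prod.snd hv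
      obtain ⟨c, hc⟩ := hsh x₀ hx₀ v h1
      have h3 := htA x₀ hxW v c h1 hc
      rw [h2] at h3
      refine hnd x₀ hx₀ v fun w => ?_
      rw [hc, ← h3, map_zero, zero_apply]
    · rintro ⟨g, c⟩
      obtain ⟨v, rfl⟩ := hsurj x₀ hx₀ g
      obtain ⟨u, hu, huc⟩ := hex x₀ hx₀ (c - fderiv ℝ t x₀ v)
      have h3 := htA x₀ hxW u _ hu huc
      refine ⟨v + u, ?_⟩
      ext1
      · simp only [ContinuousLinearMap.prod_apply, map_add, hu, Prod.fst_add, add_zero]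
      · simp only [ContinuousLinearMap.prod_apply, map_add, h3, Prod.snd_add, add_sub_cancel]
  have hfs : ContDiffOn ℝ ∞ (fun x => (p x, t x)) W := (hp.mono hWU).prodMk ht
  obtain ⟨e, hxe, heW, hef, hesm, -⟩ := exists_openPartialHomeomorph hW hfs hxW hbij
  have hef' : (e : E → G × (Fin n → ℝ)) = fun x => (p x, t x) := funext hef
  have heU : e.source ⊆ U := heW.trans hWU
  have hfe : ∀ x ∈ e.source, ∀ v c, fderiv ℝ p x v = 0 →
      (∀ w, A x ![v, w] = frameCovector a (p x) c (fderiv ℝ p x w)) →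
          fderiv ℝ e x v = (0, c) := by
    intro x hx v c hv hc
    rw [hef', (hfd x (heW hx)).fderiv, ContinuousLinearMap.prod_apply, hv, htA x (heW hx) v c hv hc]
  refine ⟨e, hxe, heU, ?_, hesm, fun x _ => by rw [hef], hfe, ?_⟩
  · rw [hef']
    exact hfs.mono heW
  have hsd : ∀ z ∈ e.target, ContDiffAt ℝ ∞ e.symm z := fun z hz =>
    hesm.contDiffAt (e.open_target.mem_nhds hz)
  have hsU : ∀ z ∈ e.target, e.symm z ∈ U := fun z hz => heU (e.map_target hz)
  have hpz : ∀ z ∈ e.target, p (e.symm z) = z.1 := fun z hz => by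
    have := e.right_inv hz
    rw [hef] at this
    exact congrArg Prod.fst this
  have hinv : ∀ z ∈ e.target, ∀ u, fderiv ℝ p (e.symm z) (fderiv ℝ e.symm z u) = u.1 ∧
      fderiv ℝ t (e.symm z) (fderiv ℝ e.symm z u) = u.2 := by
    intro z hz u
    have h1 := (hfd _ (heW (e.map_target hz))).comp z
      ((hsd z hz).differentiableAt (by simp)).hasFDerivAt
    have h2 : id =ᶠ[𝓝 z] (fun x => (p x, t x)) ∘ e.symm := by
      filter_upwards [e.open_target.mem_nhds hz] with y hy
      have := e.right_inv hy
      rw [hef'] at this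
      exact this.symm
    have h3 := congrArg (fun M => M u) ((h1.congr_of_eventuallyEq h2).unique (hasFDerivAt_id z))
    exact ⟨congrArg Prod.fst h3, congrArg Prod.snd h3⟩
  let A' : G × (Fin n → ℝ) → (G × (Fin n → ℝ)) [⋀^Fin 2]→L[ℝ] ℝ := fun z =>
    (A (e.symm z)).compContinuousLinearMap (fderiv ℝ e.symm z)
  have hAd : ∀ x ∈ U, ContDiffAt ℝ ∞ A x := fun x hx => hA.contDiffAt (hU.mem_nhds hx)
  have hA'd : ∀ z ∈ e.target, ContDiffAt ℝ ∞ A' z := fun z hz => contDiffAt_form_comp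
    ((hAd _ (hsU z hz)).comp z (hsd z hz)) ((hsd z hz).fderiv_right (m := ∞) (by simp))
  have hA'ap : ∀ z u v, A' z ![u, v] = A (e.symm z)
      ![fderiv ℝ e.symm z u, fderiv ℝ e.symm z v] := by
    intro z u v
    simp only [A', ContinuousAlternatingMap.compContinuousLinearMap_apply]
    congr 1
    ext i; fin_cases i <;> rfl
  -- In the new coordinates, contracting the form with a constant vertical field gives the pull-back
  -- of the exact form ∑ cᵢ daᵢ.
  have hA'c : ∀ z ∈ e.target, ∀ c w, A' z ![(0, c), w] = frameCovector a z.1 c w.1 := by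
    intro z hz c w
    have h1 := (hinv z hz (0, c)).1
    obtain ⟨c', hc'⟩ := hsh _ (hsU z hz) _ h1
    have h2 := htA _ (heW (e.map_target hz)) _ _ h1 hc'
    rw [(hinv z hz (0, c)).2] at h2
    rw [hA'ap, hc', (hinv z hz w).1, hpz z hz, ← h2]
  -- This is Cartan's formula for a constant field: its contraction with the exterior derivative is
  -- zero and its contraction with the form is exact, so the Lie derivative vanishes.
  have hA'cl : ∀ z ∈ e.target, ∀ c u v, fderiv ℝ A' z (0, c) ![u, v] = 0 := by
    intro z hz c u v
    have hzV : z.1 ∈ V := by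
      rw [← hpz z hz]
      exact hpV (hsU z hz)
    let f : G × (Fin n → ℝ) → ℝ := fun z => ∑ i, c i * a i z.1
    have had : ∀ z ∈ e.target, ∀ i, ContDiffAt ℝ ∞ (a i) z.1 := fun z hz i => by
      refine (ha i).contDiffAt (hV.mem_nhds ?_)
      rw [← hpz z hz]
      exact hpV (hsU z hz)
    have hf : ContDiffAt ℝ ∞ f z := by
      refine ContDiffAt.sum fun i _ => contDiffAt_const.mul ?_
      exact (had z hz i).comp z contDiffAt_fst
    have hfd' : ∀ z ∈ e.target, fderiv ℝ f z =
        (frameCovector a z.1 c).comp (ContinuousLinearMap.fst ℝ G (Fin n → ℝ)) := by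
      intro z hz
      have h1 : HasFDerivAt f (∑ i, c i • (fderiv ℝ (a i) z.1).comp
          (ContinuousLinearMap.fst ℝ G (Fin n → ℝ))) z := by
        refine HasFDerivAt.fun_sum fun i _ => HasFDerivAt.const_mul ?_ (c i)
        exact (((had z hz i).differentiableAt (by simp)).hasFDerivAt).comp z hasFDerivAt_fst
      rw [h1.fderiv, frameCovector_apply]
      ext <;> simp
    -- Symmetry of the second derivative of ∑ cᵢ aᵢ is the closedness of that contraction, and
    -- cancels the other two terms of the exterior derivative.
    have hsym := hf.isSymmSndFDerivAt minSmoothness_two_le u v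
    have hfdd : ∀ u w, fderiv ℝ (fderiv ℝ f) z u w = fderiv ℝ A' z u ![(0, c), w] := by
      intro u w
      have h1 := ((hA'd z hz).differentiableAt
        (by simp)).hasFDerivAt.continuousAlternatingMap_apply_const ![((0 : G), c), w]
      have h2 := ((hf.fderiv_right (m := ∞) (by simp)).differentiableAt
        (by simp)).hasFDerivAt.clm_apply (hasFDerivAt_const w z)
      have h3 : (fun z => A' z ![(0, c), w]) =ᶠ[𝓝 z] fun z => fderiv ℝ f z w := by
        filter_upwards [e.open_target.mem_nhds hz] with y hy
        rw [hfd' y hy, hA'c y hy]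
        rfl
      have h4 := congrArg (fun L => L u) ((h2.congr_of_eventuallyEq h3).unique h1)
      simpa using h4
    have hext : extDeriv A' z ![(0, c), u, v] = 0 := by
      rw [extDeriv_pullback ((hAd _ (hsU z hz)).differentiableAt (by simp))
        (hsd z hz) minSmoothness_two_le]
      rw [← hcl _ (hsU z hz) _ (fderiv ℝ e.symm z u) (fderiv ℝ e.symm z v) (hinv z hz (0, c)).1]
      simp only [ContinuousAlternatingMap.compContinuousLinearMap_apply]
      congr 1
      ext i; fin_cases i <;> rfl
    rw [extDeriv_two_apply, ← hfdd, ← hfdd, hsym] at hext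
    linarith
  intro y s h hseg
  ext w
  have hder : ∀ τ ∈ Icc (0 : ℝ) 1, HasDerivAt (fun τ : ℝ => A' (y, s + τ • h) w) 0 τ := by
    intro τ hτ
    have h1 := ((hA'd _ (hseg τ hτ)).differentiableAt
      (by simp)).hasFDerivAt.continuousAlternatingMap_apply_const w
    have h2 : HasDerivAt (fun τ : ℝ => (y, s + τ • h)) (0, h) τ := by
      refine (hasDerivAt_const τ y).prodMk ?_
      simpa using ((hasDerivAt_id τ).smul_const h).const_add s
    have h3 := h1.comp_hasDerivAt τ h2
    have hw : w = ![w 0, w 1] := by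
      funext i; fin_cases i <;> rfl
    have h4 := hA'cl _ (hseg τ hτ) h (w 0) (w 1)
    rw [← hw] at h4
    have h5 : (fderiv ℝ A' (y, s + τ • h)).flipAlternating w (0, h) = 0 := by
      simpa using h4
    rw [h5] at h3
    exact h3
  have hconst := constant_of_derivWithin_zero
    (fun τ hτ => (hder τ hτ).differentiableAt.differentiableWithinAt)
    (fun τ hτ => (hder τ (Ico_subset_Icc_self hτ)).hasDerivWithinAt.derivWithin
      (uniqueDiffOn_Icc_zero_one τ (Ico_subset_Icc_self hτ))) 1 (right_mem_Icc.2 zero_le_one)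
  simp only [one_smul, zero_smul, add_zero] at hconst
  exact hconst

end VectorSpace
end Realization

/-! ### Derivatives on manifolds as maps of fixed model spaces. -/

namespace Realization

section Tder

variable {E E' E'' : Type*} [NormedAddCommGroup E] [NormedSpace ℝ E] [NormedAddCommGroup E']
  [NormedSpace ℝ E'] [NormedAddCommGroup E''] [NormedSpace ℝ E'']
  {H H' H'' : Type*} [TopologicalSpace H] [TopologicalSpace H'] [TopologicalSpace H'']
  {I : ModelWithCorners ℝ E H} {I' : ModelWithCorners ℝ E' H'} {I'' : ModelWithCorners ℝ E'' H''}
  {X X' X'' : Type*} [TopologicalSpace X] [TopologicalSpace X'] [TopologicalSpace X'']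
  [ChartedSpace H X] [ChartedSpace H' X'] [ChartedSpace H'' X'']

variable (I I') in
/-- The derivative of a map between manifolds, as a map between the model vector spaces. -/
noncomputable def tder (f : X → X') (x : X) : E →L[ℝ] E' := mfderiv I I' f x

/-- With the model spaces as types, equal base points can be rewritten freely, which the dependent
tangent spaces of `mfderiv` obstruct. -/
theorem tder_comp {g : X' → X''} {f : X → X'} {x : X} (hg : MDifferentiableAt I' I'' g (f x))
    (hf : MDifferentiableAt I I' f x) :
    tder I I'' (g ∘ f) x = (tder I' I'' g (f x)).comp (tder I I' f x) :=
  mfderiv_comp x hg hf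

theorem tder_congr {f g : X → X'} {x : X} (h : f =ᶠ[𝓝 x] g) : tder I I' f x = tder I I' g x :=
  h.mfderiv_eq

theorem tder_id {x : X} : tder I I (id : X → X) x = ContinuousLinearMap.id ℝ E :=
  mfderiv_id

theorem tder_eq_fderiv {f : E → E'} {x : E} : tder 𝓘(ℝ, E) 𝓘(ℝ, E') f x = fderiv ℝ f x :=
  mfderiv_eq_fderiv

/-- If `g ∘ f` is the identity near `x`, the derivatives are inverse to each other. -/
theorem tder_leftInverse {g : X' → X} {f : X → X'} {x : X} (hg : MDifferentiableAt I' I g (f x))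
    (hf : MDifferentiableAt I I' f x) (h : ∀ᶠ y in 𝓝 x, g (f y) = y) (v : E) :
    tder I' I g (f x) (tder I I' f x v) = v := by
  have h1 := tder_comp hg hf
  have h2 : g ∘ f =ᶠ[𝓝 x] id := h
  rw [tder_congr h2, tder_id] at h1
  exact (congrArg (fun L => L v) h1).symm

/-- Smoothness of order `∞` at a point provides neighbourhoods that depend on the order, so only
finite order spreads to nearby points. Order one suffices to differentiate there. -/
theorem eventually_contMDiffAt_one [IsManifold I ∞ X] [IsManifold I' ∞ X'] {f : X → X'} {x : X}
    (hf : ContMDiffAt I I' ∞ f x) : ∀ᶠ y in 𝓝 x, ContMDiffAt I I' 1 f y := by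
  have : IsManifold I 1 X := IsManifold.of_le (n := ∞) (by exact WithTop.coe_le_coe.2 le_top)
  have : IsManifold I' 1 X' := IsManifold.of_le (n := ∞) (by exact WithTop.coe_le_coe.2 le_top)
  exact (contMDiffAt_iff_contMDiffAt_nhds (by simp)).1
    (hf.of_le (by exact WithTop.coe_le_coe.2 le_top))

end Tder

section Charts

variable {m : ℕ} {M : Type*} [TopologicalSpace M] [ChartedSpace (EuclideanSpace ℝ (Fin m)) M]

theorem isOpen_chart_target (x₀ : M) : IsOpen (extChartAt (𝓡 m) x₀).target :=
  isOpen_extChartAt_target x₀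

theorem eventually_chart_left_inv {x₀ x : M} (hx : x ∈ (extChartAt (𝓡 m) x₀).source) :
    ∀ᶠ y in 𝓝 x, (extChartAt (𝓡 m) x₀).symm (extChartAt (𝓡 m) x₀ y) = y := by
  filter_upwards [(isOpen_extChartAt_source x₀).mem_nhds hx] with y hy
  exact (extChartAt (𝓡 m) x₀).left_inv hy

theorem eventually_chart_right_inv {x₀ : M} {y : EuclideanSpace ℝ (Fin m)}
    (hy : y ∈ (extChartAt (𝓡 m) x₀).target) :
    ∀ᶠ y in 𝓝 y, extChartAt (𝓡 m) x₀ ((extChartAt (𝓡 m) x₀).symm y) = y := by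
  filter_upwards [(isOpen_chart_target x₀).mem_nhds hy] with y hy
  exact (extChartAt (𝓡 m) x₀).right_inv hy

variable [IsManifold (𝓡 m) ∞ M]

theorem contMDiffAt_chart {x₀ x : M} (hx : x ∈ (extChartAt (𝓡 m) x₀).source) :
    ContMDiffAt (𝓡 m) 𝓘(ℝ, EuclideanSpace ℝ (Fin m)) ∞ (extChartAt (𝓡 m) x₀) x :=
  contMDiffAt_extChartAt' (by rwa [extChartAt_source] at hx)

theorem contMDiffAt_chart_symm {x₀ : M} {y : EuclideanSpace ℝ (Fin m)}
    (hy : y ∈ (extChartAt (𝓡 m) x₀).target) :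
    ContMDiffAt 𝓘(ℝ, EuclideanSpace ℝ (Fin m)) (𝓡 m) ∞ (extChartAt (𝓡 m) x₀).symm y :=
  (contMDiffOn_extChartAt_symm x₀).contMDiffAt ((isOpen_chart_target x₀).mem_nhds hy)

theorem mdifferentiableAt_chart {x₀ x : M} (hx : x ∈ (extChartAt (𝓡 m) x₀).source) :
    MDifferentiableAt (𝓡 m) 𝓘(ℝ, EuclideanSpace ℝ (Fin m)) (extChartAt (𝓡 m) x₀) x :=
  (contMDiffAt_chart hx).mdifferentiableAt (by simp)

theorem mdifferentiableAt_chart_symm {x₀ : M} {y : EuclideanSpace ℝ (Fin m)}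
    (hy : y ∈ (extChartAt (𝓡 m) x₀).target) :
    MDifferentiableAt 𝓘(ℝ, EuclideanSpace ℝ (Fin m)) (𝓡 m) (extChartAt (𝓡 m) x₀).symm y :=
  (contMDiffAt_chart_symm hy).mdifferentiableAt (by simp)

theorem tder_chart_symm_comp {x₀ : M} {y : EuclideanSpace ℝ (Fin m)}
    (hy : y ∈ (extChartAt (𝓡 m) x₀).target) :
    (tder (𝓡 m) 𝓘(ℝ, EuclideanSpace ℝ (Fin m)) (extChartAt (𝓡 m) x₀)
      ((extChartAt (𝓡 m) x₀).symm y)).comp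
        (tder 𝓘(ℝ, EuclideanSpace ℝ (Fin m)) (𝓡 m) (extChartAt (𝓡 m) x₀).symm y) =
      ContinuousLinearMap.id ℝ _ := by
  ext1 v
  exact tder_leftInverse (mdifferentiableAt_chart ((extChartAt (𝓡 m) x₀).map_target hy))
    (mdifferentiableAt_chart_symm hy) (eventually_chart_right_inv hy) v

theorem tder_chart_comp_symm {x₀ x : M} (hx : x ∈ (extChartAt (𝓡 m) x₀).source) :
    (tder 𝓘(ℝ, EuclideanSpace ℝ (Fin m)) (𝓡 m) (extChartAt (𝓡 m) x₀).symm
      (extChartAt (𝓡 m) x₀ x)).comp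
        (tder (𝓡 m) 𝓘(ℝ, EuclideanSpace ℝ (Fin m)) (extChartAt (𝓡 m) x₀) x) =
      ContinuousLinearMap.id ℝ _ := by
  ext1 v
  exact tder_leftInverse (mdifferentiableAt_chart_symm ((extChartAt (𝓡 m) x₀).map_source hx))
    (mdifferentiableAt_chart hx) (eventually_chart_left_inv hx) v

end Charts

/-! ### Pull-back and exterior derivative of forms on manifolds. -/

namespace MForm

variable {m m' r : ℕ} {M M' : Type*} [TopologicalSpace M]
  [ChartedSpace (EuclideanSpace ℝ (Fin m)) M] [TopologicalSpace M']
  [ChartedSpace (EuclideanSpace ℝ (Fin m')) M']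

/-- The value of a form at a point, as a form on the model vector space. -/
def val (σ : MForm m r M) (x : M) :
    (EuclideanSpace ℝ (Fin m)) [⋀^Fin r]→L[ℝ] ℝ := σ x

theorem ext_val {σ τ : MForm m r M} (h : ∀ x, σ.val x = τ.val x) : σ = τ := funext h

theorem val_add (σ τ : MForm m r M) (x : M) : (σ + τ).val x = σ.val x + τ.val x := rfl

theorem val_sub (σ τ : MForm m r M) (x : M) : (σ - τ).val x = σ.val x - τ.val x := rfl

theorem val_pullback (f : M' → M) (σ : MForm m r M) (x : M') :
    (σ.pullback f : MForm m' r M').val x =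
      (σ.val (f x)).compContinuousLinearMap (tder (𝓡 m') (𝓡 m) f x) := rfl

theorem inChart_eq (σ : MForm m r M) (x₀ : M) (y : EuclideanSpace ℝ (Fin m)) :
    σ.inChart x₀ y = (σ.val ((extChartAt (𝓡 m) x₀).symm y)).compContinuousLinearMap
      (tder 𝓘(ℝ, EuclideanSpace ℝ (Fin m)) (𝓡 m) (extChartAt (𝓡 m) x₀).symm y) := rfl

theorem val_d (σ : MForm m r M) (x : M) :
    σ.d.val x = (extDeriv (σ.inChart x) (extChartAt (𝓡 m) x x)).compContinuousLinearMap
      (tder (𝓡 m) 𝓘(ℝ, EuclideanSpace ℝ (Fin m)) (extChartAt (𝓡 m) x) x) := rfl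

theorem comp_comp {E₁ E₂ E₃ : Type*} [NormedAddCommGroup E₁] [NormedSpace ℝ E₁]
    [NormedAddCommGroup E₂] [NormedSpace ℝ E₂] [NormedAddCommGroup E₃] [NormedSpace ℝ E₃]
    (A : E₃ [⋀^Fin r]→L[ℝ] ℝ) (f : E₂ →L[ℝ] E₃) (g : E₁ →L[ℝ] E₂) :
    (A.compContinuousLinearMap f).compContinuousLinearMap g =
      A.compContinuousLinearMap (f.comp g) := rfl

/-- A form is smooth at `x` if its expression in the preferred chart is. -/
def SmoothAt (σ : MForm m r M) (x : M) : Prop :=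
  ContDiffAt ℝ ∞ (σ.inChart x) (extChartAt (𝓡 m) x x)

theorem inChart_congr {σ τ : MForm m r M} {x₀ x : M} (hx : x ∈ (extChartAt (𝓡 m) x₀).source)
    (h : ∀ᶠ y in 𝓝 x, σ.val y = τ.val y) :
    σ.inChart x₀ =ᶠ[𝓝 (extChartAt (𝓡 m) x₀ x)] τ.inChart x₀ := by
  filter_upwards [(continuousAt_extChartAt_symm' hx).eventually
    (by rwa [(extChartAt (𝓡 m) x₀).left_inv hx])] with y hy
  rw [inChart_eq, inChart_eq, hy]

theorem smoothAt_congr {σ τ : MForm m r M} {x : M} (h : ∀ᶠ y in 𝓝 x, σ.val y = τ.val y)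
    (hτ : τ.SmoothAt x) : σ.SmoothAt x :=
  ContDiffAt.congr_of_eventuallyEq hτ (inChart_congr (mem_extChartAt_source x) h)

theorem d_congr {σ τ : MForm m r M} {x : M} (h : ∀ᶠ y in 𝓝 x, σ.val y = τ.val y) :
    σ.d.val x = τ.d.val x := by
  rw [val_d, val_d, (inChart_congr (mem_extChartAt_source x) h).extDeriv_eq]

theorem inChart_add (σ τ : MForm m r M) (x₀ : M) :
    (σ + τ).inChart x₀ = σ.inChart x₀ + τ.inChart x₀ := rfl

theorem SmoothAt.add {σ τ : MForm m r M} {x : M} (hσ : σ.SmoothAt x) (hτ : τ.SmoothAt x) :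
    (σ + τ).SmoothAt x := ContDiffAt.add hσ hτ

theorem SmoothAt.sub {σ τ : MForm m r M} {x : M} (hσ : σ.SmoothAt x) (hτ : τ.SmoothAt x) :
    (σ - τ).SmoothAt x := ContDiffAt.sub hσ hτ

theorem d_add {σ τ : MForm m r M} {x : M} (hσ : σ.SmoothAt x) (hτ : τ.SmoothAt x) :
    (σ + τ).d.val x = σ.d.val x + τ.d.val x := by
  rw [val_d, inChart_add, extDeriv_add (ContDiffAt.differentiableAt hσ (by simp))
    (ContDiffAt.differentiableAt hτ (by simp))]
  rfl

theorem d_sub {σ τ : MForm m r M} {x : M} (hσ : σ.SmoothAt x) (hτ : τ.SmoothAt x) :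
    (σ - τ).d.val x = σ.d.val x - τ.d.val x := by
  have h := d_add (hσ.sub hτ) hτ
  rw [sub_add_cancel] at h
  rw [h, add_sub_cancel_right]

theorem pullback_id (σ : MForm m r M) : σ.pullback (id : M → M) = σ := by
  refine ext_val fun x => ?_
  rw [val_pullback, tder_id]
  rfl

variable [IsManifold (𝓡 m) ∞ M] [IsManifold (𝓡 m') ∞ M']

/-- The local expression of a map in charts. -/
theorem contDiffAt_local {f : M' → M} {x₀' x : M'} {z₀ : M}
    (hx : x ∈ (extChartAt (𝓡 m') x₀').source) (hz : f x ∈ (extChartAt (𝓡 m) z₀).source)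
    (hf : ContMDiffAt (𝓡 m') (𝓡 m) ∞ f x) :
    ContDiffAt ℝ ∞ (extChartAt (𝓡 m) z₀ ∘ f ∘ (extChartAt (𝓡 m') x₀').symm)
      (extChartAt (𝓡 m') x₀' x) := by
  rw [← contMDiffAt_iff_contDiffAt]
  have hxs := (extChartAt (𝓡 m') x₀').left_inv hx
  have h1 : ContMDiffAt (𝓡 m') (𝓡 m) ∞ f
      ((extChartAt (𝓡 m') x₀').symm (extChartAt (𝓡 m') x₀' x)) := by rwa [hxs]
  have h2 := h1.comp _ (contMDiffAt_chart_symm ((extChartAt (𝓡 m') x₀').map_source hx))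
  refine ContMDiffAt.comp (extChartAt (𝓡 m') x₀' x) (contMDiffAt_chart ?_) h2
  simpa only [Function.comp, hxs] using hz

/-- Inserting a chart of the target and its inverse turns the pull-back into one between open sets
of vector spaces. The identity is local because `f` must be differentiable and stay inside the
chart. -/
theorem inChart_pullback {f : M' → M} (σ : MForm m r M) {x₀' x : M'} {z₀ : M}
    (hx : x ∈ (extChartAt (𝓡 m') x₀').source) (hz : f x ∈ (extChartAt (𝓡 m) z₀).source)
    (hf : ContMDiffAt (𝓡 m') (𝓡 m) ∞ f x) :
    (σ.pullback f : MForm m' r M').inChart x₀' =ᶠ[𝓝 (extChartAt (𝓡 m') x₀' x)]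
      fun y => (σ.inChart z₀ ((extChartAt (𝓡 m) z₀ ∘ f ∘ (extChartAt (𝓡 m') x₀').symm)
        y)).compContinuousLinearMap
          (fderiv ℝ (extChartAt (𝓡 m) z₀ ∘ f ∘ (extChartAt (𝓡 m') x₀').symm) y) := by
  have hxs := (extChartAt (𝓡 m') x₀').left_inv hx
  have hc := continuousAt_extChartAt_symm' hx
  have h1 : ∀ᶠ x' in 𝓝 x, MDifferentiableAt (𝓡 m') (𝓡 m) f x' ∧
      f x' ∈ (extChartAt (𝓡 m) z₀).source := by
    have h2 : ∀ᶠ x' in 𝓝 x, ContMDiffAt (𝓡 m') (𝓡 m) 1 f x' :=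
      eventually_contMDiffAt_one hf
    filter_upwards [h2, hf.continuousAt.eventually
      ((isOpen_extChartAt_source z₀).mem_nhds hz)] with x' h3 h4
    exact ⟨h3.mdifferentiableAt (by simp), h4⟩
  have h2 := hc.eventually (by rwa [hxs] : ∀ᶠ x' in 𝓝 ((extChartAt (𝓡 m') x₀').symm _), _)
  filter_upwards [h2, (isOpen_chart_target x₀').mem_nhds ((extChartAt (𝓡 m') x₀').map_source hx)]
    with y hy hyt
  obtain ⟨hfd, hfz⟩ := hy
  have hsd := mdifferentiableAt_chart_symm hyt
  have hcd := mdifferentiableAt_chart hfz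
  rw [inChart_eq, val_pullback, comp_comp, ← tder_eq_fderiv,
    tder_comp (f := f ∘ (extChartAt (𝓡 m') x₀').symm) hcd (hfd.comp y hsd), tder_comp hfd hsd,
    inChart_eq, comp_comp]
  simp only [Function.comp]
  rw [← ContinuousLinearMap.comp_assoc, tder_chart_comp_symm hfz, ContinuousLinearMap.id_comp,
    (extChartAt (𝓡 m) z₀).left_inv hfz]

/-- A change of chart is a pull-back under the identity map, so independence of the chart is a case
of `inChart_pullback`. -/
theorem SmoothAt.inChart {σ : MForm m r M} {x₀ x : M} (hx : x ∈ (extChartAt (𝓡 m) x₀).source)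
    (hσ : σ.SmoothAt x) : ContDiffAt ℝ ∞ (σ.inChart x₀) (extChartAt (𝓡 m) x₀ x) := by
  have h1 := inChart_pullback (f := (id : M → M)) σ hx (mem_extChartAt_source x) contMDiffAt_id
  rw [pullback_id] at h1
  have h2 := contDiffAt_local (f := (id : M → M)) (z₀ := x) hx (mem_extChartAt_source x)
    contMDiffAt_id
  refine ContDiffAt.congr_of_eventuallyEq (contDiffAt_form_comp
    (ContDiffAt.comp (g := σ.inChart x) _ ?_ h2) (h2.fderiv_right (m := ∞) (by simp))) h1
  have hxs := (extChartAt (𝓡 m) x₀).left_inv hx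
  simp only [Function.comp, hxs, id]
  exact hσ

theorem SmoothAt.pullback {σ : MForm m r M} {f : M' → M} {x : M'}
    (hf : ContMDiffAt (𝓡 m') (𝓡 m) ∞ f x) (hσ : σ.SmoothAt (f x)) :
    (σ.pullback f : MForm m' r M').SmoothAt x := by
  have h1 := inChart_pullback σ (mem_extChartAt_source x) (mem_extChartAt_source (f x)) hf
  have h2 := contDiffAt_local (mem_extChartAt_source x) (mem_extChartAt_source (f x)) hf
  refine ContDiffAt.congr_of_eventuallyEq (contDiffAt_form_comp
    (ContDiffAt.comp (g := σ.inChart (f x)) _ ?_ h2) (h2.fderiv_right (m := ∞) (by simp))) h1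
  have hxs := (extChartAt (𝓡 m') x).left_inv (mem_extChartAt_source (I := 𝓡 m') x)
  simp only [Function.comp, hxs]
  exact hσ

theorem smooth_iff {σ : MForm m r M} : σ.Smooth ↔ ∀ x, σ.SmoothAt x := by
  refine ⟨fun h x => (h x).contDiffAt ((isOpen_chart_target x).mem_nhds (mem_extChartAt_target x)),
    fun h x₀ y hy => ?_⟩
  have h1 := (h ((extChartAt (𝓡 m) x₀).symm y)).inChart ((extChartAt (𝓡 m) x₀).map_target hy)
  rw [(extChartAt (𝓡 m) x₀).right_inv hy] at h1
  exact h1.contDiffWithinAt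

/-- The free choice of target chart lets one computation serve twice: the preferred chart gives
naturality of d, and the identity map gives its independence of the chart. -/
theorem d_pullback_chart {σ : MForm m r M} {f : M' → M} {x : M'} {z₀ : M}
    (hz : f x ∈ (extChartAt (𝓡 m) z₀).source)
    (hf : ContMDiffAt (𝓡 m') (𝓡 m) ∞ f x) (hσ : σ.SmoothAt (f x)) :
    (σ.pullback f : MForm m' r M').d.val x =
      (extDeriv (σ.inChart z₀) (extChartAt (𝓡 m) z₀ (f x))).compContinuousLinearMap
        ((tder (𝓡 m) 𝓘(ℝ, EuclideanSpace ℝ (Fin m)) (extChartAt (𝓡 m) z₀) (f x)).comp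
          (tder (𝓡 m') (𝓡 m) f x)) := by
  have h1 := inChart_pullback (m' := m') σ (mem_extChartAt_source x) hz hf
  have h2 := contDiffAt_local (m' := m') (m := m) (mem_extChartAt_source x) hz hf
  have hxs := (extChartAt (𝓡 m') x).left_inv (mem_extChartAt_source (I := 𝓡 m') x)
  have h3 : (extChartAt (𝓡 m) z₀ ∘ f ∘ (extChartAt (𝓡 m') x).symm) (extChartAt (𝓡 m') x x) =
      extChartAt (𝓡 m) z₀ (f x) := by simp only [Function.comp, hxs]
  have h4 := hσ.inChart hz
  rw [val_d, h1.extDeriv_eq, extDeriv_pullback (by rw [h3]; exact h4.differentiableAt (by simp)) h2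
    minSmoothness_two_le, h3, comp_comp]
  congr 1
  have hfd := hf.mdifferentiableAt (by simp)
  rw [← tder_eq_fderiv, ← tder_comp (I := 𝓡 m') (f := extChartAt (𝓡 m') x)
    (h2.differentiableAt (by simp)).mdifferentiableAt
    (mdifferentiableAt_chart (mem_extChartAt_source x)),
    ← tder_comp (mdifferentiableAt_chart hz) hfd]
  apply tder_congr
  filter_upwards [eventually_chart_left_inv (mem_extChartAt_source (I := 𝓡 m') x)] with y hy
  simp only [Function.comp, hy]

theorem d_pullback {σ : MForm m r M} {f : M' → M} {x : M'}
    (hf : ContMDiffAt (𝓡 m') (𝓡 m) ∞ f x) (hσ : σ.SmoothAt (f x)) :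
    (σ.pullback f : MForm m' r M').d.val x = (σ.d.pullback f : MForm m' (r + 1) M').val x :=
  d_pullback_chart (mem_extChartAt_source _) hf hσ

theorem d_chart {σ : MForm m r M} {x x₀ : M} (hx : x ∈ (extChartAt (𝓡 m) x₀).source)
    (hσ : σ.SmoothAt x) :
    σ.d.val x = (extDeriv (σ.inChart x₀) (extChartAt (𝓡 m) x₀ x)).compContinuousLinearMap
      (tder (𝓡 m) 𝓘(ℝ, EuclideanSpace ℝ (Fin m)) (extChartAt (𝓡 m) x₀) x) := by
  have h := d_pullback_chart (f := (id : M → M)) (x := x) hx contMDiffAt_id hσ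
  rw [pullback_id, tder_id, ContinuousLinearMap.comp_id] at h
  exact h

theorem inChart_d {σ : MForm m r M} {x₀ : M} {y : EuclideanSpace ℝ (Fin m)}
    (hy : y ∈ (extChartAt (𝓡 m) x₀).target)
    (hσ : σ.SmoothAt ((extChartAt (𝓡 m) x₀).symm y)) :
    σ.d.inChart x₀ y = extDeriv (σ.inChart x₀) y := by
  rw [inChart_eq, d_chart ((extChartAt (𝓡 m) x₀).map_target hy) hσ, comp_comp,
    tder_chart_symm_comp hy, (extChartAt (𝓡 m) x₀).right_inv hy]
  rfl

/-- At each nearby point d is defined by another preferred chart. Smoothness at those points is what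
allows comparison with the single chart at `x`. -/
theorem inChart_d_eventuallyEq {σ : MForm m r M} {x : M} (hσ : ∀ᶠ y in 𝓝 x, σ.SmoothAt y) :
    σ.d.inChart x =ᶠ[𝓝 (extChartAt (𝓡 m) x x)] extDeriv (σ.inChart x) := by
  have h := (continuousAt_extChartAt_symm' (mem_extChartAt_source (I := 𝓡 m) x)).eventually
    (by rwa [(extChartAt (𝓡 m) x).left_inv (mem_extChartAt_source x)])
  filter_upwards [h, (isOpen_chart_target x).mem_nhds (mem_extChartAt_target x)] with y hy hyt
  exact inChart_d hyt hy

theorem SmoothAt.d {σ : MForm m r M} {x : M} (hσ : ∀ᶠ y in 𝓝 x, σ.SmoothAt y) :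
    σ.d.SmoothAt x := by
  have h1 : ContDiffAt ℝ ∞ (σ.inChart x) (extChartAt (𝓡 m) x x) := hσ.self_of_nhds
  have h2 := h1.fderiv_right (m := ∞) (by simp)
  refine ContDiffAt.congr_of_eventuallyEq ?_ (inChart_d_eventuallyEq hσ)
  exact (ContinuousAlternatingMap.alternatizeUncurryFinCLM ℝ (EuclideanSpace ℝ (Fin m)) ℝ
    (n := r)).contDiff.contDiffAt.comp _ h2

theorem d_d {σ : MForm m r M} {x : M} (hσ : ∀ᶠ y in 𝓝 x, σ.SmoothAt y) : σ.d.d.val x = 0 := by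
  have h1 : ContDiffAt ℝ ∞ (σ.inChart x) (extChartAt (𝓡 m) x x) := hσ.self_of_nhds
  rw [val_d, (inChart_d_eventuallyEq hσ).extDeriv_eq,
    extDeriv_extDeriv_apply h1 minSmoothness_two_le]
  rfl

end MForm
end Realization

/-! ### Linear algebra of realizations: conormal covectors and vertical vectors. -/

namespace Realization

variable {k : ℕ} {B : Type v} [TopologicalSpace B] [ChartedSpace (EuclideanSpace ℝ (Fin k)) B]

theorem Covector.at_apply {x y : B} (h : y = x) (α : Covector k x)
    (v : EuclideanSpace ℝ (Fin k)) :
    (Covector.at k h α : EuclideanSpace ℝ (Fin k) →L[ℝ] ℝ) v =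
      (α : EuclideanSpace ℝ (Fin k) →L[ℝ] ℝ) v := by
  subst h
  rfl

theorem tangentAt_eq {x y : B} (h : y = x) (v : TangentSpace (𝓡 k) x) :
    (tangentAt k h v : EuclideanSpace ℝ (Fin k)) = v := by
  subst h
  rfl

namespace RegularTwistedPoisson

variable (T : RegularTwistedPoisson k B)

/-- `Π♯` in terms of the model vector space. -/
def shp (b : B) : (EuclideanSpace ℝ (Fin k) →L[ℝ] ℝ) →ₗ[ℝ] EuclideanSpace ℝ (Fin k) := T.sharp b

/-- The conormal space in terms of the model vector space. -/
def con (b : B) : Submodule ℝ (EuclideanSpace ℝ (Fin k) →L[ℝ] ℝ) := T.conormal b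

theorem shp_skew (b : B) (α β : EuclideanSpace ℝ (Fin k) →L[ℝ] ℝ) :
    β (T.shp b α) = -α (T.shp b β) := T.skew b α β

/-- By skewness, the annihilator of the image of Π♯ is its kernel. -/
theorem mem_con_iff {b : B} {α : EuclideanSpace ℝ (Fin k) →L[ℝ] ℝ} :
    α ∈ T.con b ↔ T.shp b α = 0 := by
  constructor
  · intro h
    by_contra hne
    obtain ⟨β, hβ⟩ := SeparatingDual.exists_ne_zero (R := ℝ) hne
    apply hβ
    rw [T.shp_skew, neg_eq_zero]
    exact h _ ⟨β, rfl⟩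
  · intro h
    have h1 (β : EuclideanSpace ℝ (Fin k) →L[ℝ] ℝ) : α (T.shp b β) = 0 := by
      rw [T.shp_skew, h, map_zero, neg_zero]
    rintro _ ⟨β, rfl⟩
    exact h1 β

end RegularTwistedPoisson

/-- The covector `∑ cᵢ daᵢ` at `b`. -/
noncomputable def frameAt {n : ℕ} (a : Fin n → B → ℝ) (b : B) (c : Fin n → ℝ) :
    EuclideanSpace ℝ (Fin k) →L[ℝ] ℝ :=
  ∑ i, c i • tder (𝓡 k) 𝓘(ℝ, ℝ) (a i) b

section frameAt

variable {n : ℕ} (a : Fin n → B → ℝ) (b : B)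

theorem frameAt_add (c d : Fin n → ℝ) : frameAt (k := k) a b (c + d) =
    frameAt a b c + frameAt a b d := by
  simp [frameAt, add_smul, Finset.sum_add_distrib]

theorem frameAt_neg (c : Fin n → ℝ) : frameAt (k := k) a b (-c) = -frameAt a b c := by
  simp [frameAt]

end frameAt

/-- `a₁, …, aₙ` are functions on `U` exhibiting the period bundle as `ℤ da₁ ⊕ ⋯ ⊕ ℤ daₙ`. -/
structure PeriodBundle.IsFrame {T : RegularTwistedPoisson k B} (P : PeriodBundle T) (U : Set B)
    {n : ℕ} (a : Fin n → B → ℝ) : Prop where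
  isOpen : IsOpen U
  smooth : ∀ i, ContMDiffOn (𝓡 k) 𝓘(ℝ, ℝ) ∞ (a i) U
  linearIndependent : ∀ b ∈ U, LinearIndependent ℝ (fun i => dFun k (a i) b)
  span_eq : ∀ b ∈ U, Submodule.span ℝ (Set.range fun i => dFun k (a i) b) = T.conormal b
  fiber_eq : ∀ b ∈ U, P.fiber b = AddSubgroup.closure (Set.range fun i => dFun k (a i) b)

namespace PeriodBundle

variable {T : RegularTwistedPoisson k B} {P : PeriodBundle T}

theorem exists_isFrame (P : PeriodBundle T) (b : B) :
    ∃ (U : Set B) (n : ℕ) (a : Fin n → B → ℝ), b ∈ U ∧ P.IsFrame U a := by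
  obtain ⟨U, hU, hb, n, a, ha, h⟩ := P.locally_integral b
  exact ⟨U, n, a, hb, hU, ha, fun b hb => (h b hb).1, fun b hb => (h b hb).2.1,
    fun b hb => (h b hb).2.2⟩

variable {U : Set B} {n : ℕ} {a : Fin n → B → ℝ}

theorem IsFrame.mono (h : P.IsFrame U a) {V : Set B} (hV : IsOpen V) (hVU : V ⊆ U) :
    P.IsFrame V a :=
  ⟨hV, fun i => (h.smooth i).mono hVU, fun b hb => h.linearIndependent b (hVU hb),
    fun b hb => h.span_eq b (hVU hb), fun b hb => h.fiber_eq b (hVU hb)⟩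

theorem IsFrame.span_eq' (h : P.IsFrame U a) {b : B} (hb : b ∈ U) :
    Submodule.span ℝ (Set.range fun i => (tder (𝓡 k) 𝓘(ℝ, ℝ) (a i) b :
      EuclideanSpace ℝ (Fin k) →L[ℝ] ℝ)) = T.con b := h.span_eq b hb

theorem IsFrame.mem_conormal (h : P.IsFrame U a) {b : B} (hb : b ∈ U) (c : Fin n → ℝ) :
    frameAt a b c ∈ T.con b := by
  rw [← h.span_eq' hb]
  exact Submodule.sum_mem _ fun i _ => Submodule.smul_mem _ _ (Submodule.subset_span ⟨i, rfl⟩)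

theorem IsFrame.exists_eq (h : P.IsFrame U a) {b : B} (hb : b ∈ U)
    {α : EuclideanSpace ℝ (Fin k) →L[ℝ] ℝ} (hα : α ∈ T.con b) : ∃ c, α = frameAt a b c := by
  rw [← h.span_eq' hb] at hα
  obtain ⟨c, hc⟩ := (Submodule.mem_span_range_iff_exists_fun ℝ).1 hα
  exact ⟨c, hc.symm⟩

theorem IsFrame.injective (h : P.IsFrame U a) {b : B} (hb : b ∈ U) :
    Function.Injective (frameAt (k := k) a b) := by
  intro c d hcd
  have h2 : frameAt (k := k) a b (c - d) = 0 := by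
    rw [sub_eq_add_neg, frameAt_add, frameAt_neg, hcd, add_neg_cancel]
  have hli : LinearIndependent ℝ (fun i => (tder (𝓡 k) 𝓘(ℝ, ℝ) (a i) b :
      EuclideanSpace ℝ (Fin k) →L[ℝ] ℝ)) := h.linearIndependent b hb
  have h1 := Fintype.linearIndependent_iff.1 hli (c - d) h2
  funext i
  exact sub_eq_zero.1 (h1 i)

end PeriodBundle

namespace FormOver

variable (M : FormOver.{u} k B)

/-- The differential of the projection, as a map of model vector spaces. -/
noncomputable def Dp (m : M.carrier) :
    EuclideanSpace ℝ (Fin M.dim) →L[ℝ] EuclideanSpace ℝ (Fin k) :=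
  tder (𝓡 M.dim) (𝓡 k) M.proj m

/-- `IsSharp` in terms of the model vector spaces. -/
def Sharp (m : M.carrier) (α : EuclideanSpace ℝ (Fin k) →L[ℝ] ℝ)
    (X : EuclideanSpace ℝ (Fin M.dim)) : Prop :=
  ∀ w, M.form.val m ![X, w] = α (M.Dp m w)

variable {M} {T : RegularTwistedPoisson k B} {P : PeriodBundle T}

namespace IsASCIR

variable (hM : M.IsASCIR T P)
include hM

theorem nondeg {m : M.carrier} {v : EuclideanSpace ℝ (Fin M.dim)}
    (h : ∀ w, M.form.val m ![v, w] = 0) : v = 0 := hM.nondegenerate m v h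

theorem iso {m : M.carrier} {v w : EuclideanSpace ℝ (Fin M.dim)} (hv : M.Dp m v = 0)
    (hw : M.Dp m w = 0) : M.form.val m ![v, w] = 0 := hM.isotropic m v w hv hw

theorem Dp_surjective (m : M.carrier) : Function.Surjective (M.Dp m) := hM.submersion m

/-- Non-degeneracy is injectivity of v ↦ ω(v, ·), and a dimension count makes this map surjective.
-/
theorem exists_sharp (m : M.carrier) (α : EuclideanSpace ℝ (Fin k) →L[ℝ] ℝ) :
    ∃ X, M.Sharp m α X := by
  let L : EuclideanSpace ℝ (Fin M.dim) →ₗ[ℝ] (EuclideanSpace ℝ (Fin M.dim) →L[ℝ] ℝ) :=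
    (pairing (M.form.val m)).toLinearMap
  have hinj : Function.Injective L := by
    rw [injective_iff_map_eq_zero]
    intro v hv
    exact hM.nondeg fun w => congrArg (fun f => f w) hv
  have hfr : Module.finrank ℝ (EuclideanSpace ℝ (Fin M.dim)) =
      Module.finrank ℝ (EuclideanSpace ℝ (Fin M.dim) →L[ℝ] ℝ) := by
    rw [← (LinearMap.toContinuousLinearMap (𝕜 := ℝ)
      (E := EuclideanSpace ℝ (Fin M.dim)) (F' := ℝ)).finrank_eq]
    exact (Subspace.dual_finrank_eq).symm
  obtain ⟨X, hX⟩ := (LinearMap.injective_iff_surjective_of_finrank_eq_finrank hfr).1 hinj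
    (α.comp (M.Dp m))
  exact ⟨X, fun w => congrArg (fun f => f w) hX⟩

/-- Testing against β with Y = ω♯(π*β), the value of β on the image of X is ω(Y, X) = -Π(α, β). The
almost Poisson condition thus determines the projection of every Hamiltonian vector. -/
theorem Dp_sharp {m : M.carrier} {α : EuclideanSpace ℝ (Fin k) →L[ℝ] ℝ}
    {X : EuclideanSpace ℝ (Fin M.dim)} (hX : M.Sharp m α X) :
    M.Dp m X = -T.shp (M.proj m) α := by
  rw [← sub_eq_zero]
  by_contra hne
  obtain ⟨β, hβ⟩ := SeparatingDual.exists_ne_zero (R := ℝ) hne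
  apply hβ
  obtain ⟨Y, hY⟩ := hM.exists_sharp m β
  have h1 : M.form.val m ![X, Y] = β (T.shp (M.proj m) α) :=
    hM.almostPoisson m α β X Y hX hY
  have h2 := hY X
  rw [form_swap, h1] at h2
  rw [map_sub, map_neg, ← h2, sub_self]

theorem Dp_sharp_eq_zero_iff {m : M.carrier} {α : EuclideanSpace ℝ (Fin k) →L[ℝ] ℝ}
    {X : EuclideanSpace ℝ (Fin M.dim)} (hX : M.Sharp m α X) :
    M.Dp m X = 0 ↔ α ∈ T.con (M.proj m) := by
  rw [hM.Dp_sharp hX, neg_eq_zero]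
  exact T.mem_con_iff.symm

/-- By isotropy ω(v, ·) kills vertical vectors and descends to the base; composing with a linear
right inverse of dπ gives the covector. It is conormal by `Dp_sharp_eq_zero_iff`, because `v` is
vertical. -/
theorem exists_sharp_of_vertical {m : M.carrier} {v : EuclideanSpace ℝ (Fin M.dim)}
    (hv : M.Dp m v = 0) : ∃ α ∈ T.con (M.proj m),
      M.Sharp m α v := by
  obtain ⟨R, hR⟩ := (M.Dp m).toLinearMap.exists_rightInverse_of_surjective
    ((LinearMap.range_eq_top (f := (M.Dp m).toLinearMap)).2 (hM.Dp_surjective m))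
  have hR' : ∀ e, M.Dp m (R e) = e := fun e => congrArg (fun L => L e) hR
  let α : EuclideanSpace ℝ (Fin k) →L[ℝ] ℝ :=
    (pairing (M.form.val m) v).comp (LinearMap.toContinuousLinearMap R)
  have hα : M.Sharp m α v := by
    intro w
    have h1 : M.form.val m ![v, w - R (M.Dp m w)] = 0 :=
      hM.iso hv (by rw [map_sub, hR', sub_self])
    rw [← pairing_apply, map_sub, sub_eq_zero] at h1
    exact h1
  exact ⟨α, (hM.Dp_sharp_eq_zero_iff hα).1 hv, hα⟩

theorem exists_frameAt_of_vertical {U : Set B} {n : ℕ} {a : Fin n → B → ℝ} (hF : P.IsFrame U a)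
    {m : M.carrier} (hm : M.proj m ∈ U) {v : EuclideanSpace ℝ (Fin M.dim)}
    (hv : M.Dp m v = 0) : ∃ c, M.Sharp m (frameAt a (M.proj m) c) v := by
  obtain ⟨α, hα, hs⟩ := hM.exists_sharp_of_vertical hv
  obtain ⟨c, rfl⟩ := hF.exists_eq hm hα
  exact ⟨c, hs⟩

theorem exists_vertical_of_frameAt {U : Set B} {n : ℕ} {a : Fin n → B → ℝ} (hF : P.IsFrame U a)
    {m : M.carrier} (hm : M.proj m ∈ U) (c : Fin n → ℝ) :
    ∃ v, M.Dp m v = 0 ∧ M.Sharp m (frameAt a (M.proj m) c) v := by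
  obtain ⟨v, hv⟩ := hM.exists_sharp m (frameAt a (M.proj m) c)
  exact ⟨v, (hM.Dp_sharp_eq_zero_iff hv).2 (hF.mem_conormal hm c), hv⟩

end IsASCIR

end FormOver
end Realization

/-! ### Adapted coordinate boxes on a realization. -/

namespace Realization

open Set

variable {k : ℕ} {B : Type v} [TopologicalSpace B] [ChartedSpace (EuclideanSpace ℝ (Fin k)) B]

namespace FormOver

/-- Coordinates on an open subset of `M` adapted to the projection and to the vertical
Hamiltonian vector fields of `a₁, …, aₙ`. -/
structure IsBox (M : FormOver.{u} k B) (U : Set B) {n : ℕ} (a : Fin n → B → ℝ) (b₀ : B)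
    (e : OpenPartialHomeomorph M.carrier (EuclideanSpace ℝ (Fin k) × (Fin n → ℝ))) : Prop where
  proj_mem : ∀ m ∈ e.source, M.proj m ∈ U
  proj_mem_source : ∀ m ∈ e.source, M.proj m ∈ (extChartAt (𝓡 k) b₀).source
  fst_eq : ∀ m ∈ e.source, (e m).1 = extChartAt (𝓡 k) b₀ (M.proj m)
  contMDiffOn : ContMDiffOn (𝓡 M.dim) 𝓘(ℝ, EuclideanSpace ℝ (Fin k) × (Fin n → ℝ)) ∞ e e.source
  contMDiffOn_symm :
    ContMDiffOn 𝓘(ℝ, EuclideanSpace ℝ (Fin k) × (Fin n → ℝ)) (𝓡 M.dim) ∞ e.symm e.target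
  tder_sharp : ∀ m ∈ e.source, ∀ X c, M.Sharp m (frameAt a (M.proj m) c) X →
    tder (𝓡 M.dim) 𝓘(ℝ, EuclideanSpace ℝ (Fin k) × (Fin n → ℝ)) e m X = (0, c)
  form_eq : ∀ (y : EuclideanSpace ℝ (Fin k)) (s h : Fin n → ℝ),
    (∀ τ ∈ Icc (0 : ℝ) 1, (y, s + τ • h) ∈ e.target) →
    (M.form.val (e.symm (y, s + h))).compContinuousLinearMap
      (tder 𝓘(ℝ, EuclideanSpace ℝ (Fin k) × (Fin n → ℝ)) (𝓡 M.dim) e.symm (y, s + h)) =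
    (M.form.val (e.symm (y, s))).compContinuousLinearMap
      (tder 𝓘(ℝ, EuclideanSpace ℝ (Fin k) × (Fin n → ℝ)) (𝓡 M.dim) e.symm (y, s))

variable {M : FormOver.{u} k B} {T : RegularTwistedPoisson k B} {P : PeriodBundle T}

theorem smoothAt_form (M : FormOver.{u} k B) (m : M.carrier) : M.form.SmoothAt m :=
  MForm.smooth_iff.1 M.smooth_form m

theorem mdifferentiableAt_proj (m : M.carrier) :
    MDifferentiableAt (𝓡 M.dim) (𝓡 k) M.proj m := M.smooth_proj.mdifferentiableAt (by simp)

variable [IsManifold (𝓡 k) ∞ B]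

theorem frameCovector_tder_chart {U : Set B} {n : ℕ} {a : Fin n → B → ℝ}
    (hU : IsOpen U) (ha : ∀ i, ContMDiffOn (𝓡 k) 𝓘(ℝ, ℝ) ∞ (a i) U) {b₀ b : B} (hb : b ∈ U)
    (hb' : b ∈ (extChartAt (𝓡 k) b₀).source) (c : Fin n → ℝ) (w : EuclideanSpace ℝ (Fin k)) :
    frameCovector (fun i => a i ∘ (extChartAt (𝓡 k) b₀).symm) (extChartAt (𝓡 k) b₀ b) c
      (tder (𝓡 k) 𝓘(ℝ, EuclideanSpace ℝ (Fin k)) (extChartAt (𝓡 k) b₀) b w) =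
    frameAt a b c w := by
  rw [frameCovector_apply, frameAt]
  simp only [sum_apply, smul_apply]
  refine Finset.sum_congr rfl fun i _ => ?_
  congr 1
  have ht := (extChartAt (𝓡 k) b₀).map_source hb'
  have hs := (extChartAt (𝓡 k) b₀).left_inv hb'
  have h1 : MDifferentiableAt (𝓡 k) 𝓘(ℝ, ℝ) (a i) b :=
    ((ha i).contMDiffAt (hU.mem_nhds hb)).mdifferentiableAt (by simp)
  have h2 := tder_comp (g := a i) (by rwa [hs]) (mdifferentiableAt_chart_symm ht)
  rw [← tder_eq_fderiv, h2, hs, ContinuousLinearMap.comp_apply]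
  congr 1
  exact congrArg (fun L => L w) (tder_chart_comp_symm hb')

namespace IsASCIR

/-- This is `exists_fiber_box` read through a chart φ of the total space and a chart ψ of the base.
Most of the work is a dictionary between vertical vectors, frames and the relation `Sharp` on the
two sides. -/
theorem exists_isBox (hM : M.IsASCIR T P) {U : Set B} {n : ℕ} {a : Fin n → B → ℝ}
    (hF : P.IsFrame U a) (b₀ : B) {m₀ : M.carrier} (hm₀ : M.proj m₀ ∈ U)
    (hm₀' : M.proj m₀ ∈ (extChartAt (𝓡 k) b₀).source) :
    ∃ e, m₀ ∈ e.source ∧ M.IsBox U a b₀ e := by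
  set φ := extChartAt (𝓡 M.dim) m₀ with hφ
  set ψ := extChartAt (𝓡 k) b₀ with hψ
  set O : Set B := U ∩ ψ.source with hO
  have hOo : IsOpen O := hF.isOpen.inter (isOpen_extChartAt_source b₀)
  set Ω := φ.target ∩ φ.symm ⁻¹' (M.proj ⁻¹' O) with hΩ
  have hΩo : IsOpen Ω := (continuousOn_extChartAt_symm m₀).isOpen_inter_preimage
    (isOpen_chart_target m₀) (hOo.preimage M.smooth_proj.continuous)
  set V := ψ.target ∩ ψ.symm ⁻¹' U with hV
  have hVo : IsOpen V := (continuousOn_extChartAt_symm b₀).isOpen_inter_preimage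
    (isOpen_chart_target b₀) hF.isOpen
  set p := ψ ∘ M.proj ∘ φ.symm with hp
  have hpd (y) (hy : y ∈ Ω) : ContDiffAt ℝ ∞ p y := by
    have h := MForm.contDiffAt_local (f := M.proj) (x₀' := m₀) (z₀ := b₀) (φ.map_target hy.1)
      hy.2.2 M.smooth_proj.contMDiffAt
    rwa [φ.right_inv hy.1] at h
  have hdp (y) (hy : y ∈ Ω) (v) : fderiv ℝ p y v =
      tder (𝓡 k) 𝓘(ℝ, EuclideanSpace ℝ (Fin k)) ψ (M.proj (φ.symm y)) (M.Dp (φ.symm y)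
        (tder 𝓘(ℝ, EuclideanSpace ℝ (Fin M.dim)) (𝓡 M.dim) φ.symm y v)) := by
    have h1 := mdifferentiableAt_chart_symm hy.1
    have h2 := tder_comp (g := M.proj) (mdifferentiableAt_proj (φ.symm y)) h1
    have h3 := tder_comp (g := ψ) (f := M.proj ∘ φ.symm) (mdifferentiableAt_chart hy.2.2)
      ((mdifferentiableAt_proj (φ.symm y)).comp y h1)
    rw [← tder_eq_fderiv, h3, h2]
    rfl
  have hψinj (b) (hb : b ∈ ψ.source) (w) :
      tder (𝓡 k) 𝓘(ℝ, EuclideanSpace ℝ (Fin k)) ψ b w = 0 ↔ w = 0 := by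
    refine ⟨fun h => ?_, fun h => by rw [h, map_zero]⟩
    have h1 := congrArg (fun L => L w) (tder_chart_comp_symm hb)
    simp only [ContinuousLinearMap.comp_apply] at h1
    rw [← hψ, h, map_zero] at h1
    exact h1.symm
  have hvert (y) (hy : y ∈ Ω) (v) : fderiv ℝ p y v = 0 ↔ M.Dp (φ.symm y)
        (tder 𝓘(ℝ, EuclideanSpace ℝ (Fin M.dim)) (𝓡 M.dim) φ.symm y v) = 0 := by
    rw [hdp y hy, hψinj _ hy.2.2]
  have hfr (y) (hy : y ∈ Ω) (c w) :
      frameCovector (fun i => a i ∘ ψ.symm) (p y) c (fderiv ℝ p y w) =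
      frameAt a (M.proj (φ.symm y)) c (M.Dp (φ.symm y)
        (tder 𝓘(ℝ, EuclideanSpace ℝ (Fin M.dim)) (𝓡 M.dim) φ.symm y w)) := by
    rw [hdp y hy]
    exact frameCovector_tder_chart hF.isOpen hF.smooth hy.2.1 hy.2.2 c _
  have hA (y v w) : M.form.inChart m₀ y ![v, w] = M.form.val (φ.symm y)
      ![tder 𝓘(ℝ, EuclideanSpace ℝ (Fin M.dim)) (𝓡 M.dim) φ.symm y v,
        tder 𝓘(ℝ, EuclideanSpace ℝ (Fin M.dim)) (𝓡 M.dim) φ.symm y w] := by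
    rw [MForm.inChart_eq, ContinuousAlternatingMap.compContinuousLinearMap_apply]
    congr 1
    funext i
    fin_cases i <;> rfl
  have hr (y) (hy : y ∈ Ω) (w) : tder (𝓡 M.dim) 𝓘(ℝ, EuclideanSpace ℝ (Fin M.dim)) φ (φ.symm y)
      (tder 𝓘(ℝ, EuclideanSpace ℝ (Fin M.dim)) (𝓡 M.dim) φ.symm y w) = w :=
    congrArg (fun L => L w) (tder_chart_symm_comp hy.1)
  have hl (m) (hm : m ∈ φ.source) (w) :
      tder 𝓘(ℝ, EuclideanSpace ℝ (Fin M.dim)) (𝓡 M.dim) φ.symm (φ m)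
      (tder (𝓡 M.dim) 𝓘(ℝ, EuclideanSpace ℝ (Fin M.dim)) φ m w) = w :=
    congrArg (fun L => L w) (tder_chart_comp_symm hm)
  have hsj (y) (hy : y ∈ Ω) (W) :
      ∃ w, tder 𝓘(ℝ, EuclideanSpace ℝ (Fin M.dim)) (𝓡 M.dim) φ.symm y w = W := by
    have := hl (φ.symm y) (φ.map_target hy.1) W
    rw [φ.right_inv hy.1] at this
    exact ⟨_, this⟩
  have hshp (y) (hy : y ∈ Ω) (v c) : (∀ w, M.form.inChart m₀ y ![v, w] =
      frameCovector (fun i => a i ∘ ψ.symm) (p y) c (fderiv ℝ p y w)) ↔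
      M.Sharp (φ.symm y) (frameAt a (M.proj (φ.symm y)) c)
        (tder 𝓘(ℝ, EuclideanSpace ℝ (Fin M.dim)) (𝓡 M.dim) φ.symm y v) := by
    constructor
    · intro h W
      obtain ⟨w, rfl⟩ := hsj y hy W
      rw [← hA, h, hfr y hy]
    · intro h w
      rw [hA, h, hfr y hy]
  obtain ⟨η, hη⟩ := hM.twisting
  have hmφ := mem_extChartAt_source (I := 𝓡 M.dim) m₀
  have hx₀ : φ m₀ ∈ Ω := by
    refine ⟨φ.map_source hmφ, ?_⟩
    rw [mem_preimage, mem_preimage, φ.left_inv hmφ]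
    exact ⟨hm₀, hm₀'⟩
  obtain ⟨e, he₁, he₂, he₃, he₄, he₅, he₆, he₇⟩ := exists_fiber_box (U := Ω) (p := p)
    (A := M.form.inChart m₀) (V := V) (a := fun i => a i ∘ ψ.symm) (x₀ := φ m₀) hΩo
    (fun y hy => (hpd y hy).contDiffWithinAt) ((M.smooth_form m₀).mono inter_subset_left)
    (fun y hy v w hv hw => by
      rw [hA]
      exact hM.iso ((hvert y hy v).1 hv) ((hvert y hy w).1 hw))
    -- The derivative of ω is pulled back from the base, so it vanishes as soon as one argument is
    -- vertical.
    (fun y hy v w x hv => by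
      rw [← MForm.inChart_d hy.1 (M.smoothAt_form _), hη.eq, MForm.inChart_eq, MForm.val_pullback,
        ContinuousAlternatingMap.compContinuousLinearMap_apply,
        ContinuousAlternatingMap.compContinuousLinearMap_apply]
      exact ContinuousAlternatingMap.map_coord_zero _ 0 ((hvert y hy v).1 hv))
    (fun y hy w => by
      obtain ⟨W, hW⟩ := hM.Dp_surjective (φ.symm y)
        (tder 𝓘(ℝ, EuclideanSpace ℝ (Fin k)) (𝓡 k) ψ.symm (ψ (M.proj (φ.symm y))) w)
      obtain ⟨v, rfl⟩ := hsj y hy W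
      refine ⟨v, ?_⟩
      rw [hdp y hy, hW]
      have h := congrArg (fun L => L w) (tder_chart_symm_comp (ψ.map_source hy.2.2))
      simp only [ContinuousLinearMap.comp_apply] at h
      rwa [← hψ, ψ.left_inv hy.2.2] at h)
    hVo
    (fun y hy => ⟨ψ.map_source hy.2.2, by
      change ψ.symm (ψ (M.proj (φ.symm y))) ∈ U
      rw [ψ.left_inv hy.2.2]
      exact hy.2.1⟩)
    (fun i y hy => by
      have h1 : ContMDiffAt (𝓡 k) 𝓘(ℝ, ℝ) ∞ (a i) (ψ.symm y) :=
        (hF.smooth i).contMDiffAt (hF.isOpen.mem_nhds hy.2)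
      exact (h1.comp y (contMDiffAt_chart_symm hy.1)).contDiffAt.contDiffWithinAt)
    (fun y hy v hv => by
      have h : tder 𝓘(ℝ, EuclideanSpace ℝ (Fin M.dim)) (𝓡 M.dim) φ.symm y v = 0 := by
        refine hM.nondeg (m := φ.symm y) fun W => ?_
        obtain ⟨w, rfl⟩ := hsj y hy W
        rw [← hA, hv]
      rw [← hr y hy v, h, map_zero])
    (fun y hy v hv => by
      obtain ⟨c, hc⟩ := hM.exists_frameAt_of_vertical hF hy.2.1 ((hvert y hy v).1 hv)
      exact ⟨c, (hshp y hy v c).2 hc⟩)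
    (fun y hy c => by
      obtain ⟨W, hW, hc⟩ := hM.exists_vertical_of_frameAt hF hy.2.1 c
      obtain ⟨v, rfl⟩ := hsj y hy W
      exact ⟨v, (hvert y hy v).2 hW, (hshp y hy v c).2 hc⟩)
    hx₀
    (by
      intro c d hcd
      refine hF.injective hx₀.2.1 ?_
      ext w
      have h1 (c) := frameCovector_tder_chart hF.isOpen hF.smooth hx₀.2.1 hx₀.2.2 c w
      rw [← h1, ← h1]
      exact congrArg (fun L : EuclideanSpace ℝ (Fin k) →L[ℝ] ℝ => L _) hcd)
  -- The model with corners is the identity, so χ and φ agree as functions. Only χ is an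
  -- `OpenPartialHomeomorph` that can be composed with `e`.
  set χ := chartAt (EuclideanSpace ℝ (Fin M.dim)) m₀ with hχ
  have hsrc : ∀ m ∈ (χ.trans e).source, m ∈ φ.source ∧ φ m ∈ e.source := by
    intro m hm
    rw [OpenPartialHomeomorph.trans_source] at hm
    refine ⟨by rw [hφ, extChartAt_source]; exact hm.1, hm.2⟩
  have htgt : ∀ z ∈ e.target, z ∈ (χ.trans e).target := by
    intro z hz
    rw [OpenPartialHomeomorph.trans_target]
    refine ⟨hz, ?_⟩
    have := (he₂ (e.map_target hz)).1
    rw [hφ, extChartAt_target] at this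
    exact this.1
  have htgt' : ∀ z ∈ (χ.trans e).target, z ∈ e.target := by
    intro z hz
    rw [OpenPartialHomeomorph.trans_target] at hz
    exact hz.1
  have hΩm : ∀ m ∈ (χ.trans e).source, M.proj m ∈ O := by
    intro m hm
    have h := (he₂ (hsrc m hm).2).2
    rwa [mem_preimage, mem_preimage, φ.left_inv (hsrc m hm).1] at h
  have hsymm (z) (hz : z ∈ e.target) :
      ContMDiffAt 𝓘(ℝ, EuclideanSpace ℝ (Fin k) × (Fin n → ℝ))
        𝓘(ℝ, EuclideanSpace ℝ (Fin M.dim)) ∞ e.symm z :=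
    (he₄.contDiffAt (e.open_target.mem_nhds hz)).contMDiffAt
  have hform (z) (hz : z ∈ e.target) : (M.form.val ((χ.trans e).symm z)).compContinuousLinearMap
      (tder 𝓘(ℝ, EuclideanSpace ℝ (Fin k) × (Fin n → ℝ)) (𝓡 M.dim) (χ.trans e).symm z) =
      (M.form.inChart m₀ (e.symm z)).compContinuousLinearMap (fderiv ℝ e.symm z) := by
    have h1 := tder_comp (g := φ.symm)
      (mdifferentiableAt_chart_symm (he₂ (e.map_target hz)).1)
      ((hsymm z hz).mdifferentiableAt (by simp))
    rw [MForm.inChart_eq, MForm.comp_comp, ← tder_eq_fderiv]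
    exact congrArg _ h1
  refine ⟨χ.trans e, ?_, ?_⟩
  · rw [OpenPartialHomeomorph.trans_source]
    exact ⟨mem_chart_source _ _, he₁⟩
  · refine ⟨fun m hm => (hΩm m hm).1, fun m hm => (hΩm m hm).2, ?_, ?_, ?_, ?_, ?_⟩
    · intro m hm
      have h := he₅ _ (hsrc m hm).2
      have h' := φ.left_inv (hsrc m hm).1
      refine h.trans ?_
      change ψ (M.proj (φ.symm (φ m))) = _
      rw [h']
    · intro m hm
      have h1 : ContMDiffAt 𝓘(ℝ, EuclideanSpace ℝ (Fin M.dim))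
          𝓘(ℝ, EuclideanSpace ℝ (Fin k) × (Fin n → ℝ)) ∞ e (φ m) :=
        (he₃.contDiffAt (e.open_source.mem_nhds (hsrc m hm).2)).contMDiffAt
      exact (h1.comp m (contMDiffAt_chart (hsrc m hm).1)).contMDiffWithinAt
    · intro z hz
      have hz' := htgt' z hz
      exact (ContMDiffAt.comp z (contMDiffAt_chart_symm (he₂ (e.map_target hz')).1)
        (hsymm z hz')).contMDiffWithinAt
    · intro m hm X c hX
      obtain ⟨h1, h2⟩ := hsrc m hm
      have h3 : MDifferentiableAt 𝓘(ℝ, EuclideanSpace ℝ (Fin M.dim))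
          𝓘(ℝ, EuclideanSpace ℝ (Fin k) × (Fin n → ℝ)) e (φ m) :=
        ((he₃.contDiffAt (e.open_source.mem_nhds h2)).contMDiffAt).mdifferentiableAt (by simp)
      have h4 := tder_comp (g := e) h3 (mdifferentiableAt_chart h1)
      have h5 : tder (𝓡 M.dim) 𝓘(ℝ, EuclideanSpace ℝ (Fin k) × (Fin n → ℝ)) (χ.trans e) m X =
          fderiv ℝ e (φ m)
            (tder (𝓡 M.dim) 𝓘(ℝ, EuclideanSpace ℝ (Fin M.dim)) φ m X) := by
        rw [← tder_eq_fderiv]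
        exact congrArg (fun L => L X) h4
      have h6 : M.Dp m X = 0 :=
        (hM.Dp_sharp_eq_zero_iff hX).2 (hF.mem_conormal (hΩm m hm).1 c)
      have h7 := hl m h1 X
      have h8 := φ.left_inv h1
      rw [h5]
      refine he₆ _ h2 _ c ((hvert _ (he₂ h2) _).2 ?_) ((hshp _ (he₂ h2) _ _).2 ?_)
      · rw [h7, h8, h6]
      · rw [h7, h8]
        exact hX
    · intro y s h hsh
      have h1 := he₇ y s h fun τ hτ => htgt' _ (hsh τ hτ)
      have e1 : (y, s + h) ∈ e.target := by
        simpa using htgt' _ (hsh 1 ⟨zero_le_one, le_rfl⟩)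
      have e0 : (y, s) ∈ e.target := by
        simpa using htgt' _ (hsh 0 ⟨le_rfl, zero_le_one⟩)
      rw [hform _ e1, hform _ e0, h1]

end IsASCIR
end FormOver
end Realization

/-! ### Flow lines, local sections and boxes of uniform size. -/

namespace Realization

open Set

variable {k : ℕ} {B : Type v} [TopologicalSpace B] [ChartedSpace (EuclideanSpace ℝ (Fin k)) B]

namespace FormOver

/-- On `s`, the curve `γ` follows the field `ω♯(π*(∑ cᵢ daᵢ))`. -/
def FlowLine (M : FormOver.{u} k B) {n : ℕ} (a : Fin n → B → ℝ) (c : Fin n → ℝ)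
    (γ : ℝ → M.carrier) (s : Set ℝ) : Prop :=
  ∀ t ∈ s, ∃ X : EuclideanSpace ℝ (Fin M.dim),
    HasMFDerivAt 𝓘(ℝ, ℝ) (𝓡 M.dim) γ t
      ((1 : ℝ →L[ℝ] ℝ).smulRight (X : TangentSpace (𝓡 M.dim) (γ t))) ∧
    M.Sharp (γ t) (frameAt a (M.proj (γ t)) c) X

variable {M : FormOver.{u} k B} {T : RegularTwistedPoisson k B} {P : PeriodBundle T}
  {U : Set B} {n : ℕ} {a : Fin n → B → ℝ} {c : Fin n → ℝ}

theorem FlowLine.continuousAt {γ : ℝ → M.carrier} {s : Set ℝ} (h : M.FlowLine a c γ s) {t : ℝ}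
    (ht : t ∈ s) : ContinuousAt γ t := by
  obtain ⟨X, hX, -⟩ := h t ht
  exact hX.continuousAt

theorem flowsTo_iff_sharp {b : B} {α : EuclideanSpace ℝ (Fin k) →L[ℝ] ℝ} {m m' : M.carrier} :
    M.FlowsTo (b := b) α m m' ↔ ∃ γ : ℝ → M.carrier,
      (∀ t, M.proj (γ t) = b) ∧ γ 0 = m ∧ γ 1 = m' ∧ ∀ t, ∃ X : EuclideanSpace ℝ (Fin M.dim),
        HasMFDerivAt 𝓘(ℝ, ℝ) (𝓡 M.dim) γ t
          ((1 : ℝ →L[ℝ] ℝ).smulRight (X : TangentSpace (𝓡 M.dim) (γ t))) ∧ M.Sharp (γ t) α X := by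
  constructor
  · rintro ⟨γ, h, h0, h1, hγ⟩
    refine ⟨γ, h, h0, h1, fun t => ?_⟩
    obtain ⟨X, hX, hs⟩ := hγ t
    exact ⟨X, hX, fun w => (hs w).trans (Covector.at_apply (h t) α _)⟩
  · rintro ⟨γ, h, h0, h1, hγ⟩
    refine ⟨γ, h, h0, h1, fun t => ?_⟩
    obtain ⟨X, hX, hs⟩ := hγ t
    exact ⟨X, hX, fun w => (hs w).trans (Covector.at_apply (h t) α _).symm⟩

theorem flowsTo_iff {b : B} {m m' : M.carrier} :
    M.FlowsTo (b := b) (frameAt a b c) m m' ↔ ∃ γ : ℝ → M.carrier,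
      (∀ t, M.proj (γ t) = b) ∧ γ 0 = m ∧ γ 1 = m' ∧ M.FlowLine a c γ univ := by
  rw [flowsTo_iff_sharp]
  constructor
  · rintro ⟨γ, h, h0, h1, hγ⟩
    refine ⟨γ, h, h0, h1, fun t _ => ?_⟩
    rw [h t]
    exact hγ t
  · rintro ⟨γ, h, h0, h1, hγ⟩
    refine ⟨γ, h, h0, h1, fun t => ?_⟩
    have := hγ t (mem_univ t)
    rwa [h t] at this

namespace IsBox

variable {b₀ : B} {e : OpenPartialHomeomorph M.carrier (EuclideanSpace ℝ (Fin k) × (Fin n → ℝ))}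
  (he : M.IsBox U a b₀ e)
include he

theorem contMDiffAt {m : M.carrier} (hm : m ∈ e.source) :
    ContMDiffAt (𝓡 M.dim) 𝓘(ℝ, EuclideanSpace ℝ (Fin k) × (Fin n → ℝ)) ∞ e m :=
  he.contMDiffOn.contMDiffAt (e.open_source.mem_nhds hm)

theorem contMDiffAt_symm {z : EuclideanSpace ℝ (Fin k) × (Fin n → ℝ)} (hz : z ∈ e.target) :
    ContMDiffAt 𝓘(ℝ, EuclideanSpace ℝ (Fin k) × (Fin n → ℝ)) (𝓡 M.dim) ∞ e.symm z :=
  he.contMDiffOn_symm.contMDiffAt (e.open_target.mem_nhds hz)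

theorem mdifferentiableAt {m : M.carrier} (hm : m ∈ e.source) :
    MDifferentiableAt (𝓡 M.dim) 𝓘(ℝ, EuclideanSpace ℝ (Fin k) × (Fin n → ℝ)) e m :=
  (he.contMDiffAt hm).mdifferentiableAt (by simp)

theorem mdifferentiableAt_symm {z : EuclideanSpace ℝ (Fin k) × (Fin n → ℝ)} (hz : z ∈ e.target) :
    MDifferentiableAt 𝓘(ℝ, EuclideanSpace ℝ (Fin k) × (Fin n → ℝ)) (𝓡 M.dim) e.symm z :=
  (he.contMDiffAt_symm hz).mdifferentiableAt (by simp)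

theorem symm_fst {z : EuclideanSpace ℝ (Fin k) × (Fin n → ℝ)} (hz : z ∈ e.target) :
    M.proj (e.symm z) = (extChartAt (𝓡 k) b₀).symm z.1 := by
  have h1 := he.fst_eq _ (e.map_target hz)
  rw [e.right_inv hz] at h1
  rw [h1, (extChartAt (𝓡 k) b₀).left_inv (he.proj_mem_source _ (e.map_target hz))]

theorem tder_symm_apply {m : M.carrier} (hm : m ∈ e.source) (X : EuclideanSpace ℝ (Fin M.dim)) :
    tder 𝓘(ℝ, EuclideanSpace ℝ (Fin k) × (Fin n → ℝ)) (𝓡 M.dim) e.symm (e m)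
      (tder (𝓡 M.dim) 𝓘(ℝ, EuclideanSpace ℝ (Fin k) × (Fin n → ℝ)) e m X) = X := by
  refine tder_leftInverse (he.mdifferentiableAt_symm (e.map_source hm))
    (he.mdifferentiableAt hm) ?_ X
  filter_upwards [e.open_source.mem_nhds hm] with y hy
  exact e.left_inv hy

theorem hasDerivAt_comp {γ : ℝ → M.carrier} {s : Set ℝ} (hγ : M.FlowLine a c γ s) {t : ℝ}
    (ht : t ∈ s) (hs : γ t ∈ e.source) : HasDerivAt (fun t => e (γ t)) (0, c) t := by
  obtain ⟨X, hX, hsh⟩ := hγ t ht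
  have h1 := (he.mdifferentiableAt hs).hasMFDerivAt.comp t hX
  have h2 : HasFDerivAt (fun t => e (γ t)) ((tder (𝓡 M.dim)
      𝓘(ℝ, EuclideanSpace ℝ (Fin k) × (Fin n → ℝ)) e (γ t)).comp
        ((1 : ℝ →L[ℝ] ℝ).smulRight X)) t := hasMFDerivAt_iff_hasFDerivAt.1 h1
  refine h2.hasDerivAt.congr_deriv ?_
  refine Eq.trans ?_ (he.tder_sharp _ hs X c hsh)
  change tder (𝓡 M.dim) 𝓘(ℝ, EuclideanSpace ℝ (Fin k) × (Fin n → ℝ)) e (γ t) ((1 : ℝ) • X) = _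
  rw [one_smul]

/-- In a box the field is the constant vector (0, c), so straight lines are its integral curves. -/
theorem flowLine (hM : M.IsASCIR T P) (hF : P.IsFrame U a)
    {m : M.carrier} {s : Set ℝ} (hs : ∀ t ∈ s, e m + (0, t • c) ∈ e.target) :
    M.FlowLine a c (fun t => e.symm (e m + (0, t • c))) s := by
  intro t ht
  have hz := hs t ht
  have hx := e.map_target hz
  obtain ⟨X, -, hX⟩ := hM.exists_vertical_of_frameAt hF (he.proj_mem _ hx) c
  refine ⟨X, ?_, hX⟩
  have h1 := he.tder_symm_apply hx X
  rw [he.tder_sharp _ hx X c hX, e.right_inv hz] at h1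
  have h2 : HasDerivAt (fun t : ℝ => e m + (0, t • c)) (0, c) t := by
    have h3 : HasDerivAt (fun t : ℝ => t • c) c t := by
      simpa using (hasDerivAt_id t).smul_const c
    exact (HasDerivAt.prodMk (hasDerivAt_const t (0 : EuclideanSpace ℝ (Fin k))) h3).const_add _
  have h4 := (he.mdifferentiableAt_symm hz).hasMFDerivAt.comp t h2.hasFDerivAt.hasMFDerivAt
  refine h4.congr_mfderiv (ContinuousLinearMap.ext fun (r : ℝ) => ?_)
  change tder 𝓘(ℝ, EuclideanSpace ℝ (Fin k) × (Fin n → ℝ)) (𝓡 M.dim) e.symm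
    (e m + (0, t • c)) (r • ((0 : EuclideanSpace ℝ (Fin k)), c)) = r • X
  rw [map_smul, h1]

end IsBox

namespace IsASCIR

variable [IsManifold (𝓡 k) ∞ B]

/-- Two flow lines through a common point have the same constant velocity in box coordinates, so
they agree for a short time. The coincidence set is closed and extends to the right, hence fills the
interval; no uniqueness theorem for differential equations is used. -/
theorem flowLine_eqOn (hM : M.IsASCIR T P) (hF : P.IsFrame U a) {γ γ' : ℝ → M.carrier}
    (hγ : M.FlowLine a c γ (Icc 0 1)) (hγ' : M.FlowLine a c γ' (Icc 0 1))
    (hU : ∀ t ∈ Icc (0 : ℝ) 1, M.proj (γ t) ∈ U) (h0 : γ 0 = γ' 0) : EqOn γ γ' (Icc 0 1) := by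
  have hc : IsClosed ({t | γ t = γ' t} ∩ Icc 0 1) := by
    have h1 : ContinuousOn (fun t => (γ t, γ' t)) (Icc 0 1) := fun t ht =>
      ((hγ.continuousAt ht).prodMk (hγ'.continuousAt ht)).continuousWithinAt
    rw [inter_comm]
    exact h1.preimage_isClosed_of_isClosed isClosed_Icc isClosed_diagonal
  refine hc.Icc_subset_of_forall_mem_nhdsWithin h0 ?_
  rintro t ⟨hte, ht⟩
  have hti : t ∈ Icc (0 : ℝ) 1 := ⟨ht.1, ht.2.le⟩
  obtain ⟨e, hes, he⟩ := hM.exists_isBox hF (M.proj (γ t)) (hU t hti) (mem_extChartAt_source _)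
  have hte : γ t = γ' t := hte
  have h1 : ∀ᶠ x in 𝓝 t, γ x ∈ e.source ∧ γ' x ∈ e.source :=
    ((hγ.continuousAt hti).eventually (e.open_source.mem_nhds hes)).and
      ((hγ'.continuousAt hti).eventually (e.open_source.mem_nhds (hte ▸ hes)))
  obtain ⟨δ, hδ, hb⟩ := Metric.eventually_nhds_iff.1 h1
  have h2 : Ioo t (min (t + δ) 1) ∈ 𝓝[>] t :=
    Ioo_mem_nhdsGT (lt_min (by linarith) ht.2)
  refine Filter.mem_of_superset h2 fun x hx => ?_
  have hlt := lt_min_iff.1 hx.2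
  have h3 : ∀ y ∈ Icc t x, y ∈ Icc (0 : ℝ) 1 ∧ γ y ∈ e.source ∧ γ' y ∈ e.source := by
    intro y hy
    refine ⟨⟨ht.1.trans hy.1, hy.2.trans hlt.2.le⟩, hb ?_⟩
    rw [Real.dist_eq, abs_of_nonneg (by linarith [hy.1])]
    linarith [hy.2]
  have h4 : ∀ y ∈ Icc t x, HasDerivAt (fun y => e (γ y) - e (γ' y)) 0 y := by
    intro y hy
    obtain ⟨h5, h6, h7⟩ := h3 y hy
    have h8 := (he.hasDerivAt_comp hγ h5 h6).sub (he.hasDerivAt_comp hγ' h5 h7)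
    rw [sub_self] at h8
    exact h8
  have h5 := constant_of_has_deriv_right_zero
    (fun y hy => (h4 y hy).continuousAt.continuousWithinAt)
    (fun y hy => (h4 y ⟨hy.1, hy.2.le⟩).hasDerivWithinAt) x ⟨hx.1.le, le_rfl⟩
  simp only [hte, sub_self] at h5
  obtain ⟨-, h6, h7⟩ := h3 x ⟨hx.1.le, le_rfl⟩
  exact e.injOn h6 h7 (sub_eq_zero.1 h5)

/-- Translation by `c` does not depend on the box, because both sides are endpoints of the same flow
line. -/
theorem symm_add_eq (hM : M.IsASCIR T P) (hF : P.IsFrame U a) {b₀ b₁ : B}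
    {e e' : OpenPartialHomeomorph M.carrier (EuclideanSpace ℝ (Fin k) × (Fin n → ℝ))}
    (he : M.IsBox U a b₀ e) (he' : M.IsBox U a b₁ e') {m : M.carrier} (hm : m ∈ e.source)
    (hm' : m ∈ e'.source) (hc : ∀ t ∈ Icc (0 : ℝ) 1, e m + (0, t • c) ∈ e.target)
    (hc' : ∀ t ∈ Icc (0 : ℝ) 1, e' m + (0, t • c) ∈ e'.target) :
    e.symm (e m + (0, c)) = e'.symm (e' m + (0, c)) := by
  have h := hM.flowLine_eqOn hF (he.flowLine hM hF hc) (he'.flowLine hM hF hc')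
    (fun t ht => he.proj_mem _ (e.map_target (hc t ht)))
    (by simp [← Prod.zero_eq_mk, e.left_inv hm, e'.left_inv hm'])
  simpa using h ⟨zero_le_one, le_rfl⟩

/-- The projection has smooth local sections through every point. -/
theorem exists_section (hM : M.IsASCIR T P) (m : M.carrier) : ∃ (O : Set B) (σ : B → M.carrier),
    IsOpen O ∧ M.proj m ∈ O ∧ ContMDiffOn (𝓡 k) (𝓡 M.dim) ∞ σ O ∧ σ (M.proj m) = m ∧
      ∀ y ∈ O, M.proj (σ y) = y := by
  obtain ⟨U, n, a, hU, hF⟩ := P.exists_isFrame (M.proj m)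
  obtain ⟨e, hes, he⟩ := hM.exists_isBox hF (M.proj m) hU (mem_extChartAt_source _)
  set ψ := extChartAt (𝓡 k) (M.proj m) with hψ
  set τ : B → EuclideanSpace ℝ (Fin k) × (Fin n → ℝ) := fun y => (ψ y, (e m).2) with hτ
  have hτs : ∀ y ∈ ψ.source, ContMDiffAt (𝓡 k)
      𝓘(ℝ, EuclideanSpace ℝ (Fin k) × (Fin n → ℝ)) ∞ τ y :=
    fun y hy => (contMDiffAt_chart hy).prodMk_space contMDiffAt_const
  have hO : IsOpen (ψ.source ∩ τ ⁻¹' e.target) :=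
    ContinuousOn.isOpen_inter_preimage
      (fun y hy => (hτs y hy).continuousAt.continuousWithinAt)
      (isOpen_extChartAt_source _) e.open_target
  have hτm : τ (M.proj m) = e m := Prod.ext (he.fst_eq m hes).symm rfl
  refine ⟨ψ.source ∩ τ ⁻¹' e.target, e.symm ∘ τ, hO, ⟨mem_extChartAt_source _, ?_⟩, ?_, ?_, ?_⟩
  · rw [mem_preimage, hτm]
    exact e.map_source hes
  · intro y hy
    exact ((he.contMDiffAt_symm hy.2).comp y (hτs y hy.1)).contMDiffWithinAt
  · rw [Function.comp_apply, hτm, e.left_inv hes]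
  · intro y hy
    rw [Function.comp_apply, he.symm_fst hy.2]
    exact ψ.left_inv hy.1

theorem isOpenMap_proj (hM : M.IsASCIR T P) : IsOpenMap M.proj := by
  rw [isOpenMap_iff_nhds_le]
  intro m W hW
  obtain ⟨O, σ, hO, hmO, hσ, hσm, hs⟩ := hM.exists_section m
  have h1 : ContinuousAt σ (M.proj m) := (hσ.contMDiffAt (hO.mem_nhds hmO)).continuousAt
  have h2 := h1.preimage_mem_nhds (by rwa [hσm] : M.proj ⁻¹' W ∈ 𝓝 (σ (M.proj m)))
  filter_upwards [h2, hO.mem_nhds hmO] with y hy hyO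
  rwa [mem_preimage, mem_preimage, hs y hyO] at hy

/-- A tube lemma from compactness and connectedness of the fibres. Let W be a relatively compact
neighbourhood of the fibre. A nearby fibre that meets W and avoids its frontier lies inside W, since
it is connected. -/
theorem exists_saturated_nhds [T2Space B] (hM : M.IsASCIR T P) {b₀ : B} {O : Set M.carrier}
    (hO : IsOpen O)
    (h : M.proj ⁻¹' {b₀} ⊆ O) : ∃ V, IsOpen V ∧ b₀ ∈ V ∧ M.proj ⁻¹' V ⊆ O := by
  have : LocallyCompactSpace M.carrier := Manifold.locallyCompact_of_finiteDimensional (𝓡 M.dim)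
  have hπ := M.smooth_proj.continuous
  obtain ⟨W, hW, hbW, hWO, hWc⟩ :=
    exists_open_between_and_isCompact_closure (hM.compact_fiber b₀) hO h
  have hfr : IsCompact (frontier W) := hWc.of_isClosed_subset isClosed_frontier
    frontier_subset_closure
  obtain ⟨m, hm⟩ := hM.surjective b₀
  refine ⟨M.proj '' W \ M.proj '' frontier W,
    (hM.isOpenMap_proj W hW).sdiff (hfr.image hπ).isClosed, ⟨⟨m, hbW hm, hm⟩, ?_⟩, ?_⟩
  · rintro ⟨x, hx, hxb⟩
    rw [hW.frontier_eq] at hx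
    exact hx.2 (hbW hxb)
  · rintro x ⟨⟨y, hyW, hyx⟩, hx⟩
    by_contra hxO
    have h1 := (hM.connected_fiber (M.proj x)).isPreconnected
    have h2 := h1 W (closure W)ᶜ hW isClosed_closure.isOpen_compl (fun z hz => by
      by_cases hzW : z ∈ W
      · exact Or.inl hzW
      · refine Or.inr fun hzc => hx ⟨z, ?_, hz⟩
        rw [hW.frontier_eq]
        exact ⟨hzc, hzW⟩) ⟨y, hyx, hyW⟩ ⟨x, rfl, fun hxc => hxO (hWO hxc)⟩
    obtain ⟨z, -, hz1, hz2⟩ := h2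
    exact hz2 (subset_closure hz1)

/-- Finitely many boxes cover the compact fibre, giving one radius for all points over a
neighbourhood of `b₀`. This is what makes the flows complete. The neighbourhood on which one box
works yields smoothness in the point later. -/
theorem exists_uniform_isBox [T2Space B] (hM : M.IsASCIR T P) (hF : P.IsFrame U a) {b₀ : B}
    (hb₀ : b₀ ∈ U) :
    ∃ V, IsOpen V ∧ b₀ ∈ V ∧ V ⊆ U ∧ ∃ r > 0, ∀ m, M.proj m ∈ V → ∃ e, m ∈ e.source ∧
      M.IsBox U a b₀ e ∧ ∀ᶠ m' in 𝓝 m, m' ∈ e.source ∧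
        ∀ c : Fin n → ℝ, ‖c‖ < r → e m' + (0, c) ∈ e.target := by
  have key : ∃ r > 0, ∃ O, IsOpen O ∧ M.proj ⁻¹' {b₀} ⊆ O ∧ ∀ m ∈ O, ∃ e, m ∈ e.source ∧
      M.IsBox U a b₀ e ∧ ∀ᶠ m' in 𝓝 m, m' ∈ e.source ∧
        ∀ c : Fin n → ℝ, ‖c‖ < r → e m' + (0, c) ∈ e.target := by
    refine (hM.compact_fiber b₀).induction_on (p := fun K => ∃ r > 0, ∃ O, IsOpen O ∧ K ⊆ O ∧
      ∀ m ∈ O, ∃ e, m ∈ e.source ∧ M.IsBox U a b₀ e ∧ ∀ᶠ m' in 𝓝 m, m' ∈ e.source ∧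
        ∀ c : Fin n → ℝ, ‖c‖ < r → e m' + (0, c) ∈ e.target) ?_ ?_ ?_ ?_
    · exact ⟨1, one_pos, ∅, isOpen_empty, subset_rfl, fun m hm => hm.elim⟩
    · rintro s t hst ⟨r, hr, O, hO, htO, h⟩
      exact ⟨r, hr, O, hO, hst.trans htO, h⟩
    · rintro s t ⟨r, hr, O, hO, hs, h⟩ ⟨r', hr', O', hO', hs', h'⟩
      refine ⟨min r r', lt_min hr hr', O ∪ O', hO.union hO', union_subset_union hs hs', ?_⟩
      rintro m (hm | hm)
      · obtain ⟨e, h1, h2, h3⟩ := h m hm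
        exact ⟨e, h1, h2, h3.mono fun m' hm' =>
          ⟨hm'.1, fun c hc => hm'.2 c (hc.trans_le (min_le_left _ _))⟩⟩
      · obtain ⟨e, h1, h2, h3⟩ := h' m hm
        exact ⟨e, h1, h2, h3.mono fun m' hm' =>
          ⟨hm'.1, fun c hc => hm'.2 c (hc.trans_le (min_le_right _ _))⟩⟩
    · intro m hm
      have hm : M.proj m = b₀ := hm
      subst hm
      obtain ⟨e, hes, he⟩ := hM.exists_isBox hF (M.proj m) hb₀ (mem_extChartAt_source _)
      obtain ⟨ε, hε, hb⟩ := Metric.isOpen_iff.1 e.open_target _ (e.map_source hes)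
      have hS : IsOpen (e.source ∩ e ⁻¹' Metric.ball (e m) (ε / 2)) :=
        e.isOpen_inter_preimage Metric.isOpen_ball
      have hmS : m ∈ e.source ∩ e ⁻¹' Metric.ball (e m) (ε / 2) :=
        ⟨hes, Metric.mem_ball_self (half_pos hε)⟩
      refine ⟨_, mem_nhdsWithin_of_mem_nhds (hS.mem_nhds hmS), ε / 2, half_pos hε, _, hS,
        subset_rfl, fun m' hm' => ⟨e, hm'.1, he, ?_⟩⟩
      filter_upwards [hS.mem_nhds hm'] with x hx
      refine ⟨hx.1, fun c hc => hb ?_⟩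
      have h1 : dist (e x) (e m) < ε / 2 := hx.2
      have h2 : dist (e x + (0, c)) (e x) = ‖c‖ := by
        rw [dist_eq_norm, add_sub_cancel_left, Prod.norm_mk, norm_zero,
          max_eq_right (norm_nonneg _)]
      rw [Metric.mem_ball]
      linarith [dist_triangle (e x + (0, c)) (e x) (e m)]
  obtain ⟨r, hr, O, hO, hbO, h⟩ := key
  obtain ⟨V, hV, hbV, hVO⟩ := hM.exists_saturated_nhds hO hbO
  exact ⟨V ∩ U, hV.inter hF.isOpen, ⟨hbV, hb₀⟩, inter_subset_right, r, hr,
    fun m hm => h m (hVO hm.1)⟩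

end IsASCIR
end FormOver
end Realization

/-! ### From small translations to a smooth action preserving the form. -/

namespace Realization

open Set

/-- A local one-parameter family of monoid elements that is additive near `0` extends to all
parameters. -/
theorem exists_additive_extension {V G : Type*} [NormedAddCommGroup V] [NormedSpace ℝ V] [Monoid G]
    (a : V → G) {r : ℝ} (hr : 0 < r) (h0 : a 0 = 1)
    (ha : ∀ c d, ‖c‖ < r → ‖d‖ < r → a (c + d) = a c * a d) :
    ∃ ρ : V → G, (∀ c d, ρ (c + d) = ρ c * ρ d) ∧ ∀ c, ‖c‖ < r → ρ c = a c := by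
  have hpow (N : ℕ) (c : V) (h : N * ‖c‖ < r) : a ((N : ℝ) • c) = a c ^ N := by
    induction N with
    | zero => simp [h0]
    | succ N ih =>
      push_cast at h
      have h1 : N * ‖c‖ < r := by nlinarith [norm_nonneg c]
      have h2 : ‖c‖ < r := by nlinarith [norm_nonneg c, Nat.cast_nonneg (α := ℝ) N]
      push_cast
      rw [add_smul, one_smul, ha _ _ (by rwa [norm_smul, Real.norm_natCast]) h2, ih h1, pow_succ]
  -- The extension takes the N-th power at c/N. Passing to common multiples shows that every N
  -- bringing c/N into the ball gives the same result.
  set f : ℕ → V → G := fun N c => a ((N : ℝ)⁻¹ • c) ^ N with hf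
  have hsm (N : ℕ) (hN : 0 < N) (c : V) (hc : ‖c‖ < N * r) : ‖(N : ℝ)⁻¹ • c‖ < r := by
    have hN' : (0 : ℝ) < N := by exact_mod_cast hN
    rw [norm_smul, norm_inv, Real.norm_natCast, inv_mul_lt_iff₀ hN']
    exact hc
  have hmul (N K : ℕ) (hN : 0 < N) (hK : 0 < K) (c : V) (hc : ‖c‖ < N * r) :
      f (N * K) c = f N c := by
    have hK' : (0 : ℝ) < K := by exact_mod_cast hK
    have h1 : (N : ℝ)⁻¹ • c = (K : ℝ) • (((N * K : ℕ) : ℝ)⁻¹ • c) := by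
      rw [smul_smul]
      congr 1
      push_cast
      field_simp
    have h2 := hpow K (((N * K : ℕ) : ℝ)⁻¹ • c) (by
      have h3 := hsm N hN c hc
      rwa [h1, norm_smul, Real.norm_natCast] at h3)
    simp only [hf]
    rw [mul_comm N K, pow_mul, mul_comm K N, ← h2, ← h1]
  have hind (N K : ℕ) (hN : 0 < N) (hK : 0 < K) (c : V) (hc : ‖c‖ < N * r) (hc' : ‖c‖ < K * r) :
      f N c = f K c := by
    rw [← hmul N K hN hK c hc, mul_comm, hmul K N hK hN c hc']
  have hfl (c : V) : ‖c‖ < (⌊‖c‖ / r⌋₊ + 1 : ℕ) * r := by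
    rw [← div_lt_iff₀ hr]
    push_cast
    exact Nat.lt_floor_add_one _
  refine ⟨fun c => f (⌊‖c‖ / r⌋₊ + 1) c, fun c d => ?_, fun c hc => ?_⟩
  · obtain ⟨N, hN⟩ := exists_nat_gt ((‖c‖ + ‖d‖) / r)
    rw [div_lt_iff₀ hr] at hN
    have hN0 : 0 < N := by
      rcases Nat.eq_zero_or_pos N with h | h
      · rw [h, Nat.cast_zero, zero_mul] at hN
        linarith [norm_nonneg c, norm_nonneg d]
      · exact h
    have hcN : ‖c‖ < N * r := by linarith [norm_nonneg d]
    have hdN : ‖d‖ < N * r := by linarith [norm_nonneg c]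
    have hcdN : ‖c + d‖ < N * r := (norm_add_le c d).trans_lt hN
    dsimp only
    rw [hind _ N (Nat.succ_pos _) hN0 c (hfl c) hcN, hind _ N (Nat.succ_pos _) hN0 d (hfl d) hdN,
      hind _ N (Nat.succ_pos _) hN0 _ (hfl _) hcdN]
    simp only [hf]
    have h1 := hsm N hN0 c hcN
    have h2 := hsm N hN0 d hdN
    have h3 : Commute (a ((N : ℝ)⁻¹ • c)) (a ((N : ℝ)⁻¹ • d)) := by
      -- Local additivity makes the two N-th parts commute, so the power of their product splits.
      rw [Commute, SemiconjBy, ← ha _ _ h1 h2, ← ha _ _ h2 h1, add_comm]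
    rw [smul_add, ha _ _ h1 h2, h3.mul_pow]
  · dsimp only
    rw [hind _ 1 (Nat.succ_pos _) one_pos c (hfl c) (by simpa using hc)]
    simp [hf]

/-- Every vector is a sum of equal small ones. Through this, projection, smoothness and invariance
need to be checked only for small translations. -/
theorem forall_of_add_of_small {V : Type*} [NormedAddCommGroup V] [NormedSpace ℝ V]
    {p : V → Prop} {r : ℝ} (hr : 0 < r) (hs : ∀ c, ‖c‖ < r → p c)
    (ha : ∀ c d, p c → p d → p (c + d)) (c : V) : p c := by
  obtain ⟨N, hN⟩ := exists_nat_gt (‖c‖ / r)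
  have hN' : (0 : ℝ) < N := (div_nonneg (norm_nonneg c) hr.le).trans_lt hN
  have h1 : p ((N : ℝ)⁻¹ • c) := by
    refine hs _ ?_
    rw [norm_smul, norm_inv, Real.norm_natCast, inv_mul_lt_iff₀ hN']
    rwa [div_lt_iff₀ hr] at hN
  have h2 (j : ℕ) : p ((j : ℝ) • ((N : ℝ)⁻¹ • c)) := by
    induction j with
    | zero => exact hs _ (by simpa using hr)
    | succ j ih =>
      push_cast
      rw [add_smul, one_smul]
      exact ha _ _ ih h1
  have h3 := h2 N
  rwa [smul_smul, mul_inv_cancel₀ hN'.ne', one_smul] at h3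

variable {k : ℕ} {B : Type v} [TopologicalSpace B] [ChartedSpace (EuclideanSpace ℝ (Fin k)) B]

namespace FormOver

/-- `ρ` is the action of `ν*ℱ` over `U` on `M`, in the frame `da₁, …, daₙ`. -/
structure IsAction (M : FormOver.{u} k B) (U : Set B) {n : ℕ} (a : Fin n → B → ℝ)
    (ρ : (Fin n → ℝ) → M.carrier → M.carrier) : Prop where
  proj_eq : ∀ c m, M.proj (ρ c m) = M.proj m
  zero : ∀ m, ρ 0 m = m
  add : ∀ c d m, ρ (c + d) m = ρ c (ρ d m)
  contMDiffAt : ∀ c m, M.proj m ∈ U → ContMDiffAt (𝓘(ℝ, Fin n → ℝ).prod (𝓡 M.dim)) (𝓡 M.dim) ∞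
    (fun p : (Fin n → ℝ) × M.carrier => ρ p.1 p.2) (c, m)
  flowLine : ∀ c m, M.proj m ∈ U → M.FlowLine a c (fun t => ρ (t • c) m) univ
  form_eq : ∀ c m, M.proj m ∈ U → (M.form.val (ρ c m)).compContinuousLinearMap
    (tder (𝓡 M.dim) (𝓡 M.dim) (ρ c) m) = M.form.val m

variable {M : FormOver.{u} k B} {T : RegularTwistedPoisson k B} {P : PeriodBundle T}
  {U : Set B} {n : ℕ} {a : Fin n → B → ℝ}

theorem IsAction.mono {ρ : (Fin n → ℝ) → M.carrier → M.carrier} (h : M.IsAction U a ρ) {V : Set B}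
    (hV : V ⊆ U) : M.IsAction V a ρ :=
  ⟨h.proj_eq, h.zero, h.add, fun c m hm => h.contMDiffAt c m (hV hm),
    fun c m hm => h.flowLine c m (hV hm), fun c m hm => h.form_eq c m (hV hm)⟩

variable [IsManifold (𝓡 k) ∞ B]

/-- Over V, small vectors act by translation in a box, well defined by `symm_add_eq` and additive
because consecutive translations fit in one box. `exists_additive_extension` then yields all of ℝⁿ.
Smoothness and invariance of ω are inherited from the boxes. -/
theorem IsASCIR.exists_isAction [T2Space B] (hM : M.IsASCIR T P) (hF : P.IsFrame U a) {b₀ : B}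
    (hb₀ : b₀ ∈ U) : ∃ (V : Set B) (ρ : (Fin n → ℝ) → M.carrier → M.carrier),
      IsOpen V ∧ b₀ ∈ V ∧ V ⊆ U ∧ M.IsAction V a ρ := by
  classical
  obtain ⟨V, hV, hbV, hVU, r, hr, hbox⟩ := hM.exists_uniform_isBox hF hb₀
  have : Nonempty (OpenPartialHomeomorph M.carrier
      (EuclideanSpace ℝ (Fin k) × (Fin n → ℝ))) := by
    obtain ⟨m, rfl⟩ := hM.surjective b₀
    exact ⟨(hbox m hbV).choose⟩
  choose! ε hεs hε hεt using hbox
  have htgt {m} (hm : M.proj m ∈ V) {c : Fin n → ℝ} (hc : ‖c‖ < r) :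
      ε m m + (0, c) ∈ (ε m).target := (hεt m hm).self_of_nhds.2 c hc
  have hseg {c : Fin n → ℝ} (hc : ‖c‖ < r) (t : ℝ) (ht : t ∈ Icc (0 : ℝ) 1) : ‖t • c‖ < r := by
    rw [norm_smul, Real.norm_of_nonneg ht.1]
    nlinarith [norm_nonneg c, ht.2]
  -- The identity is the default away from V, so that the maps live in the endomorphism monoid of
  -- all of M and the group laws hold without side conditions.
  let s : (Fin n → ℝ) → M.carrier → M.carrier := fun c m =>
    if M.proj m ∈ V ∧ ‖c‖ < r then (ε m).symm (ε m m + (0, c)) else m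
  have hs {m} (hm : M.proj m ∈ V) {c : Fin n → ℝ} (hc : ‖c‖ < r) :
      s c m = (ε m).symm (ε m m + (0, c)) := if_pos ⟨hm, hc⟩
  have hs' {m} (hm : M.proj m ∈ V) {c : Fin n → ℝ} (hc : ‖c‖ < r)
      {e : OpenPartialHomeomorph M.carrier (EuclideanSpace ℝ (Fin k) × (Fin n → ℝ))}
      (he : M.IsBox U a b₀ e) (hme : m ∈ e.source)
      (ht : ∀ t ∈ Icc (0 : ℝ) 1, e m + (0, t • c) ∈ e.target) :
      s c m = e.symm (e m + (0, c)) := by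
    rw [hs hm hc]
    exact hM.symm_add_eq hF (hε m hm) he (hεs m hm) hme
      (fun t ht => htgt hm (hseg hc t ht)) ht
  have hsproj (c m) : M.proj (s c m) = M.proj m := by
    by_cases h : M.proj m ∈ V ∧ ‖c‖ < r
    · rw [hs h.1 h.2, (hε m h.1).symm_fst (htgt h.1 h.2), Prod.fst_add, add_zero,
        (hε m h.1).fst_eq m (hεs m h.1), (extChartAt (𝓡 k) b₀).left_inv
          ((hε m h.1).proj_mem_source m (hεs m h.1))]
    · simp only [s, if_neg h]
  let s' : (Fin n → ℝ) → Function.End M.carrier := s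
  -- Halving the radius keeps the sum within the size of the box at `m`, so both translations can be
  -- performed there.
  have hsadd (c d : Fin n → ℝ) (hc : ‖c‖ < r / 2) (hd : ‖d‖ < r / 2) :
      s' (c + d) = s' c * s' d := by
    funext m
    change s (c + d) m = s c (s d m)
    by_cases hm : M.proj m ∈ V
    · have hd' : ‖d‖ < r := by linarith
      have hc' : ‖c‖ < r := by linarith
      have hcd : ‖c + d‖ < r := by linarith [norm_add_le c d]
      have h1 : ε m (s d m) = ε m m + (0, d) := by
        rw [hs hm hd', (ε m).right_inv (htgt hm hd')]
      have h2 : s d m ∈ (ε m).source := by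
        rw [hs hm hd']
        exact (ε m).map_target (htgt hm hd')
      have h3 (x : Fin n → ℝ) : ε m m + (0, d) + (0, x) = ε m m + (0, x + d) := by
        rw [add_assoc]
        exact congrArg _ (Prod.ext (add_zero _) (add_comm d x))
      rw [hs' (by rwa [hsproj]) hc' (hε m hm) h2, h1, h3, hs hm hcd]
      intro t ht
      rw [h1, h3]
      refine htgt hm ((norm_add_le _ _).trans_lt ?_)
      have h4 : ‖t • c‖ ≤ ‖c‖ := by
        rw [norm_smul, Real.norm_of_nonneg ht.1]
        nlinarith [norm_nonneg c, ht.2]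
      linarith
    · have hm' : M.proj (s d m) ∉ V := by rwa [hsproj]
      simp only [s, hm, false_and, if_false]
  have hs0 : s' 0 = 1 := by
    funext m
    change s 0 m = m
    by_cases hm : M.proj m ∈ V
    · rw [hs hm (by simpa using hr), ← Prod.zero_eq_mk, add_zero, (ε m).left_inv (hεs m hm)]
    · simp only [s, hm, false_and, if_false]
  obtain ⟨ρ, hρadd, hρ⟩ : ∃ ρ : (Fin n → ℝ) → M.carrier → M.carrier,
      (∀ c d m, ρ (c + d) m = ρ c (ρ d m)) ∧ ∀ c m, ‖c‖ < r / 2 → ρ c m = s c m := by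
    obtain ⟨ρ, hadd, hρs⟩ := exists_additive_extension s' (half_pos hr) hs0 hsadd
    exact ⟨ρ, fun c d m => congrFun (hadd c d) m, fun c m hc => congrFun (hρs c hc) m⟩
  have hρ0 (m) : ρ 0 m = m := by
    rw [hρ 0 m (by simpa using hr)]
    exact congrFun hs0 m
  have hproj (c) : ∀ m, M.proj (ρ c m) = M.proj m := by
    refine forall_of_add_of_small (p := fun c => ∀ m, M.proj (ρ c m) = M.proj m) (half_pos hr)
      (fun c hc m => by rw [hρ c m hc, hsproj]) (fun c d hc hd m => ?_) c
    rw [hρadd, hc, hd]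
  -- Near `m` the fixed box `ε m` computes the action, whereas the definition uses a box varying
  -- with the point without any continuity.
  have hev (c) (hc : ‖c‖ < r / 2) (m) (hm : M.proj m ∈ V) :
      ∀ᶠ p : (Fin n → ℝ) × M.carrier in 𝓝 (c, m),
        ρ p.1 p.2 = (ε m).symm (ε m p.2 + (0, p.1)) := by
      have h2 : ∀ᶠ p : (Fin n → ℝ) × M.carrier in 𝓝 (c, m), ‖p.1‖ < r / 2 :=
        (continuous_fst.norm.continuousAt (x := (c, m))).eventually (gt_mem_nhds hc)
      have h3 := (continuous_snd.continuousAt (x := (c, m))).eventually (hεt m hm)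
      have h4 := (continuous_snd.continuousAt (x := (c, m))).eventually
        ((hV.preimage M.smooth_proj.continuous).mem_nhds hm)
      filter_upwards [h2, h3, h4] with p h2 h3 h4
      have hp : ‖p.1‖ < r := by linarith
      rw [hρ _ _ h2, hs' h4 hp (hε m hm) h3.1 fun t ht => h3.2 _ (hseg hp t ht)]
  have hsmooth (c) : ∀ m, M.proj m ∈ V →
      ContMDiffAt (𝓘(ℝ, Fin n → ℝ).prod (𝓡 M.dim)) (𝓡 M.dim) ∞
        (fun p : (Fin n → ℝ) × M.carrier => ρ p.1 p.2) (c, m) := by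
    refine forall_of_add_of_small (p := fun c => ∀ m, M.proj m ∈ V →
      ContMDiffAt (𝓘(ℝ, Fin n → ℝ).prod (𝓡 M.dim)) (𝓡 M.dim) ∞
        (fun p : (Fin n → ℝ) × M.carrier => ρ p.1 p.2) (c, m)) (half_pos hr) ?_ ?_ c
    · intro c hc m hm
      have h1 := hev c hc m hm
      refine ContMDiffAt.congr_of_eventuallyEq ?_ h1
      have h5 : ContMDiffAt (𝓘(ℝ, Fin n → ℝ).prod (𝓡 M.dim))
          𝓘(ℝ, EuclideanSpace ℝ (Fin k) × (Fin n → ℝ)) ∞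
          (fun p : (Fin n → ℝ) × M.carrier => ε m p.2 + (0, p.1)) (c, m) := by
        refine ContMDiffAt.add ?_ ?_
        · exact ContMDiffAt.comp (c, m) ((hε m hm).contMDiffAt (hεs m hm)) contMDiffAt_snd
        · exact contMDiffAt_const.prodMk_space contMDiffAt_fst
      exact ContMDiffAt.comp (c, m) ((hε m hm).contMDiffAt_symm (htgt hm (by linarith))) h5
    · intro c d hc hd m hm
      -- Near c + d the fixed map `ρ d` is applied first and the variable remainder, near c, second.
      have h1 : (fun p : (Fin n → ℝ) × M.carrier => ρ p.1 p.2) =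
          fun p => ρ (p.1 - d) (ρ d p.2) := by
        funext p
        rw [← hρadd, sub_add_cancel]
      rw [h1]
      have h2 : ContMDiffAt (𝓘(ℝ, Fin n → ℝ).prod (𝓡 M.dim)) (𝓡 M.dim) ∞
          (fun p : (Fin n → ℝ) × M.carrier => ρ d p.2) (c + d, m) :=
        ContMDiffAt.comp (c + d, m)
          (g := fun p : (Fin n → ℝ) × M.carrier => ρ p.1 p.2)
          (f := fun p : (Fin n → ℝ) × M.carrier => (d, p.2)) (hd m hm)
          (contMDiffAt_const.prodMk contMDiffAt_snd)
      have h3 : ContMDiffAt (𝓘(ℝ, Fin n → ℝ).prod (𝓡 M.dim)) 𝓘(ℝ, Fin n → ℝ) ∞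
          (fun p : (Fin n → ℝ) × M.carrier => p.1 - d) (c + d, m) :=
        contMDiffAt_fst.sub contMDiffAt_const
      have h4 := hc (ρ d m) (by rwa [hproj])
      refine ContMDiffAt.comp (c + d, m)
        (g := fun p : (Fin n → ℝ) × M.carrier => ρ p.1 p.2) ?_ (h3.prodMk h2)
      rwa [add_sub_cancel_right]
  refine ⟨V, ρ, hV, hbV, hVU, hproj, hρ0, hρadd, hsmooth, ?_, fun c => ?_⟩
  · intro c m hm t _
    have hm' : M.proj (ρ (t • c) m) ∈ V := by rwa [hproj]
    set x := ρ (t • c) m with hx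
    have h1 : ∀ᶠ y : ℝ in 𝓝 t, ‖(y - t) • c‖ < r / 2 := by
      have : ContinuousAt (fun y : ℝ => ‖(y - t) • c‖) t := by fun_prop
      exact this.eventually (gt_mem_nhds (by simpa using hr))
    -- By the group law the curve near time t is a small translation of the point x reached at that
    -- time, hence a straight line in the box at x.
    have h2 : (fun y : ℝ => ρ (y • c) m) =ᶠ[𝓝 t]
        (fun y => (ε x).symm (ε x x + (0, y • c))) ∘ fun y => y - t := by
      filter_upwards [h1] with y hy
      have h3 : y • c = (y - t) • c + t • c := by rw [← add_smul, sub_add_cancel]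
      rw [h3, hρadd, hρ _ _ hy, ← hx, hs hm' (by linarith), Function.comp_apply]
    obtain ⟨X, hX, hsh⟩ := (hε x hm').flowLine (c := c) (s := {(0 : ℝ)}) hM hF (m := x)
      (fun t ht => by
        rw [mem_singleton_iff.1 ht, zero_smul]
        exact htgt hm' (by simpa using hr)) 0 rfl
    have h5 : (ε x).symm (ε x x + (0, (0 : ℝ) • c)) = x := by
      rw [zero_smul, ← Prod.zero_eq_mk, add_zero, (ε x).left_inv (hεs x hm')]
    dsimp only at hsh
    rw [h5] at hsh
    refine ⟨X, ?_, hsh⟩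
    have h6 : HasMFDerivAt 𝓘(ℝ, ℝ) 𝓘(ℝ, ℝ) (fun y : ℝ => y - t) t (1 : ℝ →L[ℝ] ℝ) :=
      ((hasFDerivAt_id t).sub_const t).hasMFDerivAt
    have h7 := HasMFDerivAt.comp (g := fun y : ℝ => (ε x).symm (ε x x + (0, y • c)))
      (f := fun y => y - t) t (by rw [sub_self]; exact hX) h6
    refine (h7.congr_of_eventuallyEq h2).congr_mfderiv ?_
    exact ContinuousLinearMap.ext fun (r : ℝ) => rfl
  · refine forall_of_add_of_small (p := fun c => ∀ m, M.proj m ∈ V →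
      (M.form.val (ρ c m)).compContinuousLinearMap (tder (𝓡 M.dim) (𝓡 M.dim) (ρ c) m) =
        M.form.val m) (half_pos hr) ?_ ?_ c
    · intro c hc m hm
      have hcr : ‖c‖ < r := by linarith
      have h1 : ρ c =ᶠ[𝓝 m] (ε m).symm ∘ (fun z => z + (0, c)) ∘ ε m := by
        have h2 : ContinuousAt (fun x : M.carrier => (c, x)) m := by fun_prop
        filter_upwards [h2.eventually (hev c hc m hm)] with x hx
        exact hx
      have h2 : MDifferentiableAt 𝓘(ℝ, EuclideanSpace ℝ (Fin k) × (Fin n → ℝ))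
          𝓘(ℝ, EuclideanSpace ℝ (Fin k) × (Fin n → ℝ))
          (fun z : EuclideanSpace ℝ (Fin k) × (Fin n → ℝ) => z + (0, c)) (ε m m) :=
        (differentiableAt_id.add_const _).mdifferentiableAt
      have h3 : tder 𝓘(ℝ, EuclideanSpace ℝ (Fin k) × (Fin n → ℝ))
          𝓘(ℝ, EuclideanSpace ℝ (Fin k) × (Fin n → ℝ))
          (fun z : EuclideanSpace ℝ (Fin k) × (Fin n → ℝ) => z + (0, c)) (ε m m) =
          ContinuousLinearMap.id ℝ _ := by
        rw [tder_eq_fderiv, fderiv_add_const]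
        exact fderiv_fun_id
      have h4 := (hε m hm).mdifferentiableAt (hεs m hm)
      have h5 := tder_comp (g := (ε m).symm) (f := (fun z => z + (0, c)) ∘ ε m)
        ((hε m hm).mdifferentiableAt_symm (htgt hm hcr)) (h2.comp m h4)
      have h6 := (hε m hm).form_eq (ε m m).1 (ε m m).2 c fun τ hτ => by
        have h7 := htgt hm (hseg hcr τ hτ)
        rwa [← Prod.mk.eta (p := ε m m), Prod.mk_add_mk, add_zero] at h7
      have h8 : ((ε m m).1, (ε m m).2 + c) = ε m m + (0, c) :=
        Prod.ext (add_zero _).symm rfl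
      rw [h8, Prod.mk.eta, (ε m).left_inv (hεs m hm)] at h6
      rw [tder_congr h1, h5, tder_comp h2 h4, h3, ContinuousLinearMap.id_comp, h1.self_of_nhds]
      ext v
      have h9 := congrArg (fun A : (EuclideanSpace ℝ (Fin k) × (Fin n → ℝ)) [⋀^Fin 2]→L[ℝ] ℝ =>
        A fun i => tder (𝓡 M.dim) 𝓘(ℝ, EuclideanSpace ℝ (Fin k) × (Fin n → ℝ)) (ε m) m (v i)) h6
      refine h9.trans (congrArg (M.form.val m) ?_)
      funext i
      exact (hε m hm).tder_symm_apply (hεs m hm) (v i)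
    · intro c d hc hd m hm
      have hfix (c : Fin n → ℝ) (x : M.carrier) (hx : M.proj x ∈ V) :
          MDifferentiableAt (𝓡 M.dim) (𝓡 M.dim) (ρ c) x := by
        have h1 : ContMDiffAt (𝓡 M.dim) (𝓡 M.dim) ∞ (ρ c) x :=
          ContMDiffAt.comp x (g := fun p : (Fin n → ℝ) × M.carrier => ρ p.1 p.2)
            (f := fun x : M.carrier => (c, x)) (hsmooth c x hx)
            (contMDiffAt_const.prodMk contMDiffAt_id)
        exact h1.mdifferentiableAt (by simp)
      have hm' : M.proj (ρ d m) ∈ V := by rwa [hproj]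
      have h1 : ρ (c + d) = ρ c ∘ ρ d := funext fun m => hρadd c d m
      rw [h1, tder_comp (hfix c _ hm') (hfix d m hm), ← MForm.comp_comp, Function.comp_apply,
        hc _ hm', hd m hm]

end FormOver
end Realization

/-! ### Derivative, transitivity and stabilizers of the action. -/

namespace Realization

open Set

theorem tder_prodMk {E E' E'' : Type*} [NormedAddCommGroup E] [NormedSpace ℝ E]
    [NormedAddCommGroup E'] [NormedSpace ℝ E'] [NormedAddCommGroup E''] [NormedSpace ℝ E'']
    {H H' H'' : Type*} [TopologicalSpace H] [TopologicalSpace H'] [TopologicalSpace H'']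
    {I : ModelWithCorners ℝ E H} {I' : ModelWithCorners ℝ E' H'} {I'' : ModelWithCorners ℝ E'' H''}
    {X X' X'' : Type*} [TopologicalSpace X] [TopologicalSpace X'] [TopologicalSpace X'']
    [ChartedSpace H X] [ChartedSpace H' X'] [ChartedSpace H'' X'']
    {f : X → X'} {g : X → X''} {x : X} (hf : MDifferentiableAt I I' f x)
    (hg : MDifferentiableAt I I'' g x) (v : E) :
    tder I (I'.prod I'') (fun y => (f y, g y)) x v = (tder I I' f x v, tder I I'' g x v) := by
  rw [tder, hf.mfderiv_prod hg]
  rfl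

theorem tder_const {E E' : Type*} [NormedAddCommGroup E] [NormedSpace ℝ E]
    [NormedAddCommGroup E'] [NormedSpace ℝ E']
    {H H' : Type*} [TopologicalSpace H] [TopologicalSpace H']
    {I : ModelWithCorners ℝ E H} {I' : ModelWithCorners ℝ E' H'}
    {X X' : Type*} [TopologicalSpace X] [TopologicalSpace X']
    [ChartedSpace H X] [ChartedSpace H' X'] {x : X} {y : X'} :
    tder I I' (fun _ : X => y) x = 0 := mfderiv_const

variable {k : ℕ} {B : Type v} [TopologicalSpace B] [ChartedSpace (EuclideanSpace ℝ (Fin k)) B]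

/-- The fibre of the period bundle in terms of the model vector space. -/
def PeriodBundle.lattice {T : RegularTwistedPoisson k B} (P : PeriodBundle T) (b : B) :
    AddSubgroup (EuclideanSpace ℝ (Fin k) →L[ℝ] ℝ) := P.fiber b

namespace FormOver

variable {M : FormOver.{u} k B} {T : RegularTwistedPoisson k B} {P : PeriodBundle T}
  {U : Set B} {n : ℕ} {a : Fin n → B → ℝ} {ρ : (Fin n → ℝ) → M.carrier → M.carrier}

namespace IsAction

variable (hρ : M.IsAction U a ρ)
include hρ

theorem neg_apply (c m) : ρ (-c) (ρ c m) = m := by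
  rw [← hρ.add, neg_add_cancel, hρ.zero]

theorem apply_neg (c m) : ρ c (ρ (-c) m) = m := by
  rw [← hρ.add, add_neg_cancel, hρ.zero]

theorem comm (c d m) : ρ c (ρ d m) = ρ d (ρ c m) := by
  rw [← hρ.add, ← hρ.add, add_comm]

theorem contMDiffAt_comp {E H X : Type*} [NormedAddCommGroup E] [NormedSpace ℝ E]
    [TopologicalSpace H] {I : ModelWithCorners ℝ E H} [TopologicalSpace X] [ChartedSpace H X]
    {τ : X → Fin n → ℝ} {f : X → M.carrier} {x : X} (hx : M.proj (f x) ∈ U)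
    (hτ : ContMDiffAt I 𝓘(ℝ, Fin n → ℝ) ∞ τ x) (hf : ContMDiffAt I (𝓡 M.dim) ∞ f x) :
    ContMDiffAt I (𝓡 M.dim) ∞ (fun y => ρ (τ y) (f y)) x :=
  ContMDiffAt.comp x (g := fun p : (Fin n → ℝ) × M.carrier => ρ p.1 p.2)
    (f := fun y => (τ y, f y)) (hρ.contMDiffAt _ _ hx) (hτ.prodMk hf)

theorem contMDiffAt_apply (c : Fin n → ℝ) {m : M.carrier} (hm : M.proj m ∈ U) :
    ContMDiffAt (𝓡 M.dim) (𝓡 M.dim) ∞ (ρ c) m :=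
  hρ.contMDiffAt_comp hm contMDiffAt_const contMDiffAt_id

theorem mdifferentiableAt_apply (c : Fin n → ℝ) {m : M.carrier} (hm : M.proj m ∈ U) :
    MDifferentiableAt (𝓡 M.dim) (𝓡 M.dim) (ρ c) m :=
  (hρ.contMDiffAt_apply c hm).mdifferentiableAt (by simp)

theorem form_tder (c : Fin n → ℝ) {m : M.carrier} (hm : M.proj m ∈ U)
    (v w : EuclideanSpace ℝ (Fin M.dim)) :
    M.form.val (ρ c m) ![tder (𝓡 M.dim) (𝓡 M.dim) (ρ c) m v,
      tder (𝓡 M.dim) (𝓡 M.dim) (ρ c) m w] = M.form.val m ![v, w] := by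
  rw [← hρ.form_eq c m hm, ContinuousAlternatingMap.compContinuousLinearMap_apply]
  congr 1
  funext i
  fin_cases i <;> rfl

theorem exists_velocity (c : Fin n → ℝ) {m : M.carrier} (hm : M.proj m ∈ U) :
    ∃ X : EuclideanSpace ℝ (Fin M.dim), M.Sharp m (frameAt a (M.proj m) c) X ∧
      HasMFDerivAt 𝓘(ℝ, ℝ) (𝓡 M.dim) (fun t : ℝ => ρ (t • c) m) 0
        ((1 : ℝ →L[ℝ] ℝ).smulRight (X : TangentSpace (𝓡 M.dim) (ρ ((0 : ℝ) • c) m))) := by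
  obtain ⟨X, hX, hs⟩ := hρ.flowLine c m hm 0 (mem_univ _)
  dsimp only at hs
  rw [zero_smul, hρ.zero] at hs
  exact ⟨X, hs, hX⟩

/-- The derivative of `x ↦ ρ (τ x) (f x)`. -/
theorem tder_action {E H X : Type*} [NormedAddCommGroup E] [NormedSpace ℝ E]
    [TopologicalSpace H] {I : ModelWithCorners ℝ E H} [TopologicalSpace X] [ChartedSpace H X]
    {τ : X → Fin n → ℝ} {f : X → M.carrier} {x : X} (hx : M.proj (f x) ∈ U)
    (hτ : MDifferentiableAt I 𝓘(ℝ, Fin n → ℝ) τ x) (hf : MDifferentiableAt I (𝓡 M.dim) f x)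
    (v : E) : ∃ Y : EuclideanSpace ℝ (Fin M.dim),
      M.Sharp (f x) (frameAt a (M.proj (f x)) (tder I 𝓘(ℝ, Fin n → ℝ) τ x v)) Y ∧
      tder I (𝓡 M.dim) (fun y => ρ (τ y) (f y)) x v =
        tder (𝓡 M.dim) (𝓡 M.dim) (ρ (τ x)) (f x) (tder I (𝓡 M.dim) f x v + Y) := by
  set d := tder I 𝓘(ℝ, Fin n → ℝ) τ x v with hd
  set m := f x with hm
  set c := τ x with hc
  have hD : MDifferentiableAt (𝓘(ℝ, Fin n → ℝ).prod (𝓡 M.dim)) (𝓡 M.dim)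
      (fun p : (Fin n → ℝ) × M.carrier => ρ p.1 p.2) (c, m) :=
    (hρ.contMDiffAt c m hx).mdifferentiableAt (by simp)
  set D := tder (𝓘(ℝ, Fin n → ℝ).prod (𝓡 M.dim)) (𝓡 M.dim)
      (fun p : (Fin n → ℝ) × M.carrier => ρ p.1 p.2) (c, m) with hDdef
  have h1 : tder I (𝓡 M.dim) (fun y => ρ (τ y) (f y)) x v = D (d, tder I (𝓡 M.dim) f x v) := by
    have h2 := tder_comp (g := fun p : (Fin n → ℝ) × M.carrier => ρ p.1 p.2)
      (f := fun y => (τ y, f y)) (x := x) hD (hτ.prodMk hf)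
    have h3 := congrArg (fun L => L v) h2
    refine h3.trans ?_
    rw [ContinuousLinearMap.comp_apply, tder_prodMk hτ hf]
  have h2 (w : EuclideanSpace ℝ (Fin M.dim)) :
      D (0, w) = tder (𝓡 M.dim) (𝓡 M.dim) (ρ c) m w := by
    have hcst : MDifferentiableAt (𝓡 M.dim) 𝓘(ℝ, Fin n → ℝ) (fun _ : M.carrier => c) m :=
      mdifferentiableAt_const
    have hid : MDifferentiableAt (𝓡 M.dim) (𝓡 M.dim) (fun y : M.carrier => y) m :=
      mdifferentiableAt_id
    have h2 := tder_comp (g := fun p : (Fin n → ℝ) × M.carrier => ρ p.1 p.2)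
      (f := fun y : M.carrier => (c, y)) (x := m) hD (hcst.prodMk hid)
    have h3 := congrArg (fun L => L w) h2
    refine Eq.trans ?_ h3.symm
    rw [ContinuousLinearMap.comp_apply, tder_prodMk hcst hid, tder_const]
    exact congrArg (fun z => D (0, z)) (congrArg (fun L => L w) tder_id.symm)
  obtain ⟨Y, hY, hYd⟩ := hρ.exists_velocity d hx
  refine ⟨Y, hY, ?_⟩
  -- The curve t ↦ ρ (c + t • d) m equals `ρ c` applied to t ↦ ρ (t • d) m, so the partial
  -- derivative in the parameter is the image of the velocity Y.
  have h3 : D (d, 0) = tder (𝓡 M.dim) (𝓡 M.dim) (ρ c) m Y := by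
    have hcst : MDifferentiableAt 𝓘(ℝ, ℝ) (𝓡 M.dim) (fun _ : ℝ => m) 0 :=
      mdifferentiableAt_const
    have hl' : HasFDerivAt (fun t : ℝ => c + t • d) ((1 : ℝ →L[ℝ] ℝ).smulRight d) 0 :=
      (((1 : ℝ →L[ℝ] ℝ).smulRight d).hasFDerivAt).const_add c
    have hl : MDifferentiableAt 𝓘(ℝ, ℝ) 𝓘(ℝ, Fin n → ℝ) (fun t : ℝ => c + t • d) 0 :=
      hl'.differentiableAt.mdifferentiableAt
    have e0 : c + (0 : ℝ) • d = c := by rw [zero_smul, add_zero]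
    have h2 := tder_comp (g := fun p : (Fin n → ℝ) × M.carrier => ρ p.1 p.2)
      (f := fun t : ℝ => (c + t • d, m)) (x := 0) (by rw [e0]; exact hD) (hl.prodMk hcst)
    have h3 := congrArg (fun L => L (1 : ℝ)) h2
    rw [ContinuousLinearMap.comp_apply, tder_prodMk hl hcst, tder_const, e0, tder_eq_fderiv,
      hl'.fderiv] at h3
    have h4 := tder_comp (g := ρ c) (f := fun t : ℝ => ρ (t • d) m) (x := 0)
      (by
        rw [zero_smul, hρ.zero]
        exact hρ.mdifferentiableAt_apply c hx) hYd.mdifferentiableAt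
    have h5 : (ρ c ∘ fun t : ℝ => ρ (t • d) m) =
        (fun p : (Fin n → ℝ) × M.carrier => ρ p.1 p.2) ∘ fun t : ℝ => (c + t • d, m) := by
      funext t
      exact (hρ.add c (t • d) m).symm
    have h6 : tder 𝓘(ℝ, ℝ) (𝓡 M.dim) (fun t : ℝ => ρ (t • d) m) 0 (1 : ℝ) = Y := by
      rw [tder, hYd.mfderiv]
      exact one_smul ℝ Y
    rw [h5] at h4
    have h7 := congrArg (fun L => L (1 : ℝ)) h4
    rw [ContinuousLinearMap.comp_apply, h6, zero_smul, hρ.zero] at h7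
    rw [← h7, h3]
    exact congrArg (fun z => D (z, 0)) (one_smul ℝ d).symm
  rw [h1, map_add, ← h2, ← h3, ← map_add]
  congr 1
  exact Prod.ext (zero_add d).symm (add_zero _).symm

end IsAction

namespace IsASCIR

variable (hM : M.IsASCIR T P) (hF : P.IsFrame U a) (hρ : M.IsAction U a ρ)
include hM hF hρ

/-- Since `ρ` preserves ω, only the added vertical velocities Y and Z matter. Their mutual pairing
vanishes, and pairing them with other vectors evaluates base covectors. The correction thus depends
only on dτ and on projections to the base, which is why it cancels between the two factors of a
tensor product. -/
theorem form_tder_action {E H X : Type*} [NormedAddCommGroup E] [NormedSpace ℝ E]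
    [TopologicalSpace H] {I : ModelWithCorners ℝ E H} [TopologicalSpace X] [ChartedSpace H X]
    {τ : X → Fin n → ℝ} {f : X → M.carrier} {x : X} (hx : M.proj (f x) ∈ U)
    (hτ : MDifferentiableAt I 𝓘(ℝ, Fin n → ℝ) τ x) (hf : MDifferentiableAt I (𝓡 M.dim) f x)
    (v w : E) :
    M.form.val (ρ (τ x) (f x)) ![tder I (𝓡 M.dim) (fun y => ρ (τ y) (f y)) x v,
      tder I (𝓡 M.dim) (fun y => ρ (τ y) (f y)) x w] =
    M.form.val (f x) ![tder I (𝓡 M.dim) f x v, tder I (𝓡 M.dim) f x w] +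
      frameAt a (M.proj (f x)) (tder I 𝓘(ℝ, Fin n → ℝ) τ x v)
        (M.Dp (f x) (tder I (𝓡 M.dim) f x w)) -
      frameAt a (M.proj (f x)) (tder I 𝓘(ℝ, Fin n → ℝ) τ x w)
        (M.Dp (f x) (tder I (𝓡 M.dim) f x v)) := by
  obtain ⟨Y, hY, hv⟩ := hρ.tder_action hx hτ hf v
  obtain ⟨Z, hZ, hw⟩ := hρ.tder_action hx hτ hf w
  have hYv := (hM.Dp_sharp_eq_zero_iff hY).2 (hF.mem_conormal hx _)
  have h1 (p q : EuclideanSpace ℝ (Fin M.dim)) : M.form.val (f x) ![p + Y, q + Z] =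
      M.form.val (f x) ![p, q] + M.form.val (f x) ![p, Z] + M.form.val (f x) ![Y, q] +
        M.form.val (f x) ![Y, Z] := by
    simp only [← pairing_apply, map_add, add_apply]
    ring
  rw [hv, hw, hρ.form_tder _ hx, h1, hY, hY, form_swap _ _ Z, hZ, 
    (hM.Dp_sharp_eq_zero_iff hZ).2 (hF.mem_conormal hx _), map_zero]
  ring

variable [IsManifold (𝓡 k) ∞ B]

theorem action_eq_of_flowLine {c : Fin n → ℝ} {γ : ℝ → M.carrier}
    (hγ : M.FlowLine a c γ (Icc 0 1)) (h0 : M.proj (γ 0) ∈ U) : γ 1 = ρ c (γ 0) := by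
  have h1 := hM.flowLine_eqOn hF (γ := fun t => ρ (t • c) (γ 0))
    (fun t _ => hρ.flowLine c (γ 0) h0 t (mem_univ t)) hγ
    (fun t _ => by rwa [hρ.proj_eq]) (by simp [hρ.zero])
  have h2 := h1 (right_mem_Icc.2 zero_le_one)
  simp only [one_smul] at h2
  exact h2.symm

/-- Existence of the flow comes from the action and its uniqueness from `flowLine_eqOn`. From here
on `FlowsTo` is handled through `ρ`. -/
theorem flowsTo_iff_eq {b : B} (hb : b ∈ U) {c : Fin n → ℝ} {m m' : M.carrier} :
    M.FlowsTo (b := b) (frameAt a b c) m m' ↔ M.proj m = b ∧ m' = ρ c m := by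
  rw [flowsTo_iff]
  constructor
  · rintro ⟨γ, h, rfl, rfl, hγ⟩
    exact ⟨h 0, hM.action_eq_of_flowLine hF hρ (fun t _ => hγ t (mem_univ t)) (by rwa [h])⟩
  · rintro ⟨rfl, rfl⟩
    exact ⟨fun t => ρ (t • c) m, fun t => hρ.proj_eq _ _, by simp [hρ.zero], by simp,
      hρ.flowLine c m hb⟩

theorem action_eq_of_isBox {b₀ : B}
    {e : OpenPartialHomeomorph M.carrier (EuclideanSpace ℝ (Fin k) × (Fin n → ℝ))}
    (he : M.IsBox U a b₀ e) {m : M.carrier} (hm : m ∈ e.source) {c : Fin n → ℝ}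
    (hc : ∀ t ∈ Icc (0 : ℝ) 1, e m + (0, t • c) ∈ e.target) : ρ c m = e.symm (e m + (0, c)) := by
  have h0 : e.symm (e m + (0, (0 : ℝ) • c)) = m := by
    rw [zero_smul, ← Prod.zero_eq_mk, add_zero, e.left_inv hm]
  have h1 := hM.action_eq_of_flowLine hF hρ (he.flowLine hM hF hc)
    (by rw [h0]; exact he.proj_mem m hm)
  rw [h0, one_smul] at h1
  exact h1.symm

/-- Near a pair of points in a fibre, the translation taking one point to the other can be chosen
smoothly. -/
theorem exists_difference {m : M.carrier} (hm : M.proj m ∈ U) (c : Fin n → ℝ) :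
    ∃ (O : Set (M.carrier × M.carrier)) (δ : M.carrier × M.carrier → Fin n → ℝ), IsOpen O ∧
      (m, ρ c m) ∈ O ∧ δ (m, ρ c m) = c ∧
      (∀ p ∈ O, ContMDiffAt ((𝓡 M.dim).prod (𝓡 M.dim)) 𝓘(ℝ, Fin n → ℝ) ∞ δ p) ∧
      ∀ p ∈ O, M.proj p.1 ∈ U ∧ (M.proj p.1 = M.proj p.2 → ρ (δ p) p.1 = p.2) := by
  have hm' : M.proj (ρ c m) ∈ U := by rwa [hρ.proj_eq]
  obtain ⟨e, hes, he⟩ := hM.exists_isBox hF (M.proj (ρ c m)) hm' (mem_extChartAt_source _)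
  obtain ⟨ε, hε, hb⟩ := Metric.isOpen_iff.1 e.open_target _ (e.map_source hes)
  have hS : IsOpen (e.source ∩ e ⁻¹' Metric.ball (e (ρ c m)) ε) :=
    e.isOpen_inter_preimage Metric.isOpen_ball
  set S := e.source ∩ e ⁻¹' Metric.ball (e (ρ c m)) ε with hSdef
  have hmS : ρ c m ∈ S := ⟨hes, Metric.mem_ball_self hε⟩
  have hW : IsOpen (M.proj ⁻¹' U ∩ ρ c ⁻¹' S) := ContinuousOn.isOpen_inter_preimage
    (fun x hx => (hρ.contMDiffAt_apply c hx).continuousAt.continuousWithinAt)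
    (hF.isOpen.preimage M.smooth_proj.continuous) hS
  -- After `ρ c` both points lie in one box, where the remaining translation is the difference of
  -- fibre coordinates. The preimage of a ball makes the segment between them stay in the target.
  refine ⟨(M.proj ⁻¹' U ∩ ρ c ⁻¹' S) ×ˢ S, fun p => c + ((e p.2).2 - (e (ρ c p.1)).2),
    hW.prod hS, ⟨⟨hm, hmS⟩, hmS⟩, by simp, ?_, ?_⟩
  · rintro ⟨x, y⟩ ⟨⟨hxU, hxS⟩, hyS⟩
    have h1 : ContMDiffAt ((𝓡 M.dim).prod (𝓡 M.dim)) 𝓘(ℝ, EuclideanSpace ℝ (Fin k) × (Fin n → ℝ)) ∞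
        (fun p : M.carrier × M.carrier => e p.2) (x, y) :=
      ContMDiffAt.comp (x, y) (he.contMDiffAt hyS.1) contMDiffAt_snd
    have h2 : ContMDiffAt ((𝓡 M.dim).prod (𝓡 M.dim)) 𝓘(ℝ, EuclideanSpace ℝ (Fin k) × (Fin n → ℝ)) ∞
        (fun p : M.carrier × M.carrier => e (ρ c p.1)) (x, y) :=
      ContMDiffAt.comp (x, y) (he.contMDiffAt hxS.1)
        (ContMDiffAt.comp (x, y) (hρ.contMDiffAt_apply c hxU) contMDiffAt_fst)
    have h3 (z) : ContMDiffAt 𝓘(ℝ, EuclideanSpace ℝ (Fin k) × (Fin n → ℝ)) 𝓘(ℝ, Fin n → ℝ) ∞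
        (Prod.snd : EuclideanSpace ℝ (Fin k) × (Fin n → ℝ) → Fin n → ℝ) z :=
      contDiffAt_snd.contMDiffAt
    exact contMDiffAt_const.add (((h3 _).comp (x, y) h1).sub ((h3 _).comp (x, y) h2))
  · rintro ⟨x, y⟩ ⟨⟨hxU, hxS⟩, hyS⟩
    refine ⟨hxU, fun hxy => ?_⟩
    dsimp only at hxU hxS hyS hxy
    have h1 : (e y).1 = (e (ρ c x)).1 := by
      rw [he.fst_eq _ hyS.1, he.fst_eq _ hxS.1, hρ.proj_eq c x, hxy]
    have h2 (t : ℝ) : e (ρ c x) + (0, t • ((e y).2 - (e (ρ c x)).2)) =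
        e (ρ c x) + t • (e y - e (ρ c x)) := by
      congr 1
      refine Prod.ext ?_ rfl
      change 0 = t • ((e y).1 - (e (ρ c x)).1)
      rw [h1, sub_self, smul_zero]
    dsimp only
    rw [add_comm c, hρ.add, hM.action_eq_of_isBox hF hρ he hxS.1]
    · have h3 := h2 1
      rw [one_smul, one_smul, add_sub_cancel] at h3
      rw [h3, e.left_inv hyS.1]
    · intro t ht
      rw [h2]
      exact hb ((convex_ball _ _).add_smul_sub_mem hxS.2 hyS.2 ht)

/-- `exists_difference` at c = 0 shows that orbits are open in the fibre. So is the complement of an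
orbit, and the fibre is connected. -/
theorem exists_action_eq {m m' : M.carrier} (hm : M.proj m ∈ U) (h : M.proj m = M.proj m') :
    ∃ c, ρ c m = m' := by
  have hloc {x : M.carrier} (hx : M.proj x ∈ U) :
      ∀ᶠ y in 𝓝 x, M.proj x = M.proj y → ∃ c, ρ c x = y := by
    obtain ⟨O, δ, hO, hxO, -, -, hδ⟩ := hM.exists_difference hF hρ hx 0
    rw [hρ.zero] at hxO
    have hc : ContinuousAt (fun y : M.carrier => (x, y)) x := by fun_prop
    filter_upwards [hc.eventually (hO.mem_nhds hxO)] with y hy hxy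
    exact ⟨_, (hδ _ hy).2 hxy⟩
  have hpre := (hM.connected_fiber (M.proj m)).isPreconnected
  have hsub : M.proj ⁻¹' {M.proj m} ⊆ {y | ∃ c, ρ c m = y} := by
    have : PreconnectedSpace (M.proj ⁻¹' {M.proj m}) := Subtype.preconnectedSpace hpre
    set S : Set (M.proj ⁻¹' {M.proj m}) := {y | ∃ c, ρ c m = y.1} with hS
    have h1 : IsOpen S := by
      rw [isOpen_iff_mem_nhds]
      rintro y ⟨c, hc⟩
      have hy : M.proj y.1 = M.proj m := y.2
      have h2 := hloc (x := y.1) (by rwa [hy])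
      filter_upwards [continuous_subtype_val.continuousAt.eventually h2] with z hz
      obtain ⟨d, hd⟩ := hz (hy.trans (z.2 : M.proj z.1 = M.proj m).symm)
      exact ⟨d + c, by rw [hρ.add, hc, hd]⟩
    have h2 : IsOpen Sᶜ := by
      rw [isOpen_iff_mem_nhds]
      intro y hy
      have hym : M.proj y.1 = M.proj m := y.2
      have h2 := hloc (x := y.1) (by rwa [hym])
      filter_upwards [continuous_subtype_val.continuousAt.eventually h2] with z hz
      obtain ⟨d, hd⟩ := hz (hym.trans (z.2 : M.proj z.1 = M.proj m).symm)
      rintro ⟨c, hc⟩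
      exact hy ⟨-d + c, by rw [hρ.add, hc, ← hd, hρ.neg_apply]⟩
    have h3 : IsClopen S := ⟨isOpen_compl_iff.1 h2, h1⟩
    have h4 := h3.eq_univ ⟨⟨m, rfl⟩, 0, hρ.zero m⟩
    intro y hy
    have h5 : (⟨y, hy⟩ : M.proj ⁻¹' {M.proj m}) ∈ S := h4 ▸ mem_univ _
    exact h5
  exact hsub h.symm

/-- The period bundle records the covectors fixing a whole fibre. The action being commutative and
transitive on the fibre, fixing one point is equivalent. -/
theorem action_eq_self_iff {m : M.carrier} (hm : M.proj m ∈ U) {c : Fin n → ℝ} :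
    ρ c m = m ↔ frameAt a (M.proj m) c ∈ P.lattice (M.proj m) := by
  refine Iff.trans ?_ (hM.period (M.proj m) (frameAt a (M.proj m) c)).symm
  constructor
  · refine fun h => ⟨hF.mem_conormal hm c, fun m' hm' => ?_⟩
    refine (hM.flowsTo_iff_eq hF hρ hm).2 ⟨hm', ?_⟩
    obtain ⟨d, rfl⟩ := hM.exists_action_eq hF hρ hm hm'.symm
    rw [hρ.comm, h]
  · exact fun h => ((hM.flowsTo_iff_eq hF hρ hm).1 (h.2 m rfl)).2.symm

end IsASCIR
end FormOver
end Realization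

/-! ### The quotient set, its identification with M₁, and local lifts. -/

namespace Realization

open Set

variable {k : ℕ} {B : Type v} [TopologicalSpace B] [ChartedSpace (EuclideanSpace ℝ (Fin k)) B]

namespace FormOver

variable {M M₁ M₂ : FormOver.{u} k B} {T : RegularTwistedPoisson k B} {P : PeriodBundle T}

theorem FlowsTo.proj_eq {b : B} {α : Covector k b} {m m' : M.carrier} (h : M.FlowsTo α m m') :
    M.proj m = b := by
  obtain ⟨γ, h, rfl, -, -⟩ := h
  exact h 0

/-- A section of the projection that is smooth on an open set. -/
structure LocalSection (M : FormOver.{u} k B) where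
  toFun : B → M.carrier
  dom : Set B
  isOpen_dom : IsOpen dom
  proj_eq : ∀ y, M.proj (toFun y) = y
  contMDiffAt : ∀ y ∈ dom, ContMDiffAt (𝓡 k) (𝓡 M.dim) ∞ toFun y

instance : CoeFun (LocalSection M) fun _ => B → M.carrier := ⟨LocalSection.toFun⟩

namespace LocalSection

variable (σ : LocalSection M)

theorem mdifferentiableAt {y : B} (hy : y ∈ σ.dom) : MDifferentiableAt (𝓡 k) (𝓡 M.dim) σ y :=
  (σ.contMDiffAt y hy).mdifferentiableAt (by simp)

theorem Dp_tder {y : B} (hy : y ∈ σ.dom) (v : EuclideanSpace ℝ (Fin k)) :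
    M.Dp (σ y) (tder (𝓡 k) (𝓡 M.dim) σ y v) = v := by
  refine tder_leftInverse (mdifferentiableAt_proj _) (σ.mdifferentiableAt hy) ?_ v
  exact Filter.Eventually.of_forall σ.proj_eq

/-- `ω₁ + π*(σ*ω₂ - Θ)`. -/
noncomputable def form (Θ : MForm k 2 B) (M₁ : FormOver.{u} k B) : MForm M₁.dim 2 M₁.carrier :=
  M₁.form + ((M.form.pullback σ : MForm k 2 B) - Θ).pullback M₁.proj

theorem form_apply (Θ : MForm k 2 B) (m : M₁.carrier) (v w : EuclideanSpace ℝ (Fin M₁.dim)) :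
    (σ.form Θ M₁).val m ![v, w] = M₁.form.val m ![v, w] +
      (M.form.val (σ (M₁.proj m)) ![tder (𝓡 k) (𝓡 M.dim) σ (M₁.proj m) (M₁.Dp m v),
        tder (𝓡 k) (𝓡 M.dim) σ (M₁.proj m) (M₁.Dp m w)] -
      Θ.val (M₁.proj m) ![M₁.Dp m v, M₁.Dp m w]) := by
  have h1 (L : EuclideanSpace ℝ (Fin M₁.dim) →L[ℝ] EuclideanSpace ℝ (Fin k)) :
      (fun i => L (![v, w] i)) = ![L v, L w] := by
    funext i
    fin_cases i <;> rfl
  have h2 (L : EuclideanSpace ℝ (Fin k) →L[ℝ] EuclideanSpace ℝ (Fin M.dim)) (v w) :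
      (fun i => L (![v, w] i)) = ![L v, L w] := by
    funext i
    fin_cases i <;> rfl
  rw [← h2, ← h1 (M₁.Dp m)]
  rfl

theorem smoothAt_form {Θ : MForm k 2 B} (hΘ : Θ.Smooth) [IsManifold (𝓡 k) ∞ B] {m : M₁.carrier}
    (hm : M₁.proj m ∈ σ.dom) : (σ.form Θ M₁).SmoothAt m :=
  (M₁.smoothAt_form m).add (MForm.SmoothAt.pullback M₁.smooth_proj.contMDiffAt
    ((MForm.SmoothAt.pullback (σ.contMDiffAt _ hm) (M.smoothAt_form _)).sub
      (MForm.smooth_iff.1 hΘ _)))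

end LocalSection

variable [IsManifold (𝓡 k) ∞ B]

/-- A smooth local section is extended by arbitrary choices to all of B. Having a total section lets
`emb` be a bijection from the whole of M₁. -/
theorem IsASCIR.exists_localSection (hM : M.IsASCIR T P) (m : M.carrier) :
    ∃ σ : LocalSection M, M.proj m ∈ σ.dom ∧ σ (M.proj m) = m := by
  classical
  obtain ⟨O, σ, hO, hmO, hσ, hσm, hs⟩ := hM.exists_section m
  choose s hs' using hM.surjective
  refine ⟨⟨O.piecewise σ s, O, hO, fun y => ?_, fun y hy => ?_⟩, hmO, ?_⟩
  · by_cases hy : y ∈ O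
    · rw [O.piecewise_eq_of_mem _ _ hy, hs y hy]
    · rw [O.piecewise_eq_of_notMem _ _ hy, hs']
  · refine (hσ.contMDiffAt (hO.mem_nhds hy)).congr_of_eventuallyEq ?_
    filter_upwards [hO.mem_nhds hy] with z hz
    exact O.piecewise_eq_of_mem _ _ hz
  · exact (O.piecewise_eq_of_mem _ _ hmO).trans hσm

theorem IsASCIR.exists_common_action [T2Space B] (h₁ : M₁.IsASCIR T P) (h₂ : M₂.IsASCIR T P)
    (b : B) : ∃ (V : Set B) (n : ℕ) (a : Fin n → B → ℝ) (ρ₁ : (Fin n → ℝ) → M₁.carrier → M₁.carrier)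
      (ρ₂ : (Fin n → ℝ) → M₂.carrier → M₂.carrier), b ∈ V ∧ P.IsFrame V a ∧ M₁.IsAction V a ρ₁ ∧
        M₂.IsAction V a ρ₂ := by
  obtain ⟨U, n, a, hb, hF⟩ := P.exists_isFrame b
  obtain ⟨V₁, ρ₁, hV₁, hb₁, hU₁, hρ₁⟩ := h₁.exists_isAction hF hb
  obtain ⟨V₂, ρ₂, hV₂, hb₂, -, hρ₂⟩ := h₂.exists_isAction hF hb
  exact ⟨V₁ ∩ V₂, n, a, ρ₁, ρ₂, ⟨hb₁, hb₂⟩,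
    hF.mono (hV₁.inter hV₂) (inter_subset_left.trans hU₁), hρ₁.mono inter_subset_left,
    hρ₂.mono inter_subset_right⟩

/-- One frame trivializes both actions, turning the anti-diagonal into pairs (c, -c). -/
theorem sameAntiOrbit_iff (h₁ : M₁.IsASCIR T P) (h₂ : M₂.IsASCIR T P) {V : Set B} {n : ℕ}
    {a : Fin n → B → ℝ} {ρ₁ : (Fin n → ℝ) → M₁.carrier → M₁.carrier}
    {ρ₂ : (Fin n → ℝ) → M₂.carrier → M₂.carrier} (hF : P.IsFrame V a) (hρ₁ : M₁.IsAction V a ρ₁)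
    (hρ₂ : M₂.IsAction V a ρ₂) {p p' : FiberProduct M₁ M₂} (hp : M₁.proj p.1.1 ∈ V) :
    SameAntiOrbit T p p' ↔ ∃ c, p'.1.1 = ρ₁ c p.1.1 ∧ p'.1.2 = ρ₂ (-c) p.1.2 := by
  constructor
  · rintro ⟨b, α, hα, f₁, f₂⟩
    obtain rfl := f₁.proj_eq
    obtain ⟨c, hc⟩ := hF.exists_eq hp hα
    have hc' : -α = (frameAt a (M₁.proj p.1.1) (-c) : EuclideanSpace ℝ (Fin k) →L[ℝ] ℝ) := by
      rw [frameAt_neg, ← hc]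
      rfl
    rw [hc] at f₁
    rw [hc'] at f₂
    exact ⟨c, ((h₁.flowsTo_iff_eq hF hρ₁ hp).1 f₁).2, ((h₂.flowsTo_iff_eq hF hρ₂ hp).1 f₂).2⟩
  · rintro ⟨c, hc₁, hc₂⟩
    refine ⟨M₁.proj p.1.1, frameAt a (M₁.proj p.1.1) c, hF.mem_conormal hp c,
      (h₁.flowsTo_iff_eq hF hρ₁ hp).2 ⟨rfl, hc₁⟩, ?_⟩
    have h := (h₂.flowsTo_iff_eq hF hρ₂ hp (m := p.1.2) (m' := p'.1.2) (c := -c)).2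
      ⟨p.2.symm, hc₂⟩
    rw [frameAt_neg] at h
    exact h

variable [T2Space B]

/-- The orbits of the anti-diagonal form a partition. -/
def antiSetoid (h₁ : M₁.IsASCIR T P) (h₂ : M₂.IsASCIR T P) : Setoid (FiberProduct M₁ M₂) where
  r := SameAntiOrbit T
  iseqv := by
    have hproj {p p' : FiberProduct M₁ M₂} (h : SameAntiOrbit T p p') :
        M₁.proj p.1.1 = M₁.proj p'.1.1 := by
      obtain ⟨b, α, -, ⟨γ, h, h0, h1, -⟩, -⟩ := h
      rw [← h0, ← h1, h, h]
    refine ⟨fun p => ?_, fun {p p'} h => ?_, fun {p p' p''} h h' => ?_⟩ <;>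
      obtain ⟨V, n, a, ρ₁, ρ₂, hb, hF, hρ₁, hρ₂⟩ := h₁.exists_common_action h₂ (M₁.proj p.1.1)
    · refine (sameAntiOrbit_iff h₁ h₂ hF hρ₁ hρ₂ hb).2 ⟨0, ?_, ?_⟩
      · rw [hρ₁.zero]
      · rw [neg_zero, hρ₂.zero]
    · have hb' := hproj h ▸ hb
      obtain ⟨c, e₁, e₂⟩ := (sameAntiOrbit_iff h₁ h₂ hF hρ₁ hρ₂ hb).1 h
      refine (sameAntiOrbit_iff h₁ h₂ hF hρ₁ hρ₂ hb').2 ⟨-c, ?_, ?_⟩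
      · rw [e₁, hρ₁.neg_apply]
      · rw [e₂, hρ₂.neg_apply]
    · have hb' := hproj h ▸ hb
      obtain ⟨c, e₁, e₂⟩ := (sameAntiOrbit_iff h₁ h₂ hF hρ₁ hρ₂ hb).1 h
      obtain ⟨d, e₁', e₂'⟩ := (sameAntiOrbit_iff h₁ h₂ hF hρ₁ hρ₂ hb').1 h'
      refine (sameAntiOrbit_iff h₁ h₂ hF hρ₁ hρ₂ hb).2 ⟨d + c, ?_, ?_⟩
      · rw [e₁', e₁, hρ₁.add]
      · rw [e₂', e₂, neg_add, hρ₂.add]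

/-- The underlying set of the tensor product. -/
def TensorCarrier (h₁ : M₁.IsASCIR T P) (h₂ : M₂.IsASCIR T P) : Type u :=
  Quotient (antiSetoid h₁ h₂)

namespace TensorCarrier

variable {h₁ : M₁.IsASCIR T P} {h₂ : M₂.IsASCIR T P}

variable (h₁ h₂) in
/-- The class `[m₁, m₂]`. -/
def mk (p : FiberProduct M₁ M₂) : TensorCarrier h₁ h₂ := Quotient.mk _ p

theorem mk_surjective : Function.Surjective (mk h₁ h₂) := Quotient.mk_surjective

theorem mk_eq_iff {p p' : FiberProduct M₁ M₂} : mk h₁ h₂ p = mk h₁ h₂ p' ↔ SameAntiOrbit T p p' :=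
  Quotient.eq (r := antiSetoid h₁ h₂)

/-- The projection of the tensor product. -/
def proj : TensorCarrier h₁ h₂ → B :=
  Quotient.lift (fun p => M₁.proj p.1.1) fun p p' h => by
    obtain ⟨b, α, -, ⟨γ, h, h0, h1, -⟩, -⟩ := (h : SameAntiOrbit T p p')
    rw [← h0, ← h1, h, h]

variable (h₁ h₂) in
/-- The map `m ↦ [m, σ(π m)]`. -/
def emb (σ : LocalSection M₂) (m : M₁.carrier) : TensorCarrier h₁ h₂ :=
  mk h₁ h₂ ⟨(m, σ (M₁.proj m)), (σ.proj_eq _).symm⟩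

theorem proj_emb (σ : LocalSection M₂) (m : M₁.carrier) : proj (emb h₁ h₂ σ m) = M₁.proj m := rfl

/-- Surjectivity: the second entry can be moved to the section, as the action on fibres of M₂ is
transitive. Injectivity: a translation fixing the section value is by a period, and since both
realizations have the same period bundle it also fixes the point of M₁. -/
theorem emb_bijective (σ : LocalSection M₂) : Function.Bijective (emb h₁ h₂ σ) := by
  constructor
  · intro m m' h
    have hb : M₁.proj m = M₁.proj m' := congrArg proj h
    obtain ⟨V, n, a, ρ₁, ρ₂, hbV, hF, hρ₁, hρ₂⟩ := h₁.exists_common_action h₂ (M₁.proj m)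
    obtain ⟨c, e₁, e₂⟩ := (sameAntiOrbit_iff h₁ h₂ hF hρ₁ hρ₂ hbV).1 (mk_eq_iff.1 h)
    dsimp only at e₁ e₂
    rw [← hb] at e₂
    have e₃ := (h₂.action_eq_self_iff hF hρ₂ (by rwa [σ.proj_eq])).1 e₂.symm
    rw [σ.proj_eq] at e₃
    have e₄ := (h₁.action_eq_self_iff hF hρ₁ hbV).2 e₃
    rw [e₁, ← e₄, hρ₁.apply_neg, e₄]
  · intro y
    obtain ⟨p, rfl⟩ := mk_surjective y
    obtain ⟨V, n, a, ρ₁, ρ₂, hbV, hF, hρ₁, hρ₂⟩ := h₁.exists_common_action h₂ (M₁.proj p.1.1)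
    obtain ⟨c, hc⟩ := h₂.exists_action_eq hF hρ₂ (m := p.1.2) (m' := σ (M₁.proj p.1.1))
      (p.2 ▸ hbV) (by rw [σ.proj_eq, p.2])
    refine ⟨ρ₁ (-c) p.1.1, (mk_eq_iff.2 ?_).symm⟩
    refine (sameAntiOrbit_iff h₁ h₂ hF hρ₁ hρ₂ hbV).2 ⟨-c, rfl, ?_⟩
    rw [neg_neg, hc]
    exact congrArg σ (hρ₁.proj_eq _ _)

/-- Locally on the fibre product, the projection to the tensor product lifts through `emb σ`. -/
theorem exists_local_lift (Θ : MForm k 2 B) (σ : LocalSection M₂) (p : FiberProduct M₁ M₂)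
    (hp : M₁.proj p.1.1 ∈ σ.dom) :
    ∃ (O : Set (M₁.carrier × M₂.carrier)) (F : M₁.carrier × M₂.carrier → M₁.carrier),
      IsOpen O ∧ p.1 ∈ O ∧
      (∀ x ∈ O, ContMDiffAt ((𝓡 M₁.dim).prod (𝓡 M₂.dim)) (𝓡 M₁.dim) ∞ F x) ∧
      (∀ x ∈ O, M₁.proj (F x) = M₁.proj x.1) ∧
      (∀ p' : FiberProduct M₁ M₂, p'.1 ∈ O → emb h₁ h₂ σ (F p'.1) = mk h₁ h₂ p') ∧
      ∀ v w : EuclideanSpace ℝ (Fin M₁.dim) × EuclideanSpace ℝ (Fin M₂.dim),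
        M₁.Dp p.1.1 v.1 = M₂.Dp p.1.2 v.2 → M₁.Dp p.1.1 w.1 = M₂.Dp p.1.2 w.2 →
        (σ.form Θ M₁).val (F p.1) ![tder ((𝓡 M₁.dim).prod (𝓡 M₂.dim)) (𝓡 M₁.dim) F p.1 v,
          tder ((𝓡 M₁.dim).prod (𝓡 M₂.dim)) (𝓡 M₁.dim) F p.1 w] =
        M₁.form.val p.1.1 ![v.1, w.1] + M₂.form.val p.1.2 ![v.2, w.2] -
          Θ.val (M₁.proj p.1.1) ![M₁.Dp p.1.1 v.1, M₁.Dp p.1.1 w.1] := by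
  obtain ⟨⟨x₁, x₂⟩, hx⟩ := p
  dsimp only at hx hp ⊢
  obtain ⟨V, n, a, ρ₁, ρ₂, hbV, hF, hρ₁, hρ₂⟩ := h₁.exists_common_action h₂ (M₁.proj x₁)
  have hbV₂ : M₂.proj x₂ ∈ V := hx ▸ hbV
  obtain ⟨c, hc⟩ := h₂.exists_action_eq hF hρ₂ hbV₂ (m' := σ (M₂.proj x₂)) (by rw [σ.proj_eq])
  obtain ⟨O', δ, hO', hxO', -, hδ, hδρ⟩ := h₂.exists_difference hF hρ₂ hbV₂ c
  rw [hc] at hxO'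
  have hψ (y) (hy : M₂.proj y ∈ σ.dom) : ContMDiffAt (𝓡 M₂.dim) ((𝓡 M₂.dim).prod (𝓡 M₂.dim)) ∞
      (fun y => (y, σ (M₂.proj y))) y :=
    contMDiffAt_id.prodMk ((σ.contMDiffAt _ hy).comp y M₂.smooth_proj.contMDiffAt)
  -- δ' moves a point of M₂ to the section. The compensating translation by -δ' on M₁ is the lift F.
  set δ' : M₂.carrier → Fin n → ℝ := fun y => δ (y, σ (M₂.proj y)) with hδ'
  set O₂ : Set M₂.carrier := M₂.proj ⁻¹' (σ.dom) ∩ (fun y => (y, σ (M₂.proj y))) ⁻¹' O' with hO₂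
  have hO₂o : IsOpen O₂ := ContinuousOn.isOpen_inter_preimage
    (fun y hy => (hψ y hy).continuousAt.continuousWithinAt)
    (σ.isOpen_dom.preimage M₂.smooth_proj.continuous) hO'
  have hxO₂ : x₂ ∈ O₂ := ⟨by rwa [mem_preimage, ← hx], hxO'⟩
  have hδs (y) (hy : y ∈ O₂) : ContMDiffAt (𝓡 M₂.dim) 𝓘(ℝ, Fin n → ℝ) ∞ δ' y :=
    (hδ _ hy.2).comp y (hψ y hy.1)
  have hδa (y) (hy : y ∈ O₂) : ρ₂ (δ' y) y = σ (M₂.proj y) :=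
    (hδρ _ hy.2).2 (by rw [σ.proj_eq])
  have hFs (x : M₁.carrier × M₂.carrier) (hx : x ∈ (M₁.proj ⁻¹' V) ×ˢ O₂) :
      ContMDiffAt ((𝓡 M₁.dim).prod (𝓡 M₂.dim)) (𝓡 M₁.dim) ∞
        (fun x : M₁.carrier × M₂.carrier => ρ₁ (-δ' x.2) x.1) x :=
    hρ₁.contMDiffAt_comp hx.1 (((hδs _ hx.2).comp x contMDiffAt_snd).neg) contMDiffAt_fst
  refine ⟨(M₁.proj ⁻¹' V) ×ˢ O₂, fun x => ρ₁ (-δ' x.2) x.1,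
    (hF.isOpen.preimage M₁.smooth_proj.continuous).prod hO₂o, ⟨hbV, hxO₂⟩, hFs,
    fun x _ => hρ₁.proj_eq _ _, ?_, ?_⟩
  · rintro ⟨⟨y₁, y₂⟩, hy⟩ ⟨hyV, hyO⟩
    dsimp only at hy hyV hyO ⊢
    refine (mk_eq_iff.2 ?_).symm
    refine (sameAntiOrbit_iff h₁ h₂ hF hρ₁ hρ₂ (p := ⟨(y₁, y₂), hy⟩) hyV).2 ⟨-δ' y₂, rfl, ?_⟩
    dsimp only
    rw [neg_neg, hδa _ hyO, hρ₁.proj_eq, hy]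
  · intro v w hv hw
    have hd : MDifferentiableAt (𝓡 M₂.dim) 𝓘(ℝ, Fin n → ℝ) δ' x₂ :=
      (hδs _ hxO₂).mdifferentiableAt (by simp)
    have hsnd : MDifferentiableAt ((𝓡 M₁.dim).prod (𝓡 M₂.dim)) (𝓡 M₂.dim)
        (Prod.snd : M₁.carrier × M₂.carrier → M₂.carrier) (x₁, x₂) := mdifferentiableAt_snd
    have hfst : MDifferentiableAt ((𝓡 M₁.dim).prod (𝓡 M₂.dim)) (𝓡 M₁.dim)
        (Prod.fst : M₁.carrier × M₂.carrier → M₁.carrier) (x₁, x₂) := mdifferentiableAt_fst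
    have hneg : MDifferentiableAt 𝓘(ℝ, Fin n → ℝ) 𝓘(ℝ, Fin n → ℝ)
        (fun z : Fin n → ℝ => -z) (δ' x₂) := differentiableAt_id.neg.mdifferentiableAt
    have hdc : MDifferentiableAt ((𝓡 M₁.dim).prod (𝓡 M₂.dim)) 𝓘(ℝ, Fin n → ℝ)
        (fun x : M₁.carrier × M₂.carrier => δ' x.2) (x₁, x₂) :=
      MDifferentiableAt.comp (g := δ') (f := Prod.snd) (x₁, x₂) hd hsnd
    have hτ : MDifferentiableAt ((𝓡 M₁.dim).prod (𝓡 M₂.dim)) 𝓘(ℝ, Fin n → ℝ)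
        (fun x : M₁.carrier × M₂.carrier => -δ' x.2) (x₁, x₂) :=
      hneg.comp (x₁, x₂) hdc
    have tfst (u) : tder ((𝓡 M₁.dim).prod (𝓡 M₂.dim)) (𝓡 M₁.dim)
        (Prod.fst : M₁.carrier × M₂.carrier → M₁.carrier) (x₁, x₂) u = u.1 := by
      rw [tder, mfderiv_fst]
      rfl
    have tsnd (u) : tder ((𝓡 M₁.dim).prod (𝓡 M₂.dim)) (𝓡 M₂.dim)
        (Prod.snd : M₁.carrier × M₂.carrier → M₂.carrier) (x₁, x₂) u = u.2 := by
      rw [tder, mfderiv_snd]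
      rfl
    have tτ (u) : tder ((𝓡 M₁.dim).prod (𝓡 M₂.dim)) 𝓘(ℝ, Fin n → ℝ)
        (fun x : M₁.carrier × M₂.carrier => -δ' x.2) (x₁, x₂) u =
        -tder (𝓡 M₂.dim) 𝓘(ℝ, Fin n → ℝ) δ' x₂ u.2 := by
      have e1 := tder_comp (g := fun z : Fin n → ℝ => -z)
        (f := fun x : M₁.carrier × M₂.carrier => δ' x.2) (x := (x₁, x₂)) hneg hdc
      have e2 := tder_comp (g := δ') (f := (Prod.snd : M₁.carrier × M₂.carrier → M₂.carrier))
        (x := (x₁, x₂)) hd hsnd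
      have e3 := congrArg (fun L => L u) e1
      have e4 := congrArg (fun L => L u) e2
      rw [ContinuousLinearMap.comp_apply, tder_eq_fderiv, fderiv_fun_neg, fderiv_fun_id] at e3
      rw [ContinuousLinearMap.comp_apply, tsnd] at e4
      exact e3.trans (congrArg Neg.neg e4)
    have key₁ := h₁.form_tder_action hF hρ₁ (f := (Prod.fst : M₁.carrier × M₂.carrier → M₁.carrier))
      (x := (x₁, x₂)) hbV hτ hfst v w
    rw [tτ, tτ, tfst, tfst] at key₁
    have hid : MDifferentiableAt (𝓡 M₂.dim) (𝓡 M₂.dim) (fun y : M₂.carrier => y) x₂ :=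
      mdifferentiableAt_id
    have key₂ := h₂.form_tder_action hF hρ₂ (f := fun y : M₂.carrier => y) (x := x₂) hbV₂ hd hid
      v.2 w.2
    have tid (u) : tder (𝓡 M₂.dim) (𝓡 M₂.dim) (fun y : M₂.carrier => y) x₂ u = u :=
      congrArg (fun L => L u) tder_id
    have tσ (u) : tder (𝓡 M₂.dim) (𝓡 M₂.dim) (fun y => ρ₂ (δ' y) y) x₂ u =
        tder (𝓡 k) (𝓡 M₂.dim) σ (M₂.proj x₂) (M₂.Dp x₂ u) := by
      have e1 : (fun y => ρ₂ (δ' y) y) =ᶠ[𝓝 x₂] σ ∘ M₂.proj := by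
        filter_upwards [hO₂o.mem_nhds hxO₂] with y hy
        exact hδa y hy
      rw [tder_congr e1, tder_comp (σ.mdifferentiableAt hxO₂.1) (mdifferentiableAt_proj x₂)]
      rfl
    rw [tσ, tσ, tid, tid, hδa _ hxO₂] at key₂
    have tπ (u) : M₁.Dp (ρ₁ (-δ' x₂) x₁) (tder ((𝓡 M₁.dim).prod (𝓡 M₂.dim)) (𝓡 M₁.dim)
        (fun x : M₁.carrier × M₂.carrier => ρ₁ (-δ' x.2) x.1) (x₁, x₂) u) = M₁.Dp x₁ u.1 := by
      have e1 := tder_comp (g := M₁.proj)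
        (f := fun x : M₁.carrier × M₂.carrier => ρ₁ (-δ' x.2) x.1) (x := (x₁, x₂))
        (mdifferentiableAt_proj _) ((hFs (x₁, x₂) ⟨hbV, hxO₂⟩).mdifferentiableAt (by simp))
      have e2 := tder_comp (g := M₁.proj)
        (f := (Prod.fst : M₁.carrier × M₂.carrier → M₁.carrier)) (x := (x₁, x₂))
        (mdifferentiableAt_proj _) hfst
      have e3 : (M₁.proj ∘ fun x : M₁.carrier × M₂.carrier => ρ₁ (-δ' x.2) x.1) =
          M₁.proj ∘ Prod.fst := funext fun x => hρ₁.proj_eq _ _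
      rw [e3, e2] at e1
      have e4 := congrArg (fun L => L u) e1
      rw [ContinuousLinearMap.comp_apply, tfst] at e4
      exact e4.symm
    -- The corrections in `key₁` and `key₂` come from -δ' and δ'. For tangent vectors of the fibre
    -- product both are evaluated on the same base vectors, so they cancel.
    rw [LocalSection.form_apply, key₁, tπ, tπ, hρ₁.proj_eq, hx, hv, hw, key₂, frameAt_neg,
      frameAt_neg]
    simp only [neg_apply]
    ring

end TensorCarrier
end FormOver
end Realization

/-! ### The manifold structure of the tensor product. -/

namespace Realization

open Set

section Glue

variable {m : ℕ} {X N ι : Type*} [TopologicalSpace X] [TopologicalSpace N]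
  [ChartedSpace (EuclideanSpace ℝ (Fin m)) X]

/-- The charts of `N` obtained from partial homeomorphisms to a manifold `X`. -/
@[reducible]
def gluedChartedSpace (e : ι → OpenPartialHomeomorph N X) (i : N → ι)
    (hi : ∀ y, y ∈ (e (i y)).source) : ChartedSpace (EuclideanSpace ℝ (Fin m)) N where
  atlas := {f | ∃ j, ∃ c ∈ atlas (EuclideanSpace ℝ (Fin m)) X, f = (e j).trans c}
  chartAt y := (e (i y)).trans (chartAt _ (e (i y) y))
  mem_chart_source y := by
    rw [OpenPartialHomeomorph.trans_source]
    exact ⟨hi y, mem_chart_source _ _⟩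
  chart_mem_atlas y := ⟨i y, _, chart_mem_atlas _ _, rfl⟩

variable [IsManifold (𝓡 m) ∞ X] {e : ι → OpenPartialHomeomorph N X}

theorem contMDiffAt_of_mem_atlas {c : OpenPartialHomeomorph X (EuclideanSpace ℝ (Fin m))}
    (hc : c ∈ atlas (EuclideanSpace ℝ (Fin m)) X) {x : X} (hx : x ∈ c.source) :
    ContMDiffAt (𝓡 m) (𝓡 m) ∞ c x :=
  (contMDiffOn_of_mem_maximalAtlas (IsManifold.subset_maximalAtlas hc)).contMDiffAt
    (c.open_source.mem_nhds hx)

theorem contMDiffAt_symm_of_mem_atlas {c : OpenPartialHomeomorph X (EuclideanSpace ℝ (Fin m))}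
    (hc : c ∈ atlas (EuclideanSpace ℝ (Fin m)) X) {y : EuclideanSpace ℝ (Fin m)}
    (hy : y ∈ c.target) : ContMDiffAt (𝓡 m) (𝓡 m) ∞ c.symm y :=
  (contMDiffOn_symm_of_mem_maximalAtlas (IsManifold.subset_maximalAtlas hc)).contMDiffAt
    (c.open_target.mem_nhds hy)

/-- A transition map of N is a transition e l ∘ (e j).symm between pieces of X, composed with charts
of X on both sides. -/
theorem isManifold_glued (i : N → ι) (hi : ∀ y, y ∈ (e (i y)).source)
    (h : ∀ j l, ∀ x ∈ (e j).target, (e j).symm x ∈ (e l).source →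
      ContMDiffAt (𝓡 m) (𝓡 m) ∞ (e l ∘ (e j).symm) x) :
    letI := gluedChartedSpace (m := m) e i hi
    IsManifold (𝓡 m) ∞ N := by
  let _ := gluedChartedSpace (m := m) e i hi
  refine isManifold_of_contDiffOn _ _ _ ?_
  rintro _ _ ⟨j, c, hc, rfl⟩ ⟨l, c', hc', rfl⟩
  rintro y ⟨hy, -⟩
  have hy : y ∈ (((e j).trans c).symm.trans ((e l).trans c')).source := hy
  rw [OpenPartialHomeomorph.trans_source, OpenPartialHomeomorph.symm_source,
    OpenPartialHomeomorph.trans_target, mem_inter_iff, mem_inter_iff, mem_preimage, mem_preimage,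
    OpenPartialHomeomorph.trans_source, mem_inter_iff, mem_preimage] at hy
  obtain ⟨⟨hy1, hy2⟩, hy3, hy4⟩ := hy
  have h1 := contMDiffAt_symm_of_mem_atlas hc hy1
  have h2 := h j l (c.symm y) hy2 hy3
  have h3 := contMDiffAt_of_mem_atlas hc' hy4
  have h4 : ContMDiffAt (𝓡 m) (𝓡 m) ∞ (c' ∘ (e l ∘ (e j).symm) ∘ c.symm) y :=
    ContMDiffAt.comp y (g := c') h3 (ContMDiffAt.comp y (g := e l ∘ (e j).symm) h2 h1)
  exact h4.contDiffAt.contDiffWithinAt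

theorem contMDiffAt_glued (i : N → ι) (hi : ∀ y, y ∈ (e (i y)).source)
    (h : ∀ j l, ∀ x ∈ (e j).target, (e j).symm x ∈ (e l).source →
      ContMDiffAt (𝓡 m) (𝓡 m) ∞ (e l ∘ (e j).symm) x) (j : ι) {y : N} (hy : y ∈ (e j).source) :
    letI := gluedChartedSpace (m := m) e i hi
    ContMDiffAt (𝓡 m) (𝓡 m) ∞ (e j) y := by
  let _ := gluedChartedSpace (m := m) e i hi
  have := isManifold_glued i hi h
  set c := chartAt (EuclideanSpace ℝ (Fin m)) (e j y) with hc
  have hyc := mem_chart_source (EuclideanSpace ℝ (Fin m)) (e j y)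
  have hmem : (e j).trans c ∈ atlas (EuclideanSpace ℝ (Fin m)) N :=
    ⟨j, c, chart_mem_atlas _ _, rfl⟩
  have h1 : ContMDiffAt (𝓡 m) (𝓡 m) ∞ ((e j).trans c) y :=
    contMDiffAt_of_mem_atlas hmem (by
      rw [OpenPartialHomeomorph.trans_source]
      exact ⟨hy, hyc⟩)
  have h2 : ContMDiffAt (𝓡 m) (𝓡 m) ∞ c.symm (c (e j y)) :=
    contMDiffAt_symm_of_mem_atlas (chart_mem_atlas _ _) (c.map_source hyc)
  refine (ContMDiffAt.comp (g := c.symm) y h2 h1).congr_of_eventuallyEq ?_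
  have h3 : e j ⁻¹' c.source ∈ 𝓝 y :=
    ((e j).continuousAt hy).preimage_mem_nhds (c.open_source.mem_nhds hyc)
  filter_upwards [h3] with z hz
  exact (c.left_inv hz).symm

theorem contMDiffAt_glued_symm (i : N → ι) (hi : ∀ y, y ∈ (e (i y)).source)
    (h : ∀ j l, ∀ x ∈ (e j).target, (e j).symm x ∈ (e l).source →
      ContMDiffAt (𝓡 m) (𝓡 m) ∞ (e l ∘ (e j).symm) x) (j : ι) {x : X} (hx : x ∈ (e j).target) :
    letI := gluedChartedSpace (m := m) e i hi
    ContMDiffAt (𝓡 m) (𝓡 m) ∞ (e j).symm x := by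
  let _ := gluedChartedSpace (m := m) e i hi
  have := isManifold_glued i hi h
  set c := chartAt (EuclideanSpace ℝ (Fin m)) x with hc
  have hxc := mem_chart_source (EuclideanSpace ℝ (Fin m)) x
  have hmem : (e j).trans c ∈ atlas (EuclideanSpace ℝ (Fin m)) N :=
    ⟨j, c, chart_mem_atlas _ _, rfl⟩
  have h1 : ContMDiffAt (𝓡 m) (𝓡 m) ∞ ((e j).trans c).symm (c x) :=
    contMDiffAt_symm_of_mem_atlas hmem (by
      rw [OpenPartialHomeomorph.trans_target]
      refine ⟨c.map_source hxc, ?_⟩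
      rwa [mem_preimage, c.left_inv hxc])
  have h2 : ContMDiffAt (𝓡 m) (𝓡 m) ∞ c x := contMDiffAt_of_mem_atlas (chart_mem_atlas _ _) hxc
  refine (ContMDiffAt.comp (g := ((e j).trans c).symm) x h1 h2).congr_of_eventuallyEq ?_
  filter_upwards [c.open_source.mem_nhds hxc] with z hz
  exact congrArg (e j).symm (c.left_inv hz).symm

end Glue

variable {k : ℕ} {B : Type v} [TopologicalSpace B] [ChartedSpace (EuclideanSpace ℝ (Fin k)) B]

namespace FormOver

variable {M₁ M₂ : FormOver.{u} k B} {T : RegularTwistedPoisson k B} {P : PeriodBundle T}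

theorem continuousAt_localSection {σ : LocalSection M₂} {m : M₁.carrier} (hm : M₁.proj m ∈ σ.dom) :
    ContinuousAt (fun m => σ (M₁.proj m)) m :=
  ContinuousAt.comp (g := σ) (σ.contMDiffAt _ hm).continuousAt
    M₁.smooth_proj.continuous.continuousAt

variable [IsManifold (𝓡 k) ∞ B]

theorem exists_dom (h₂ : M₂.IsASCIR T P) (b : B) : ∃ σ : LocalSection M₂, b ∈ σ.dom := by
  obtain ⟨m, rfl⟩ := h₂.surjective b
  obtain ⟨σ, hσ, -⟩ := h₂.exists_localSection m
  exact ⟨σ, hσ⟩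

/-- A section smooth near `b`. -/
noncomputable def sectionAt (h₂ : M₂.IsASCIR T P) (b : B) : LocalSection M₂ :=
  (exists_dom h₂ b).choose

theorem mem_dom_sectionAt (h₂ : M₂.IsASCIR T P) (b : B) : b ∈ (sectionAt h₂ b).dom :=
  (exists_dom h₂ b).choose_spec

variable [T2Space B]

instance : TopologicalSpace (FiberProduct M₁ M₂) := instTopologicalSpaceSubtype

namespace TensorCarrier

variable {h₁ : M₁.IsASCIR T P} {h₂ : M₂.IsASCIR T P}

instance : TopologicalSpace (TensorCarrier h₁ h₂) :=
  TopologicalSpace.coinduced (mk h₁ h₂) inferInstance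

theorem isQuotientMap_mk : Topology.IsQuotientMap (mk h₁ h₂) := ⟨⟨rfl⟩, mk_surjective⟩

theorem continuous_proj : Continuous (proj : TensorCarrier h₁ h₂ → B) := by
  rw [isQuotientMap_mk.continuous_iff]
  exact M₁.smooth_proj.continuous.comp (continuous_fst.comp continuous_subtype_val)

variable (h₁ h₂) in
/-- `emb σ` as a bijection. -/
noncomputable def embEquiv (σ : LocalSection M₂) : M₁.carrier ≃ TensorCarrier h₁ h₂ :=
  Equiv.ofBijective (emb h₁ h₂ σ) (emb_bijective σ)

theorem embEquiv_apply (σ : LocalSection M₂) (m : M₁.carrier) :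
    embEquiv h₁ h₂ σ m = emb h₁ h₂ σ m := rfl

theorem proj_embEquiv_symm (σ : LocalSection M₂) (y : TensorCarrier h₁ h₂) :
    M₁.proj ((embEquiv h₁ h₂ σ).symm y) = proj y := by
  rw [← proj_emb (h₁ := h₁) (h₂ := h₂) σ, ← embEquiv_apply, Equiv.apply_symm_apply]

theorem embEquiv_symm_eq {σ : LocalSection M₂} {m : M₁.carrier} {y : TensorCarrier h₁ h₂}
    (h : emb h₁ h₂ σ m = y) : (embEquiv h₁ h₂ σ).symm y = m := by
  rw [Equiv.symm_apply_eq, ← h, embEquiv_apply]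

variable (h₁ h₂) in
/-- The part of the tensor product over the domain of `σ`, identified with a part of `M₁`. -/
noncomputable def chart (σ : LocalSection M₂) :
    OpenPartialHomeomorph (TensorCarrier h₁ h₂) M₁.carrier where
  toFun := (embEquiv h₁ h₂ σ).symm
  invFun := emb h₁ h₂ σ
  source := proj ⁻¹' σ.dom
  target := M₁.proj ⁻¹' σ.dom
  map_source' y hy := by rwa [mem_preimage, proj_embEquiv_symm]
  map_target' m hm := hm
  left_inv' y _ := (embEquiv h₁ h₂ σ).apply_symm_apply y
  right_inv' m _ := (embEquiv h₁ h₂ σ).symm_apply_apply m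
  open_source := σ.isOpen_dom.preimage continuous_proj
  open_target := σ.isOpen_dom.preimage M₁.smooth_proj.continuous
  continuousOn_toFun := by
    rw [isQuotientMap_mk.continuousOn_isOpen_iff (σ.isOpen_dom.preimage continuous_proj)]
    intro p hp
    obtain ⟨O, F, hO, hpO, hF, -, hFe, -⟩ := exists_local_lift (h₁ := h₁) (h₂ := h₂) 0 σ p hp
    have h1 : ContinuousAt (fun p : FiberProduct M₁ M₂ => F p.1) p :=
      ContinuousAt.comp (g := F) (hF _ hpO).continuousAt continuous_subtype_val.continuousAt
    refine (h1.congr ?_).continuousWithinAt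
    filter_upwards [(hO.preimage continuous_subtype_val).mem_nhds hpO] with p' hp'
    exact (embEquiv_symm_eq (hFe p' hp')).symm
  continuousOn_invFun := by
    intro m hm
    have h1 : ContinuousAt (fun m => (⟨(m, σ (M₁.proj m)), (σ.proj_eq _).symm⟩ :
        FiberProduct M₁ M₂)) m :=
      Topology.IsInducing.subtypeVal.continuousAt_iff.2
        (continuousAt_id.prodMk (continuousAt_localSection hm))
    exact (ContinuousAt.comp (g := mk h₁ h₂) isQuotientMap_mk.continuous.continuousAt
      h1).continuousWithinAt

/-- A change of section is m ↦ F (m, σ(π m)) with F the local lift for τ, that is, translation by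
the difference of the two sections. -/
theorem contMDiffAt_transition (σ τ : LocalSection M₂) {m : M₁.carrier}
    (hm : m ∈ (chart h₁ h₂ σ).target) (hm' : (chart h₁ h₂ σ).symm m ∈ (chart h₁ h₂ τ).source) :
    ContMDiffAt (𝓡 M₁.dim) (𝓡 M₁.dim) ∞ (chart h₁ h₂ τ ∘ (chart h₁ h₂ σ).symm) m := by
  have hmτ : M₁.proj m ∈ τ.dom := hm'
  have hmσ : M₁.proj m ∈ σ.dom := hm
  obtain ⟨O, F, hO, hpO, hF, -, hFe, -⟩ := exists_local_lift (h₁ := h₁) (h₂ := h₂) 0 τ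
    ⟨(m, σ (M₁.proj m)), (σ.proj_eq _).symm⟩ hmτ
  have h1 : ContMDiffAt (𝓡 M₁.dim) ((𝓡 M₁.dim).prod (𝓡 M₂.dim)) ∞
      (fun m => (m, σ (M₁.proj m))) m :=
    contMDiffAt_id.prodMk ((σ.contMDiffAt _ hmσ).comp m M₁.smooth_proj.contMDiffAt)
  refine (ContMDiffAt.comp (g := F) m (hF _ hpO) h1).congr_of_eventuallyEq ?_
  filter_upwards [h1.continuousAt.preimage_mem_nhds (hO.mem_nhds hpO)] with y hy
  exact embEquiv_symm_eq (hFe ⟨(y, σ (M₁.proj y)), (σ.proj_eq _).symm⟩ hy)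

noncomputable instance : ChartedSpace (EuclideanSpace ℝ (Fin M₁.dim)) (TensorCarrier h₁ h₂) :=
  gluedChartedSpace (chart h₁ h₂) (fun y => sectionAt h₂ (proj y))
    fun y => mem_dom_sectionAt h₂ (proj y)

instance : IsManifold (𝓡 M₁.dim) ∞ (TensorCarrier h₁ h₂) :=
  isManifold_glued _ (fun y => mem_dom_sectionAt h₂ (proj y))
    fun σ τ _ hx hx' => contMDiffAt_transition σ τ hx hx'

theorem contMDiffAt_chart (σ : LocalSection M₂) {y : TensorCarrier h₁ h₂} (hy : proj y ∈ σ.dom) :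
    ContMDiffAt (𝓡 M₁.dim) (𝓡 M₁.dim) ∞ (chart h₁ h₂ σ) y :=
  contMDiffAt_glued _ (fun y => mem_dom_sectionAt h₂ (proj y))
    (fun σ τ _ hx hx' => contMDiffAt_transition σ τ hx hx') σ hy

theorem contMDiffAt_emb (σ : LocalSection M₂) {m : M₁.carrier} (hm : M₁.proj m ∈ σ.dom) :
    ContMDiffAt (𝓡 M₁.dim) (𝓡 M₁.dim) ∞ (emb h₁ h₂ σ) m :=
  contMDiffAt_glued_symm _ (fun y => mem_dom_sectionAt h₂ (proj y))
    (fun σ τ _ hx hx' => contMDiffAt_transition σ τ hx hx') σ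
    (x := m) hm

instance : T2Space (TensorCarrier h₁ h₂) := by
  refine ⟨fun y z hyz => ?_⟩
  -- Points over the same base point lie in one chart and are separated in M₁; otherwise they are
  -- separated in B.
  by_cases h : proj y = proj z
  · set σ := sectionAt h₂ (proj y) with hσ
    have hy : y ∈ (chart h₁ h₂ σ).source := mem_dom_sectionAt h₂ (proj y)
    have hz : z ∈ (chart h₁ h₂ σ).source := by
      change proj z ∈ σ.dom
      rw [← h]
      exact hy
    obtain ⟨U, V, hU, hV, hyU, hzV, hUV⟩ := t2_separation fun he =>
      hyz ((chart h₁ h₂ σ).injOn hy hz he)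
    exact ⟨_, _, (chart h₁ h₂ σ).isOpen_inter_preimage hU,
      (chart h₁ h₂ σ).isOpen_inter_preimage hV, ⟨hy, hyU⟩, ⟨hz, hzV⟩,
      (hUV.preimage _).mono inter_subset_right inter_subset_right⟩
  · obtain ⟨U, V, hU, hV, hyU, hzV, hUV⟩ := t2_separation h
    exact ⟨_, _, hU.preimage continuous_proj, hV.preimage continuous_proj, hyU, hzV,
      hUV.preimage _⟩

instance [SecondCountableTopology B] : SecondCountableTopology (TensorCarrier h₁ h₂) := by
  -- Countably many section domains cover B, and each piece over them is homeomorphic to an open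
  -- part of M₁.
  obtain ⟨s, hs, hcov⟩ := TopologicalSpace.countable_cover_nhds
    (f := fun b : B => (sectionAt h₂ b).dom)
    fun b => (sectionAt h₂ b).isOpen_dom.mem_nhds (mem_dom_sectionAt h₂ b)
  have := hs.to_subtype
  have (b : s) : SecondCountableTopology (chart h₁ h₂ (sectionAt h₂ b.1)).source :=
    OpenPartialHomeomorph.secondCountableTopology_source _
  refine TopologicalSpace.secondCountableTopology_of_countable_cover
    (fun b : s => (chart h₁ h₂ (sectionAt h₂ b.1)).open_source) (eq_univ_of_forall fun y => ?_)
  have h : proj y ∈ ⋃ b ∈ s, (sectionAt h₂ b).dom := hcov ▸ mem_univ _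
  obtain ⟨b, hb, hy⟩ := mem_iUnion₂.1 h
  exact mem_iUnion.2 ⟨⟨b, hb⟩, hy⟩

end TensorCarrier
end FormOver
end Realization

/-! ### The 2-form of the tensor product. -/

namespace Realization

open Set

theorem form_ext {E : Type*} [NormedAddCommGroup E] [NormedSpace ℝ E] {A A' : E [⋀^Fin 2]→L[ℝ] ℝ}
    (h : ∀ v w, A ![v, w] = A' ![v, w]) : A = A' := by
  ext v
  have h1 : v = ![v 0, v 1] := by
    funext i
    fin_cases i <;> rfl
  rw [h1, h]

variable {k : ℕ} {B : Type v} [TopologicalSpace B] [ChartedSpace (EuclideanSpace ℝ (Fin k)) B]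

theorem MForm.pullback_two {m m' : ℕ} {X X' : Type*} [TopologicalSpace X]
    [ChartedSpace (EuclideanSpace ℝ (Fin m)) X] [TopologicalSpace X']
    [ChartedSpace (EuclideanSpace ℝ (Fin m')) X'] (f : X → X') (A : MForm m' 2 X') (x : X)
    (v w : EuclideanSpace ℝ (Fin m)) : (A.pullback f : MForm m 2 X).val x ![v, w] =
      A.val (f x) ![tder (𝓡 m) (𝓡 m') f x v, tder (𝓡 m) (𝓡 m') f x w] := by
  rw [MForm.val_pullback, ContinuousAlternatingMap.compContinuousLinearMap_apply]
  congr 1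
  funext i
  fin_cases i <;> rfl

namespace FormOver

section FlowsTo

variable {M N : FormOver.{u} k B}

theorem FlowsTo.map {b : B} {α : EuclideanSpace ℝ (Fin k) →L[ℝ] ℝ} {f : M.carrier → N.carrier}
    (hf : ∀ m, M.proj m = b → MDifferentiableAt (𝓡 M.dim) (𝓡 N.dim) f m)
    (hp : ∀ m, M.proj m = b → N.proj (f m) = b)
    (hs : ∀ m X, M.proj m = b → M.Sharp m α X →
      N.Sharp (f m) α (tder (𝓡 M.dim) (𝓡 N.dim) f m X))
    {m m' : M.carrier} (h : M.FlowsTo (b := b) α m m') :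
    N.FlowsTo (b := b) α (f m) (f m') := by
  rw [flowsTo_iff_sharp] at h ⊢
  obtain ⟨γ, h, rfl, rfl, hγ⟩ := h
  refine ⟨f ∘ γ, fun t => hp _ (h t), rfl, rfl, fun t => ?_⟩
  obtain ⟨X, hX, hsh⟩ := hγ t
  refine ⟨_, ?_, hs _ X (h t) hsh⟩
  refine ((hf _ (h t)).hasMFDerivAt.comp t hX).congr_mfderiv
    (ContinuousLinearMap.ext fun (r : ℝ) => ?_)
  exact (tder (𝓡 M.dim) (𝓡 N.dim) f (γ t)).map_smul r X

end FlowsTo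

variable {M M₁ M₂ : FormOver.{u} k B} {T : RegularTwistedPoisson k B} {P : PeriodBundle T}

/-- Up to a vertical vector, dσ(Π♯α) is -ω♯(π*α) by `Dp_sharp`. Vertical vectors pair to zero with
each other and with these fields, since Hamiltonian vectors project to leaf vectors paired with
conormal covectors. What remains is Π(α, γ). -/
theorem IsASCIR.form_section_leaf (hM : M.IsASCIR T P) {Θ : MForm k 2 B}
    (hΘ : T.IsCharacteristicForm Θ) (σ : LocalSection M) {b : B} (hb : b ∈ σ.dom)
    (α γ : EuclideanSpace ℝ (Fin k) →L[ℝ] ℝ) :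
    M.form.val (σ b) ![tder (𝓡 k) (𝓡 M.dim) σ b (T.shp b α),
      tder (𝓡 k) (𝓡 M.dim) σ b (T.shp b γ)] = Θ.val b ![T.shp b α, T.shp b γ] := by
  have key (α : EuclideanSpace ℝ (Fin k) →L[ℝ] ℝ) : ∃ X V, M.Sharp (σ b) α X ∧
      M.Dp (σ b) V = 0 ∧ tder (𝓡 k) (𝓡 M.dim) σ b (T.shp b α) = V - X := by
    obtain ⟨X, hX⟩ := hM.exists_sharp (σ b) α
    refine ⟨X, tder (𝓡 k) (𝓡 M.dim) σ b (T.shp b α) + X, hX, ?_, by abel⟩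
    rw [map_add, σ.Dp_tder hb, hM.Dp_sharp hX, σ.proj_eq, add_neg_cancel]
  obtain ⟨X, V, hX, hV, h1⟩ := key α
  obtain ⟨Y, W, hY, hW, h2⟩ := key γ
  have hY' := hM.Dp_sharp hY
  rw [σ.proj_eq] at hY'
  have h3 : M.form.val (σ b) ![V - X, W - Y] = M.form.val (σ b) ![V, W] +
      M.form.val (σ b) ![Y, V] - M.form.val (σ b) ![X, W] + M.form.val (σ b) ![X, Y] := by
    rw [form_swap _ Y V]
    simp only [← pairing_apply, map_sub, sub_apply]
    ring
  have h4 : Θ.val b ![T.shp b α, T.shp b γ] = γ (T.shp b α) := hΘ.restrict b α γ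
  -- The mixed terms vanish more directly than by conormality: ω(X, W) is α on the projection of a
  -- vertical vector.
  rw [h1, h2, h3, hM.iso hV hW, hX, hX, hY, hV, hW, map_zero, map_zero, hY', map_neg, h4,
    T.shp_skew b α γ]
  ring

variable [IsManifold (𝓡 k) ∞ B] [T2Space B]

namespace TensorCarrier

variable {h₁ : M₁.IsASCIR T P} {h₂ : M₂.IsASCIR T P} {Θ : MForm k 2 B}

theorem chart_apply_emb (σ : LocalSection M₂) (m : M₁.carrier) :
    chart h₁ h₂ σ (emb h₁ h₂ σ m) = m := embEquiv_symm_eq rfl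

theorem emb_apply_chart (σ : LocalSection M₂) (y : TensorCarrier h₁ h₂) :
    emb h₁ h₂ σ (chart h₁ h₂ σ y) = y := (embEquiv h₁ h₂ σ).apply_symm_apply y

theorem proj_chart (σ : LocalSection M₂) (y : TensorCarrier h₁ h₂) :
    M₁.proj (chart h₁ h₂ σ y) = proj y := proj_embEquiv_symm σ y

theorem mdifferentiableAt_chart (σ : LocalSection M₂) {y : TensorCarrier h₁ h₂}
    (hy : proj y ∈ σ.dom) : MDifferentiableAt (𝓡 M₁.dim) (𝓡 M₁.dim) (chart h₁ h₂ σ) y :=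
  (contMDiffAt_chart σ hy).mdifferentiableAt (by simp)

theorem mdifferentiableAt_emb (σ : LocalSection M₂) {m : M₁.carrier} (hm : M₁.proj m ∈ σ.dom) :
    MDifferentiableAt (𝓡 M₁.dim) (𝓡 M₁.dim) (emb h₁ h₂ σ) m :=
  (contMDiffAt_emb σ hm).mdifferentiableAt (by simp)

theorem tder_chart_tder_emb (σ : LocalSection M₂) {m : M₁.carrier} (hm : M₁.proj m ∈ σ.dom)
    (v : EuclideanSpace ℝ (Fin M₁.dim)) :
    tder (𝓡 M₁.dim) (𝓡 M₁.dim) (chart h₁ h₂ σ) (emb h₁ h₂ σ m)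
      (tder (𝓡 M₁.dim) (𝓡 M₁.dim) (emb h₁ h₂ σ) m v) = v :=
  tder_leftInverse (mdifferentiableAt_chart σ (y := emb h₁ h₂ σ m) hm) (mdifferentiableAt_emb σ hm)
    (Filter.Eventually.of_forall (chart_apply_emb σ)) v

theorem tder_emb_tder_chart (σ : LocalSection M₂) {y : TensorCarrier h₁ h₂} (hy : proj y ∈ σ.dom)
    (v : EuclideanSpace ℝ (Fin M₁.dim)) :
    tder (𝓡 M₁.dim) (𝓡 M₁.dim) (emb h₁ h₂ σ) (chart h₁ h₂ σ y)
      (tder (𝓡 M₁.dim) (𝓡 M₁.dim) (chart h₁ h₂ σ) y v) = v :=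
  tder_leftInverse (mdifferentiableAt_emb σ (by rwa [proj_chart])) (mdifferentiableAt_chart σ hy)
    (Filter.Eventually.of_forall (emb_apply_chart σ)) v

/-- The transition lifts to m ↦ (m, σ(π m)) in the fibre product. There both sides are ω₁ ⊕ ω₂ - Θ
on the graph, by `exists_local_lift` for τ. -/
theorem form_transition (Θ : MForm k 2 B) (σ τ : LocalSection M₂) {m : M₁.carrier}
    (hσ : M₁.proj m ∈ σ.dom) (hτ : M₁.proj m ∈ τ.dom) (v w : EuclideanSpace ℝ (Fin M₁.dim)) :
    (τ.form Θ M₁).val (chart h₁ h₂ τ (emb h₁ h₂ σ m))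
      ![tder (𝓡 M₁.dim) (𝓡 M₁.dim) (chart h₁ h₂ τ ∘ emb h₁ h₂ σ) m v,
        tder (𝓡 M₁.dim) (𝓡 M₁.dim) (chart h₁ h₂ τ ∘ emb h₁ h₂ σ) m w] =
      (σ.form Θ M₁).val m ![v, w] := by
  obtain ⟨O, F, hO, hpO, hF, -, hFe, hform⟩ := exists_local_lift (h₁ := h₁) (h₂ := h₂) Θ τ
    ⟨(m, σ (M₁.proj m)), (σ.proj_eq _).symm⟩ hτ
  dsimp only at hpO hform
  have hσπ : ContMDiffAt (𝓡 M₁.dim) (𝓡 M₂.dim) ∞ (σ ∘ M₁.proj) m :=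
    (σ.contMDiffAt _ hσ).comp m M₁.smooth_proj.contMDiffAt
  have h1 : ContMDiffAt (𝓡 M₁.dim) ((𝓡 M₁.dim).prod (𝓡 M₂.dim)) ∞
      (fun m => (m, (σ ∘ M₁.proj) m)) m := contMDiffAt_id.prodMk hσπ
  have hev : (chart h₁ h₂ τ ∘ emb h₁ h₂ σ) =ᶠ[𝓝 m] F ∘ fun m => (m, (σ ∘ M₁.proj) m) := by
    filter_upwards [h1.continuousAt.preimage_mem_nhds (hO.mem_nhds hpO)] with y hy
    exact embEquiv_symm_eq (hFe ⟨(y, σ (M₁.proj y)), (σ.proj_eq _).symm⟩ hy)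
  have hid : MDifferentiableAt (𝓡 M₁.dim) (𝓡 M₁.dim) (fun y : M₁.carrier => y) m :=
    mdifferentiableAt_id
  have tψ (v) : tder (𝓡 M₁.dim) ((𝓡 M₁.dim).prod (𝓡 M₂.dim)) (fun m => (m, (σ ∘ M₁.proj) m)) m v =
      (v, tder (𝓡 k) (𝓡 M₂.dim) σ (M₁.proj m) (M₁.Dp m v)) := by
    rw [tder_prodMk hid (hσπ.mdifferentiableAt (by simp)),
      tder_comp (σ.mdifferentiableAt hσ) (mdifferentiableAt_proj m)]
    exact Prod.ext (congrArg (fun L => L v) tder_id) rfl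
  have hd := tder_comp (g := F) (f := fun m => (m, (σ ∘ M₁.proj) m)) (x := m)
    ((hF _ hpO).mdifferentiableAt (by simp)) (h1.mdifferentiableAt (by simp))
  rw [tder_congr hev, hd, ContinuousLinearMap.comp_apply, ContinuousLinearMap.comp_apply, tψ, tψ]
  have h2 : chart h₁ h₂ τ (emb h₁ h₂ σ m) = F (m, σ (M₁.proj m)) := hev.self_of_nhds
  have h3 := hform (v, tder (𝓡 k) (𝓡 M₂.dim) σ (M₁.proj m) (M₁.Dp m v))
    (w, tder (𝓡 k) (𝓡 M₂.dim) σ (M₁.proj m) (M₁.Dp m w)) (σ.Dp_tder hσ _).symm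
    (σ.Dp_tder hσ _).symm
  rw [h2, LocalSection.form_apply σ, ← add_sub_assoc]
  exact h3

variable (h₁ h₂ Θ) in
/-- The 2-form of the tensor product. -/
noncomputable def form : MForm M₁.dim 2 (TensorCarrier h₁ h₂) := fun y =>
  (((sectionAt h₂ (proj y)).form Θ M₁).pullback (chart h₁ h₂ (sectionAt h₂ (proj y))) :
    MForm M₁.dim 2 (TensorCarrier h₁ h₂)) y

/-- The definition uses a section varying with the point. Independence of the section allows one to
be fixed on a neighbourhood, as smoothness and d require. -/
theorem form_val (σ : LocalSection M₂) {y : TensorCarrier h₁ h₂} (hy : proj y ∈ σ.dom) :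
    (form h₁ h₂ Θ).val y =
      ((σ.form Θ M₁).pullback (chart h₁ h₂ σ) : MForm M₁.dim 2 (TensorCarrier h₁ h₂)).val y := by
  set τ := sectionAt h₂ (proj y) with hτ
  have hyτ : proj y ∈ τ.dom := mem_dom_sectionAt h₂ _
  change ((τ.form Θ M₁).pullback (chart h₁ h₂ τ) : MForm M₁.dim 2 (TensorCarrier h₁ h₂)).val y = _
  refine form_ext fun v w => ?_
  rw [MForm.pullback_two, MForm.pullback_two]
  have h1 : (chart h₁ h₂ τ : TensorCarrier h₁ h₂ → M₁.carrier) =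
      (chart h₁ h₂ τ ∘ emb h₁ h₂ σ) ∘ chart h₁ h₂ σ := by
    funext y
    exact congrArg (chart h₁ h₂ τ) (emb_apply_chart σ y).symm
  have hyσ : M₁.proj (chart h₁ h₂ σ y) ∈ σ.dom := by rwa [proj_chart]
  have hg : MDifferentiableAt (𝓡 M₁.dim) (𝓡 M₁.dim) (chart h₁ h₂ τ ∘ emb h₁ h₂ σ)
      (chart h₁ h₂ σ y) := (contMDiffAt_transition σ τ hyσ (by
        change proj (emb h₁ h₂ σ (chart h₁ h₂ σ y)) ∈ τ.dom
        rwa [emb_apply_chart])).mdifferentiableAt (by simp)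
  have h2 := tder_comp hg (mdifferentiableAt_chart σ hy)
  rw [← h1] at h2
  rw [h2, ContinuousLinearMap.comp_apply, ContinuousLinearMap.comp_apply,
    ← form_transition (h₁ := h₁) (h₂ := h₂) Θ σ τ hyσ (by rwa [proj_chart]), emb_apply_chart]

theorem form_emb (σ : LocalSection M₂) {m : M₁.carrier} (hm : M₁.proj m ∈ σ.dom)
    (v w : EuclideanSpace ℝ (Fin M₁.dim)) : (form h₁ h₂ Θ).val (emb h₁ h₂ σ m)
      ![tder (𝓡 M₁.dim) (𝓡 M₁.dim) (emb h₁ h₂ σ) m v,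
        tder (𝓡 M₁.dim) (𝓡 M₁.dim) (emb h₁ h₂ σ) m w] = (σ.form Θ M₁).val m ![v, w] := by
  rw [form_val σ (y := emb h₁ h₂ σ m) hm, MForm.pullback_two, tder_chart_tder_emb σ hm,
    tder_chart_tder_emb σ hm,
    chart_apply_emb]

theorem contMDiff_proj :
    ContMDiff (𝓡 M₁.dim) (𝓡 k) ∞ (proj : TensorCarrier h₁ h₂ → B) := by
  intro y
  set σ := sectionAt h₂ (proj y)
  have h1 : (proj : TensorCarrier h₁ h₂ → B) = M₁.proj ∘ chart h₁ h₂ σ :=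
    funext fun y => (proj_chart σ y).symm
  rw [h1]
  exact M₁.smooth_proj.contMDiffAt.comp y (contMDiffAt_chart σ (mem_dom_sectionAt h₂ _))

theorem eventually_mem_dom (σ : LocalSection M₂) {y : TensorCarrier h₁ h₂} (hy : proj y ∈ σ.dom) :
    ∀ᶠ z in 𝓝 y, proj z ∈ σ.dom :=
  (σ.isOpen_dom.preimage continuous_proj).mem_nhds hy

theorem smooth_form (hΘ : Θ.Smooth) : (form h₁ h₂ Θ).Smooth := by
  rw [MForm.smooth_iff]
  intro y
  have hy := mem_dom_sectionAt h₂ (proj y)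
  refine MForm.smoothAt_congr ?_ (MForm.SmoothAt.pullback (contMDiffAt_chart _ hy)
    ((sectionAt h₂ (proj y)).smoothAt_form (M₁ := M₁) hΘ (by rwa [proj_chart])))
  filter_upwards [eventually_mem_dom _ hy] with z hz
  exact form_val _ hz

end TensorCarrier

variable [SecondCountableTopology B] (h₁ : M₁.IsASCIR T P) (h₂ : M₂.IsASCIR T P) {Θ : MForm k 2 B}

/-- The tensor product `M₁ ⊗ M₂`. -/
noncomputable def tensor (hΘ : Θ.Smooth) : FormOver.{u} k B where
  carrier := TensorCarrier h₁ h₂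
  dim := M₁.dim
  proj := TensorCarrier.proj
  form := TensorCarrier.form h₁ h₂ Θ
  smooth_proj := TensorCarrier.contMDiff_proj
  smooth_form := TensorCarrier.smooth_form hΘ

end FormOver
end Realization

/-! ### The tensor product is again a realization. -/

namespace Realization

open Set

variable {k : ℕ} {B : Type v} [TopologicalSpace B] [ChartedSpace (EuclideanSpace ℝ (Fin k)) B]

namespace FormOver

variable {M₁ M₂ : FormOver.{u} k B} {T : RegularTwistedPoisson k B} {P : PeriodBundle T}
  {Θ : MForm k 2 B}

namespace LocalSection

/-- `σ*ω₂ - Θ`. -/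
noncomputable def baseForm (σ : LocalSection M₂) (Θ : MForm k 2 B) : MForm k 2 B :=
  (M₂.form.pullback σ : MForm k 2 B) - Θ

variable (σ : LocalSection M₂)

theorem form_apply_pairing (m : M₁.carrier) (v w : EuclideanSpace ℝ (Fin M₁.dim)) :
    (σ.form Θ M₁).val m ![v, w] = M₁.form.val m ![v, w] +
      pairing ((σ.baseForm Θ).val (M₁.proj m)) (M₁.Dp m v) (M₁.Dp m w) := by
  rw [form_apply, pairing_apply, ← MForm.pullback_two]
  rfl

theorem baseForm_leaf (h₂ : M₂.IsASCIR T P) (hΘ : T.IsCharacteristicForm Θ) {b : B} (hb : b ∈ σ.dom)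
    (α γ : EuclideanSpace ℝ (Fin k) →L[ℝ] ℝ) :
    pairing ((σ.baseForm Θ).val b) (T.shp b α) (T.shp b γ) = 0 := by
  have h := h₂.form_section_leaf hΘ σ hb α γ
  rw [← MForm.pullback_two, ← sub_eq_zero] at h
  exact h

/-- Contracting σ*ω₂ - Θ with a leaf vector annihilates the leaf, so the result is conormal and
killed by Π♯. The next two proofs rest on this. -/
theorem shp_pairing (h₂ : M₂.IsASCIR T P) (hΘ : T.IsCharacteristicForm Θ) {b : B} (hb : b ∈ σ.dom)
    (α : EuclideanSpace ℝ (Fin k) →L[ℝ] ℝ) :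
    T.shp b (pairing ((σ.baseForm Θ).val b) (-T.shp b α)) = 0 := by
  rw [← T.mem_con_iff]
  rintro _ ⟨γ, rfl⟩
  refine (congrArg (fun L => L (T.shp b γ)) (map_neg (pairing ((σ.baseForm Θ).val b)) _)).trans ?_
  exact neg_eq_zero.2 (σ.baseForm_leaf h₂ hΘ hb α γ)

/-- A vector in the kernel is ω₁♯ of a pulled-back covector g, so it projects to the leaf vector
-Π♯g. By `shp_pairing` Π♯g = 0. Then the vector is vertical, g vanishes, and non-degeneracy of ω₁
applies. -/
theorem form_nondeg (h₁ : M₁.IsASCIR T P) (h₂ : M₂.IsASCIR T P) (hΘ : T.IsCharacteristicForm Θ)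
    {m : M₁.carrier} (hm : M₁.proj m ∈ σ.dom) {v : EuclideanSpace ℝ (Fin M₁.dim)}
    (h : ∀ w, (σ.form Θ M₁).val m ![v, w] = 0) : v = 0 := by
  set g := -pairing ((σ.baseForm Θ).val (M₁.proj m)) (M₁.Dp m v) with hg
  have hs : M₁.Sharp m g v := fun w => by
    have h1 := h w
    rw [form_apply_pairing] at h1
    exact eq_neg_of_add_eq_zero_left h1
  have hv := h₁.Dp_sharp hs
  have hg0 : T.shp (M₁.proj m) g = 0 := by
    have h1 := σ.shp_pairing h₂ hΘ hm g
    rw [← hv] at h1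
    rw [hg, map_neg, h1, neg_zero]
  rw [hg0, neg_zero] at hv
  refine h₁.nondeg (m := m) fun w => ?_
  rw [hs w, hg, hv, map_zero, neg_zero]
  rfl

/-- Passing from ω₁ to the modified form changes the covector by a conormal one, which Π♯ does not
see. Hence the almost Poisson property survives. -/
theorem Dp_of_sharp (h₁ : M₁.IsASCIR T P) (h₂ : M₂.IsASCIR T P) (hΘ : T.IsCharacteristicForm Θ)
    {m : M₁.carrier} (hm : M₁.proj m ∈ σ.dom) {α : EuclideanSpace ℝ (Fin k) →L[ℝ] ℝ}
    {X : EuclideanSpace ℝ (Fin M₁.dim)} (h : ∀ w, (σ.form Θ M₁).val m ![X, w] = α (M₁.Dp m w)) :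
    M₁.Dp m X = -T.shp (M₁.proj m) α := by
  set g := pairing ((σ.baseForm Θ).val (M₁.proj m)) (M₁.Dp m X) with hg
  have hs : M₁.Sharp m (α - g) X := fun w => by
    have h1 := h w
    rw [form_apply_pairing] at h1
    exact eq_sub_of_add_eq h1
  have hX := h₁.Dp_sharp hs
  have hg0 : T.shp (M₁.proj m) g = 0 := by
    have h1 := σ.shp_pairing h₂ hΘ hm (α - g)
    rwa [← hX] at h1
  rw [hX, map_sub, hg0, sub_zero]

end LocalSection

variable [IsManifold (𝓡 k) ∞ B]

/-- As σ is a section, d(σ*ω₂) = σ*π*η₂ = η₂; the rest is naturality of d. -/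
theorem LocalSection.form_d (σ : LocalSection M₂) (hΘ : Θ.Smooth) {η₁ η₂ : MForm k 3 B}
    (h₁ : M₁.form.d = η₁.pullback M₁.proj) (h₂ : M₂.form.d = η₂.pullback M₂.proj) {m : M₁.carrier}
    (hm : M₁.proj m ∈ σ.dom) : (σ.form Θ M₁).d.val m =
      ((η₁ + η₂ - Θ.d).pullback M₁.proj : MForm M₁.dim 3 M₁.carrier).val m := by
  have s1 := M₁.smoothAt_form m
  have s2 : (M₂.form.pullback σ : MForm k 2 B).SmoothAt (M₁.proj m) :=
    MForm.SmoothAt.pullback (σ.contMDiffAt _ hm) (M₂.smoothAt_form _)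
  have s3 : Θ.SmoothAt (M₁.proj m) := MForm.smooth_iff.1 hΘ _
  have s4 : (((M₂.form.pullback σ : MForm k 2 B) - Θ).pullback M₁.proj :
      MForm M₁.dim 2 M₁.carrier).SmoothAt m :=
    MForm.SmoothAt.pullback M₁.smooth_proj.contMDiffAt (s2.sub s3)
  have e1 : (M₂.form.pullback σ : MForm k 2 B).d.val (M₁.proj m) = η₂.val (M₁.proj m) := by
    rw [MForm.d_pullback (σ.contMDiffAt _ hm) (M₂.smoothAt_form _), h₂, MForm.val_pullback,
      MForm.val_pullback, MForm.comp_comp, σ.proj_eq]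
    ext v
    exact congrArg (η₂.val (M₁.proj m)) (funext fun i => σ.Dp_tder hm (v i))
  rw [LocalSection.form, MForm.d_add s1 s4,
    MForm.d_pullback M₁.smooth_proj.contMDiffAt (s2.sub s3), MForm.val_pullback,
    MForm.d_sub s2 s3, e1, h₁, MForm.val_pullback, MForm.val_pullback, MForm.val_sub,
    MForm.val_add, add_sub_assoc]
  rfl

variable [T2Space B]

namespace TensorCarrier

variable {h₁ : M₁.IsASCIR T P} {h₂ : M₂.IsASCIR T P}

theorem exists_emb (y : TensorCarrier h₁ h₂) : ∃ (σ : LocalSection M₂) (m : M₁.carrier),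
    M₁.proj m ∈ σ.dom ∧ emb h₁ h₂ σ m = y :=
  ⟨_, _, by
    rw [proj_chart]
    exact mem_dom_sectionAt h₂ (proj y), emb_apply_chart _ y⟩

theorem tder_emb_surjective (σ : LocalSection M₂) {m : M₁.carrier} (hm : M₁.proj m ∈ σ.dom) :
    Function.Surjective (tder (𝓡 M₁.dim) (𝓡 M₁.dim) (emb h₁ h₂ σ) m) := fun Y => by
  have h := tder_emb_tder_chart σ (y := emb h₁ h₂ σ m) hm Y
  rw [chart_apply_emb] at h
  exact ⟨_, h⟩

theorem tder_proj_emb (σ : LocalSection M₂) {m : M₁.carrier} (hm : M₁.proj m ∈ σ.dom)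
    (v : EuclideanSpace ℝ (Fin M₁.dim)) :
    tder (𝓡 M₁.dim) (𝓡 k) (TensorCarrier.proj : TensorCarrier h₁ h₂ → B) (emb h₁ h₂ σ m)
      (tder (𝓡 M₁.dim) (𝓡 M₁.dim) (emb h₁ h₂ σ) m v) = M₁.Dp m v := by
  have h := tder_comp (g := (TensorCarrier.proj : TensorCarrier h₁ h₂ → B))
    (f := emb h₁ h₂ σ) (x := m)
    (contMDiff_proj.mdifferentiableAt (by simp)) (mdifferentiableAt_emb σ hm)
  exact (congrArg (fun L => L v) h).symm

end TensorCarrier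

variable [SecondCountableTopology B] {h₁ : M₁.IsASCIR T P} {h₂ : M₂.IsASCIR T P}

open TensorCarrier

theorem sharp_tensor_emb_iff (hΘ : Θ.Smooth) (σ : LocalSection M₂) {m : M₁.carrier}
    (hm : M₁.proj m ∈ σ.dom) {α : EuclideanSpace ℝ (Fin k) →L[ℝ] ℝ}
    {X : EuclideanSpace ℝ (Fin M₁.dim)} : (tensor h₁ h₂ hΘ).Sharp (emb h₁ h₂ σ m) α
      (tder (𝓡 M₁.dim) (𝓡 M₁.dim) (emb h₁ h₂ σ) m X) ↔
        ∀ w, (σ.form Θ M₁).val m ![X, w] = α (M₁.Dp m w) := by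
  constructor
  · intro h w
    rw [← form_emb (h₁ := h₁) (h₂ := h₂) σ hm, ← tder_proj_emb (h₁ := h₁) (h₂ := h₂) σ hm w]
    exact h _
  · intro h W
    obtain ⟨w, rfl⟩ := tder_emb_surjective (h₁ := h₁) (h₂ := h₂) σ hm W
    refine (form_emb (h₁ := h₁) (h₂ := h₂) σ hm X w).trans ((h w).trans ?_)
    exact congrArg α (tder_proj_emb (h₁ := h₁) (h₂ := h₂) σ hm w).symm

theorem isTwistingForm_tensor (hΘ : Θ.Smooth) {η₁ η₂ : MForm k 3 B} (e₁ : M₁.IsTwistingForm η₁)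
    (e₂ : M₂.IsTwistingForm η₂) : (tensor h₁ h₂ hΘ).IsTwistingForm (η₁ + η₂ - Θ.d) := by
  have s1 := MForm.smooth_iff.1 e₁.smooth
  have s2 := MForm.smooth_iff.1 e₂.smooth
  have s3 (b) : Θ.d.SmoothAt b :=
    MForm.SmoothAt.d (Filter.Eventually.of_forall (MForm.smooth_iff.1 hΘ))
  refine ⟨MForm.smooth_iff.2 fun b => ((s1 b).add (s2 b)).sub (s3 b), ?_, ?_⟩
  · refine MForm.ext_val fun b => ?_
    rw [MForm.d_sub ((s1 b).add (s2 b)) (s3 b), MForm.d_add (s1 b) (s2 b), e₁.closed, e₂.closed,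
      MForm.d_d (Filter.Eventually.of_forall (MForm.smooth_iff.1 hΘ)), sub_zero]
    exact add_zero _
  · refine MForm.ext_val fun (y : TensorCarrier h₁ h₂) => ?_
    set σ := sectionAt h₂ (TensorCarrier.proj y) with hσ
    have hy : TensorCarrier.proj y ∈ σ.dom := mem_dom_sectionAt h₂ (TensorCarrier.proj y)
    have hy' : M₁.proj (chart h₁ h₂ σ y) ∈ σ.dom := by rwa [proj_chart]
    change (TensorCarrier.form h₁ h₂ Θ).d.val y =
      (MForm.pullback (TensorCarrier.proj : TensorCarrier h₁ h₂ → B) (η₁ + η₂ - Θ.d) :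
        MForm M₁.dim 3 (TensorCarrier h₁ h₂)).val y
    rw [MForm.d_congr (τ := ((σ.form Θ M₁).pullback (chart h₁ h₂ σ) :
      MForm M₁.dim 2 (TensorCarrier h₁ h₂)))
        ((eventually_mem_dom σ hy).mono fun z hz => form_val σ hz),
      MForm.d_pullback (TensorCarrier.contMDiffAt_chart σ hy) (σ.smoothAt_form hΘ hy'),
      MForm.val_pullback,
      σ.form_d hΘ e₁.eq e₂.eq hy', MForm.val_pullback, MForm.comp_comp, MForm.val_pullback,
      proj_chart]
    congr 1
    have h1 : (TensorCarrier.proj : TensorCarrier h₁ h₂ → B) = M₁.proj ∘ chart h₁ h₂ σ :=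
      funext fun y => (proj_chart σ y).symm
    have h2 := tder_comp (g := M₁.proj) (f := chart h₁ h₂ σ) (mdifferentiableAt_proj _)
      (TensorCarrier.mdifferentiableAt_chart σ hy)
    rw [← h1] at h2
    exact h2.symm

theorem isASCIR_tensor (hΘ : T.IsCharacteristicForm Θ) :
    (tensor h₁ h₂ hΘ.smooth).IsASCIR T P := by
  -- Each fibre is the continuous image of a fibre of M₁, which transfers compactness and
  -- connectedness.
  have hfib (b : B) : (TensorCarrier.proj : TensorCarrier h₁ h₂ → B) ⁻¹' {b} =
      emb h₁ h₂ (sectionAt h₂ b) '' (M₁.proj ⁻¹' {b}) := by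
    ext y
    constructor
    · intro hy
      refine ⟨chart h₁ h₂ _ y, ?_, emb_apply_chart _ y⟩
      rw [mem_preimage, proj_chart]
      exact hy
    · rintro ⟨m, hm, rfl⟩
      exact hm
  have hcont (b : B) : ContinuousOn (emb h₁ h₂ (sectionAt h₂ b)) (M₁.proj ⁻¹' {b}) := by
    rintro m rfl
    exact (contMDiffAt_emb _ (mem_dom_sectionAt h₂ _)).continuousAt.continuousWithinAt
  have hnd (y : TensorCarrier h₁ h₂) (Y : EuclideanSpace ℝ (Fin M₁.dim))
      (h : ∀ W, (TensorCarrier.form h₁ h₂ Θ).val y ![Y, W] = 0) : Y = 0 := by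
    obtain ⟨σ, m, hm, rfl⟩ := exists_emb y
    obtain ⟨v, rfl⟩ := tder_emb_surjective (h₁ := h₁) (h₂ := h₂) σ hm Y
    rw [σ.form_nondeg h₁ h₂ hΘ hm (v := v) fun w => by
      rw [← form_emb (h₁ := h₁) (h₂ := h₂) σ hm]
      exact h _, map_zero]
  -- For a conormal covector the Hamiltonian vector is vertical, so the added basic form does not
  -- affect it. `emb` therefore carries flow lines to flow lines, and the periods are unchanged.
  have hsharp {b : B} {α : EuclideanSpace ℝ (Fin k) →L[ℝ] ℝ} (hα : α ∈ T.con b)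
      (σ : LocalSection M₂) (hb : b ∈ σ.dom) (m : M₁.carrier) (hm : M₁.proj m = b)
      (X : EuclideanSpace ℝ (Fin M₁.dim)) (hX : M₁.Sharp m α X) :
      (tensor h₁ h₂ hΘ.smooth).Sharp (emb h₁ h₂ σ m) α
        (tder (𝓡 M₁.dim) (𝓡 M₁.dim) (emb h₁ h₂ σ) m X) := by
    subst hm
    refine (sharp_tensor_emb_iff hΘ.smooth σ hb).2 fun w => ?_
    rw [LocalSection.form_apply_pairing, (h₁.Dp_sharp_eq_zero_iff hX).2 hα, map_zero, hX w]
    exact add_zero _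
  refine ⟨fun b => ?_, fun y => ?_, fun b => ?_, fun b => ?_, hnd, fun y v w hv hw => ?_,
    fun y α γ X Y hX hY => ?_, ?_, fun b α => ?_⟩
  · obtain ⟨m, rfl⟩ := h₁.surjective b
    exact ⟨emb h₁ h₂ (sectionAt h₂ (M₁.proj m)) m, rfl⟩
  · obtain ⟨σ, m, hm, rfl⟩ := exists_emb y
    intro w
    obtain ⟨v, hv⟩ := h₁.Dp_surjective m w
    exact ⟨_, (tder_proj_emb (h₁ := h₁) (h₂ := h₂) σ hm v).trans hv⟩
  · rw [show (tensor h₁ h₂ hΘ.smooth).proj ⁻¹' {b} = _ from hfib b]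
    exact (h₁.compact_fiber b).image_of_continuousOn (hcont b)
  · rw [show (tensor h₁ h₂ hΘ.smooth).proj ⁻¹' {b} = _ from hfib b]
    exact (h₁.connected_fiber b).image _ (hcont b)
  · obtain ⟨σ, m, hm, rfl⟩ := exists_emb y
    obtain ⟨v, rfl⟩ := tder_emb_surjective (h₁ := h₁) (h₂ := h₂) σ hm v
    obtain ⟨w, rfl⟩ := tder_emb_surjective (h₁ := h₁) (h₂ := h₂) σ hm w
    have hv' : M₁.Dp m v = 0 := (tder_proj_emb (h₁ := h₁) (h₂ := h₂) σ hm v).symm.trans hv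
    have hw' : M₁.Dp m w = 0 := (tder_proj_emb (h₁ := h₁) (h₂ := h₂) σ hm w).symm.trans hw
    refine (form_emb (h₁ := h₁) (h₂ := h₂) σ hm v w).trans ?_
    rw [LocalSection.form_apply_pairing, h₁.iso hv' hw', hv', map_zero]
    exact add_zero _
  · obtain ⟨σ, m, hm, rfl⟩ := exists_emb y
    obtain ⟨X, rfl⟩ := tder_emb_surjective (h₁ := h₁) (h₂ := h₂) σ hm X
    obtain ⟨Y, rfl⟩ := tder_emb_surjective (h₁ := h₁) (h₂ := h₂) σ hm Y
    have hX' := (sharp_tensor_emb_iff (h₁ := h₁) (h₂ := h₂) hΘ.smooth σ hm).1 hX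
    have hY' := (sharp_tensor_emb_iff (h₁ := h₁) (h₂ := h₂) hΘ.smooth σ hm).1 hY
    refine (form_emb (h₁ := h₁) (h₂ := h₂) σ hm X Y).trans ?_
    rw [hX', σ.Dp_of_sharp h₁ h₂ hΘ hm hY']
    have h1 := T.shp_skew (M₁.proj m) α γ
    exact (map_neg (α : EuclideanSpace ℝ (Fin k) →L[ℝ] ℝ) _).trans h1.symm
  · obtain ⟨η₁, e₁⟩ := h₁.twisting
    obtain ⟨η₂, e₂⟩ := h₂.twisting
    exact ⟨_, isTwistingForm_tensor hΘ.smooth e₁ e₂⟩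
  · rw [h₁.period]
    refine and_congr_right fun hα => ?_
    set σ := sectionAt h₂ b with hσ
    have hb : b ∈ σ.dom := mem_dom_sectionAt h₂ b
    have hα' : (α : EuclideanSpace ℝ (Fin k) →L[ℝ] ℝ) ∈ T.con b := hα
    -- The converse direction: non-degeneracy of the tensor form forces Y to be the image of the
    -- Hamiltonian vector on M₁.
    have hback {m : M₁.carrier} (hm : M₁.proj m = b) {Y : EuclideanSpace ℝ (Fin M₁.dim)}
        (hY : (tensor h₁ h₂ hΘ.smooth).Sharp (emb h₁ h₂ σ m) α Y) :
        M₁.Sharp m α (tder (𝓡 M₁.dim) (𝓡 M₁.dim) (chart h₁ h₂ σ) (emb h₁ h₂ σ m) Y) := by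
      obtain ⟨X, hX⟩ := h₁.exists_sharp m α
      have h3 : tder (𝓡 M₁.dim) (𝓡 M₁.dim) (emb h₁ h₂ σ) m X = Y := by
        rw [← sub_eq_zero]
        refine hnd (emb h₁ h₂ σ m) _ fun W => ?_
        have h4 := (hsharp hα' σ hb m hm X hX W).trans (hY W).symm
        rw [← pairing_apply, map_sub, sub_apply, sub_eq_zero]
        exact h4
      rw [← h3, tder_chart_tder_emb (h₁ := h₁) (h₂ := h₂) σ (by rwa [hm]) X]
      exact hX
    constructor
    · intro h (y : TensorCarrier h₁ h₂) hy
      have hm : M₁.proj (chart h₁ h₂ σ y) = b := (proj_chart σ y).trans hy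
      have h1 := FlowsTo.map (N := tensor h₁ h₂ hΘ.smooth) (f := emb h₁ h₂ σ) (α := α)
        (fun m hm => mdifferentiableAt_emb σ (hm ▸ hb)) (fun m hm => hm)
        (fun m X hm hX => hsharp hα' σ hb m hm X hX) (h _ hm)
      exact (emb_apply_chart σ y) ▸ h1
    · intro h m hm
      have h1 := FlowsTo.map (M := tensor h₁ h₂ hΘ.smooth) (N := M₁) (f := chart h₁ h₂ σ) (α := α)
        (fun y hy => TensorCarrier.mdifferentiableAt_chart σ (hy ▸ hb))
        (fun y hy => (proj_chart σ y).trans hy)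
        (fun (y : TensorCarrier h₁ h₂) Y hy hY => by
          have hym : M₁.proj (chart h₁ h₂ σ y) = b := (proj_chart σ y).trans hy
          have h2 := fun hY => hback hym (Y := Y) hY
          have e : emb h₁ h₂ σ (chart h₁ h₂ σ y) = y := emb_apply_chart σ y
          rw [e] at h2
          exact h2 hY) (h (emb h₁ h₂ σ m) hm)
      exact (chart_apply_emb (h₁ := h₁) (h₂ := h₂) σ m) ▸ h1

end FormOver
end Realization

/-! ### The defining properties of the quotient. -/

namespace Realization

open Set

variable {k : ℕ} {B : Type v} [TopologicalSpace B] [ChartedSpace (EuclideanSpace ℝ (Fin k)) B]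

namespace FormOver

variable {M₁ M₂ N : FormOver.{u} k B} {T : RegularTwistedPoisson k B} {P : PeriodBundle T}
  {Θ : MForm k 2 B}

theorem FiberProduct.isTangent_iff {p : FiberProduct M₁ M₂}
    {v : EuclideanSpace ℝ (Fin M₁.dim) × EuclideanSpace ℝ (Fin M₂.dim)} :
    p.IsTangent v ↔ M₁.Dp p.1.1 v.1 = M₂.Dp p.1.2 v.2 := by
  have h := tangentAt_eq p.2 (M₂.dproj p.1.2 v.2)
  constructor
  · intro h'
    exact (show M₁.Dp p.1.1 v.1 = _ from h').trans h
  · intro h'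
    exact Eq.trans (show M₁.dproj p.1.1 v.1 = _ from h') h.symm

variable [IsManifold (𝓡 k) ∞ B] [T2Space B] [SecondCountableTopology B]

open TensorCarrier

theorem isTensorQuotient_tensor (h₁ : M₁.IsASCIR T P) (h₂ : M₂.IsASCIR T P) (hΘ : Θ.Smooth) :
    IsTensorQuotient T Θ M₁ M₂ (tensor h₁ h₂ hΘ) (TensorCarrier.mk h₁ h₂) where
  surjective := mk_surjective
  eq_iff _ _ := mk_eq_iff
  proj_eq _ := rfl
  smooth_and_form p := by
    set σ := sectionAt h₂ (M₁.proj p.1.1)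
    have hp : M₁.proj p.1.1 ∈ σ.dom := mem_dom_sectionAt h₂ _
    obtain ⟨O, F, hO, hpO, hF, hFp, hFm, hform⟩ := exists_local_lift (h₁ := h₁) (h₂ := h₂) Θ σ p hp
    have hFdom {x} (hx : x ∈ O) (hx' : M₁.proj x.1 ∈ σ.dom) : M₁.proj (F x) ∈ σ.dom := by
      rwa [hFp x hx]
    -- The quotient map extends off the fibre product as `emb` after the lift F, which is defined on
    -- an open set of the full product.
    refine ⟨O ∩ (fun x => M₁.proj x.1) ⁻¹' σ.dom, emb h₁ h₂ σ ∘ F, hO.inter (σ.isOpen_dom.preimage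
      (M₁.smooth_proj.continuous.comp continuous_fst)), ⟨hpO, hp⟩, fun x hx => ?_,
      fun p' hp' => hFm p' hp'.1, fun v w hv hw => ?_⟩
    · exact ((TensorCarrier.contMDiffAt_emb σ (hFdom hx.1 hx.2)).comp x
        (hF x hx.1)).contMDiffWithinAt
    · have hd (u : EuclideanSpace ℝ (Fin M₁.dim) × EuclideanSpace ℝ (Fin M₂.dim)) :
          tder ((𝓡 M₁.dim).prod (𝓡 M₂.dim)) (𝓡 M₁.dim) (emb h₁ h₂ σ ∘ F) p.1 u =
            tder (𝓡 M₁.dim) (𝓡 M₁.dim) (emb h₁ h₂ σ) (F p.1)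
              (tder ((𝓡 M₁.dim).prod (𝓡 M₂.dim)) (𝓡 M₁.dim) F p.1 u) :=
        congrArg (fun L => L u) (tder_comp (TensorCarrier.mdifferentiableAt_emb σ (hFdom hpO hp))
          ((hF _ hpO).mdifferentiableAt (by simp)))
      have h := form_emb (h₁ := h₁) (h₂ := h₂) (Θ := Θ) σ (hFdom hpO hp)
        (tder ((𝓡 M₁.dim).prod (𝓡 M₂.dim)) (𝓡 M₁.dim) F p.1 v)
        (tder ((𝓡 M₁.dim).prod (𝓡 M₂.dim)) (𝓡 M₁.dim) F p.1 w)
      rw [← hd v, ← hd w] at h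
      exact h.trans (hform v w (FiberProduct.isTangent_iff.1 hv) (FiberProduct.isTangent_iff.1 hw))
  submersion p := by
    -- A section through the second entry of `p` makes the local inverse y ↦ (chart y, σ(π y)) pass
    -- through `p` itself.
    obtain ⟨σ, hσ, hσp⟩ := h₂.exists_localSection p.1.2
    rw [← p.2] at hσ hσp
    have hmk : TensorCarrier.mk h₁ h₂ p = emb h₁ h₂ σ p.1.1 := by
      refine congrArg (TensorCarrier.mk h₁ h₂) (Subtype.ext (Prod.ext rfl hσp.symm))
    refine ⟨(TensorCarrier.proj : TensorCarrier h₁ h₂ → B) ⁻¹' σ.dom,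
      fun y : TensorCarrier h₁ h₂ => (chart h₁ h₂ σ y, σ (TensorCarrier.proj y)),
      σ.isOpen_dom.preimage continuous_proj, hσ, ?_,
      fun (y : TensorCarrier h₁ h₂) hy => ?_, fun y _ => ?_⟩
    · rw [hmk]
      exact Prod.ext (chart_apply_emb σ _) hσp
    · exact ((TensorCarrier.contMDiffAt_chart σ hy).prodMk
        ((σ.contMDiffAt _ hy).comp y contMDiff_proj.contMDiffAt)).contMDiffWithinAt
    · have e : M₁.proj (chart h₁ h₂ σ y) = TensorCarrier.proj y := proj_chart σ y
      have h : M₁.proj (chart h₁ h₂ σ y) = M₂.proj (σ (TensorCarrier.proj y)) :=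
        e.trans (σ.proj_eq _).symm
      have h' : TensorCarrier.mk h₁ h₂ ⟨(chart h₁ h₂ σ y, σ (TensorCarrier.proj y)), h⟩ =
          emb h₁ h₂ σ (chart h₁ h₂ σ y) :=
        congrArg (TensorCarrier.mk h₁ h₂) (Subtype.ext (Prod.ext rfl (congrArg σ e.symm)))
      exact ⟨h, h'.trans (emb_apply_chart σ y)⟩
  twisting _ _ e₁ e₂ := isTwistingForm_tensor hΘ e₁ e₂

end FormOver

theorem ASCIR.exists_isTensorProduct [IsManifold (𝓡 k) ∞ B] [T2Space B] [SecondCountableTopology B]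
    {T : RegularTwistedPoisson k B} {P : PeriodBundle T} {Θ : MForm k 2 B}
    (hΘ : T.IsCharacteristicForm Θ) (M₁ M₂ : ASCIR.{u} T P) :
    ∃ N : ASCIR.{u} T P, ASCIR.IsTensorProduct Θ M₁ M₂ N :=
  ⟨⟨FormOver.tensor M₁.2 M₂.2 hΘ.smooth, FormOver.isASCIR_tensor hΘ⟩,
    FormOver.TensorCarrier.mk M₁.2 M₂.2,
    FormOver.isTensorQuotient_tensor M₁.2 M₂.2 hΘ.smooth⟩

end Realization

/-! ### Functoriality and the operation on isomorphism classes. -/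

namespace Realization

open Set

variable {k : ℕ} {B : Type v} [TopologicalSpace B] [ChartedSpace (EuclideanSpace ℝ (Fin k)) B]

namespace FormOver

variable {M N M₁ M₂ M₁' M₂' N' : FormOver.{u} k B} {T : RegularTwistedPoisson k B}
  {Θ : MForm k 2 B}

namespace Iso

variable (f : Iso M N)

theorem mdifferentiableAt (m : M.carrier) : MDifferentiableAt (𝓡 M.dim) (𝓡 N.dim) f.toDiffeo m :=
  f.toDiffeo.contMDiff.mdifferentiableAt (by simp)

theorem Dp_tder (m : M.carrier) (v : EuclideanSpace ℝ (Fin M.dim)) :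
    N.Dp (f.toDiffeo m) (tder (𝓡 M.dim) (𝓡 N.dim) f.toDiffeo m v) = M.Dp m v := by
  have h := tder_comp (g := N.proj) (f := f.toDiffeo) (x := m) (mdifferentiableAt_proj _)
    (f.mdifferentiableAt m)
  rw [show N.proj ∘ f.toDiffeo = M.proj from funext f.proj_eq] at h
  exact (congrArg (fun L => L v) h).symm

theorem form_tder (m : M.carrier) (v w : EuclideanSpace ℝ (Fin M.dim)) :
    N.form.val (f.toDiffeo m) ![tder (𝓡 M.dim) (𝓡 N.dim) f.toDiffeo m v,
      tder (𝓡 M.dim) (𝓡 N.dim) f.toDiffeo m w] = M.form.val m ![v, w] := by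
  rw [← MForm.pullback_two, f.form_eq]

theorem tder_surjective (m : M.carrier) :
    Function.Surjective (tder (𝓡 M.dim) (𝓡 N.dim) f.toDiffeo m) := fun w => by
  have h := tder_comp (g := f.toDiffeo) (f := f.toDiffeo.symm) (x := f.toDiffeo m)
    (f.mdifferentiableAt _) (f.symm.mdifferentiableAt _)
  rw [show f.toDiffeo ∘ f.toDiffeo.symm = id from funext f.toDiffeo.apply_symm_apply, tder_id,
    f.toDiffeo.symm_apply_apply] at h
  exact ⟨_, (congrArg (fun L => L w) h).symm⟩

theorem flowsTo {b : B} {α : Covector k b} {m m' : M.carrier} (h : M.FlowsTo α m m') :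
    N.FlowsTo α (f.toDiffeo m) (f.toDiffeo m') := by
  refine FlowsTo.map (fun m _ => f.mdifferentiableAt m) (fun m hm => (f.proj_eq m).trans hm)
    (fun m X _ hX W => ?_) h
  obtain ⟨w, rfl⟩ := f.tder_surjective m W
  rw [f.form_tder, f.Dp_tder, hX w]

theorem ext_apply {f g : Iso M N} (h : ∀ m, f.toDiffeo m = g.toDiffeo m) : f = g := by
  obtain ⟨f, _, _⟩ := f
  obtain ⟨g, _, _⟩ := g
  obtain rfl : f = g := Diffeomorph.ext h
  rfl

end Iso

theorem SameAntiOrbit.map (f₁ : Iso M₁ M₁') (f₂ : Iso M₂ M₂') {p p' : FiberProduct M₁ M₂}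
    (h : SameAntiOrbit T p p') :
    SameAntiOrbit T (FiberProduct.map f₁ f₂ p) (FiberProduct.map f₁ f₂ p') := by
  obtain ⟨b, α, hα, e₁, e₂⟩ := h
  exact ⟨b, α, hα, f₁.flowsTo e₁, f₂.flowsTo e₂⟩

theorem FiberProduct.map_symm_map (f₁ : Iso M₁ M₁') (f₂ : Iso M₂ M₂') (p : FiberProduct M₁ M₂) :
    FiberProduct.map f₁.symm f₂.symm (FiberProduct.map f₁ f₂ p) = p :=
  Subtype.ext (Prod.ext (f₁.toDiffeo.symm_apply_apply _) (f₂.toDiffeo.symm_apply_apply _))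

theorem FiberProduct.map_map_symm (f₁ : Iso M₁ M₁') (f₂ : Iso M₂ M₂') (p : FiberProduct M₁' M₂') :
    FiberProduct.map f₁ f₂ (FiberProduct.map f₁.symm f₂.symm p) = p :=
  Subtype.ext (Prod.ext (f₁.toDiffeo.apply_symm_apply _) (f₂.toDiffeo.apply_symm_apply _))

theorem tder_comp_prodMk {Q : M₁.carrier × M₂.carrier → N'.carrier} {s₁ : N.carrier → M₁.carrier}
    {s₂ : N.carrier → M₂.carrier} {y : N.carrier}
    (hQ : MDifferentiableAt ((𝓡 M₁.dim).prod (𝓡 M₂.dim)) (𝓡 N'.dim) Q (s₁ y, s₂ y))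
    (h₁ : MDifferentiableAt (𝓡 N.dim) (𝓡 M₁.dim) s₁ y)
    (h₂ : MDifferentiableAt (𝓡 N.dim) (𝓡 M₂.dim) s₂ y) (v : EuclideanSpace ℝ (Fin N.dim)) :
    tder (𝓡 N.dim) (𝓡 N'.dim) (fun z => Q (s₁ z, s₂ z)) y v =
      tder ((𝓡 M₁.dim).prod (𝓡 M₂.dim)) (𝓡 N'.dim) Q (s₁ y, s₂ y)
        (tder (𝓡 N.dim) (𝓡 M₁.dim) s₁ y v, tder (𝓡 N.dim) (𝓡 M₂.dim) s₂ y v) := by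
  have h := tder_comp (g := Q) (f := fun z => (s₁ z, s₂ z)) (x := y) hQ (h₁.prodMk h₂)
  rw [← tder_prodMk h₁ h₂]
  exact congrArg (fun L => L v) h

namespace IsTensorQuotient

variable {q : FiberProduct M₁ M₂ → N.carrier} {q' : FiberProduct M₁' M₂' → N'.carrier}

theorem exists_section (hq : IsTensorQuotient T Θ M₁ M₂ N q) (y : N.carrier) :
    ∃ (s₁ : N.carrier → M₁.carrier) (s₂ : N.carrier → M₂.carrier),
      ContMDiffAt (𝓡 N.dim) (𝓡 M₁.dim) ∞ s₁ y ∧ ContMDiffAt (𝓡 N.dim) (𝓡 M₂.dim) ∞ s₂ y ∧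
      ∀ᶠ z in 𝓝 y, ∃ h : M₁.proj (s₁ z) = M₂.proj (s₂ z), q ⟨(s₁ z, s₂ z), h⟩ = z := by
  obtain ⟨p, rfl⟩ := hq.surjective y
  obtain ⟨O, s, hO, hpO, -, hs, h⟩ := hq.submersion p
  have hs' := hs.contMDiffAt (hO.mem_nhds hpO)
  exact ⟨fun z => (s z).1, fun z => (s z).2, hs'.fst, hs'.snd,
    Filter.mem_of_superset (hO.mem_nhds hpO) h⟩

theorem exists_lift (hq : IsTensorQuotient T Θ M₁ M₂ N q) {x₁ : M₁.carrier} {x₂ : M₂.carrier}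
    (hx : M₁.proj x₁ = M₂.proj x₂) :
    ∃ (O : Set (M₁.carrier × M₂.carrier)) (Q : M₁.carrier × M₂.carrier → N.carrier),
      O ∈ 𝓝 (x₁, x₂) ∧ ContMDiffAt ((𝓡 M₁.dim).prod (𝓡 M₂.dim)) (𝓡 N.dim) ∞ Q (x₁, x₂) ∧
      (∀ z₁ z₂ (h : M₁.proj z₁ = M₂.proj z₂), (z₁, z₂) ∈ O → Q (z₁, z₂) = q ⟨(z₁, z₂), h⟩) ∧
      ∀ (v₁ w₁ : EuclideanSpace ℝ (Fin M₁.dim)) (v₂ w₂ : EuclideanSpace ℝ (Fin M₂.dim)),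
        M₁.Dp x₁ v₁ = M₂.Dp x₂ v₂ → M₁.Dp x₁ w₁ = M₂.Dp x₂ w₂ →
        N.form.val (Q (x₁, x₂))
          ![tder ((𝓡 M₁.dim).prod (𝓡 M₂.dim)) (𝓡 N.dim) Q (x₁, x₂) (v₁, v₂),
            tder ((𝓡 M₁.dim).prod (𝓡 M₂.dim)) (𝓡 N.dim) Q (x₁, x₂) (w₁, w₂)] =
        M₁.form.val x₁ ![v₁, w₁] + M₂.form.val x₂ ![v₂, w₂] -
          Θ.val (M₁.proj x₁) ![M₁.Dp x₁ v₁, M₁.Dp x₁ w₁] := by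
  obtain ⟨O, Q, hO, hx', hQ, hQq, hQf⟩ := hq.smooth_and_form ⟨(x₁, x₂), hx⟩
  refine ⟨O, Q, hO.mem_nhds hx', hQ.contMDiffAt (hO.mem_nhds hx'), fun z₁ z₂ h hz => hQq ⟨_, h⟩ hz,
    fun v₁ w₁ v₂ w₂ hv hw => ?_⟩
  exact hQf (v₁, v₂) (w₁, w₂)
    ((FiberProduct.isTangent_iff (p := ⟨(x₁, x₂), hx⟩) (v := (v₁, v₂))).2 hv)
    ((FiberProduct.isTangent_iff (p := ⟨(x₁, x₂), hx⟩) (v := (w₁, w₂))).2 hw)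

/-- Isomorphisms carry flow lines to flow lines, so `q' ∘ (f₁ × f₂)` is constant on orbits and
descends. Near each point it is a smooth extension of `q'` after f₁ × f₂ after a local section of
`q`, and both forms are computed by the same formula on the fibre product. -/
theorem exists_map (hq : IsTensorQuotient T Θ M₁ M₂ N q)
    (hq' : IsTensorQuotient T Θ M₁' M₂' N' q') (f₁ : Iso M₁ M₁') (f₂ : Iso M₂ M₂') :
    ∃ g : N.carrier → N'.carrier, (∀ p, g (q p) = q' (FiberProduct.map f₁ f₂ p)) ∧
      ContMDiff (𝓡 N.dim) (𝓡 N'.dim) ∞ g ∧ (∀ y, N'.proj (g y) = N.proj y) ∧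
      N'.form.pullback g = N.form := by
  choose r hr using hq.surjective
  have hg (p : FiberProduct M₁ M₂) : q' (FiberProduct.map f₁ f₂ (r (q p))) =
      q' (FiberProduct.map f₁ f₂ p) :=
    (hq'.eq_iff _ _).2 (((hq.eq_iff _ _).1 (hr (q p))).map f₁ f₂)
  set g : N.carrier → N'.carrier := fun y => q' (FiberProduct.map f₁ f₂ (r y)) with hgdef
  have hgq (p) : g (q p) = q' (FiberProduct.map f₁ f₂ p) := hg p
  have key (y : N.carrier) : ContMDiffAt (𝓡 N.dim) (𝓡 N'.dim) ∞ g y ∧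
      ∀ v w, N'.form.val (g y) ![tder (𝓡 N.dim) (𝓡 N'.dim) g y v,
        tder (𝓡 N.dim) (𝓡 N'.dim) g y w] = N.form.val y ![v, w] := by
    obtain ⟨s₁, s₂, hs₁, hs₂, hs⟩ := hq.exists_section y
    obtain ⟨hy, hqy⟩ := hs.self_of_nhds
    have d₁ := hs₁.mdifferentiableAt (by simp)
    have d₂ := hs₂.mdifferentiableAt (by simp)
    obtain ⟨O, Q, hO, cQ, hQq, hQf⟩ := hq.exists_lift hy
    obtain ⟨O', Q', hO', cQ', hQq', hQf'⟩ := hq'.exists_lift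
      (((f₁.proj_eq _).trans hy).trans (f₂.proj_eq _).symm)
    have t₁ : ContMDiffAt (𝓡 N.dim) (𝓡 M₁'.dim) ∞ (fun z => f₁.toDiffeo (s₁ z)) y :=
      (f₁.toDiffeo.contMDiff.contMDiffAt (x := s₁ y)).comp y hs₁
    have t₂ : ContMDiffAt (𝓡 N.dim) (𝓡 M₂'.dim) ∞ (fun z => f₂.toDiffeo (s₂ z)) y :=
      (f₂.toDiffeo.contMDiff.contMDiffAt (x := s₂ y)).comp y hs₂
    -- Because this composite is the identity, the differentials of s₁ and s₂ lift each tangent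
    -- vector of N to the fibre product.
    have e : (fun z => Q (s₁ z, s₂ z)) =ᶠ[𝓝 y] id := by
      filter_upwards [hs, (hs₁.continuousAt.prodMk hs₂.continuousAt).preimage_mem_nhds
        hO] with z hz hzO
      obtain ⟨h, hz⟩ := hz
      exact (hQq _ _ h hzO).trans hz
    have e' : g =ᶠ[𝓝 y] fun z => Q' (f₁.toDiffeo (s₁ z), f₂.toDiffeo (s₂ z)) := by
      filter_upwards [hs, (t₁.continuousAt.prodMk t₂.continuousAt).preimage_mem_nhds
        hO'] with z hz hzO
      obtain ⟨h, hz⟩ := hz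
      exact ((congrArg g hz).symm.trans (hgq _)).trans (hQq' _ _ _ hzO).symm
    refine ⟨(cQ'.comp y (t₁.prodMk t₂)).congr_of_eventuallyEq e', fun v w => ?_⟩
    have D₁ (u) : tder (𝓡 N.dim) (𝓡 M₁'.dim) (fun z => f₁.toDiffeo (s₁ z)) y u =
        tder (𝓡 M₁.dim) (𝓡 M₁'.dim) f₁.toDiffeo (s₁ y) (tder (𝓡 N.dim) (𝓡 M₁.dim) s₁ y u) :=
      congrArg (fun L => L u) (tder_comp (f₁.mdifferentiableAt _) d₁)
    have D₂ (u) : tder (𝓡 N.dim) (𝓡 M₂'.dim) (fun z => f₂.toDiffeo (s₂ z)) y u =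
        tder (𝓡 M₂.dim) (𝓡 M₂'.dim) f₂.toDiffeo (s₂ y) (tder (𝓡 N.dim) (𝓡 M₂.dim) s₂ y u) :=
      congrArg (fun L => L u) (tder_comp (f₂.mdifferentiableAt _) d₂)
    have tan (u) : M₁.Dp (s₁ y) (tder (𝓡 N.dim) (𝓡 M₁.dim) s₁ y u) =
        M₂.Dp (s₂ y) (tder (𝓡 N.dim) (𝓡 M₂.dim) s₂ y u) := by
      have h₁ := tder_comp (g := M₁.proj) (mdifferentiableAt_proj _) d₁
      have h₂ := tder_comp (g := M₂.proj) (mdifferentiableAt_proj _) d₂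
      have h : M₁.proj ∘ s₁ =ᶠ[𝓝 y] M₂.proj ∘ s₂ := hs.mono fun z hz => hz.1
      rw [tder_congr h, h₂] at h₁
      exact (congrArg (fun L => L u) h₁).symm
    have E (u) : tder ((𝓡 M₁.dim).prod (𝓡 M₂.dim)) (𝓡 N.dim) Q (s₁ y, s₂ y)
        (tder (𝓡 N.dim) (𝓡 M₁.dim) s₁ y u, tder (𝓡 N.dim) (𝓡 M₂.dim) s₂ y u) = u := by
      rw [← tder_comp_prodMk (cQ.mdifferentiableAt (by simp)) d₁ d₂, tder_congr e, tder_id]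
      rfl
    have E' (u) : tder (𝓡 N.dim) (𝓡 N'.dim) g y u = tder ((𝓡 M₁'.dim).prod (𝓡 M₂'.dim))
        (𝓡 N'.dim) Q' (f₁.toDiffeo (s₁ y), f₂.toDiffeo (s₂ y))
        (tder (𝓡 M₁.dim) (𝓡 M₁'.dim) f₁.toDiffeo (s₁ y) (tder (𝓡 N.dim) (𝓡 M₁.dim) s₁ y u),
          tder (𝓡 M₂.dim) (𝓡 M₂'.dim) f₂.toDiffeo (s₂ y)
            (tder (𝓡 N.dim) (𝓡 M₂.dim) s₂ y u)) := by
      rw [tder_congr e', tder_comp_prodMk (cQ'.mdifferentiableAt (by simp))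
        (t₁.mdifferentiableAt (by simp)) (t₂.mdifferentiableAt (by simp)), D₁, D₂]
    have tan' (u) := (f₁.Dp_tder (s₁ y) _).trans ((tan u).trans (f₂.Dp_tder (s₂ y) _).symm)
    -- F and F' evaluate the forms of N and N' on corresponding lifts; the isomorphisms preserve
    -- each of the three summands.
    have F := hQf _ _ _ _ (tan v) (tan w)
    have F' := hQf' _ _ _ _ (tan' v) (tan' w)
    rw [f₁.form_tder, f₂.form_tder, f₁.Dp_tder, f₁.Dp_tder, f₁.proj_eq, ← E' v, ← E' w,
      ← e'.eq_of_nhds] at F'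
    rw [E, E, show Q (s₁ y, s₂ y) = y from e.eq_of_nhds] at F
    exact F'.trans F.symm
  refine ⟨g, hgq, fun y => (key y).1, fun y => ?_, ?_⟩
  · obtain ⟨p, rfl⟩ := hq.surjective y
    rw [hgq, hq'.proj_eq, hq.proj_eq]
    exact f₁.proj_eq _
  · refine MForm.ext_val fun y => form_ext fun v w => ?_
    rw [MForm.pullback_two]
    exact (key y).2 v w

/-- The inverse is the map induced by the inverse isomorphisms, and surjectivity of the quotient
maps gives both inverse laws and uniqueness. -/
theorem existsUnique_iso (hq : IsTensorQuotient T Θ M₁ M₂ N q)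
    (hq' : IsTensorQuotient T Θ M₁' M₂' N' q') (f₁ : Iso M₁ M₁') (f₂ : Iso M₂ M₂') :
    ∃! g : Iso N N', ∀ p, g.toDiffeo (q p) = q' (FiberProduct.map f₁ f₂ p) := by
  obtain ⟨g, hg, cg, pg, fg⟩ := hq.exists_map hq' f₁ f₂
  obtain ⟨g', hg', cg', -, -⟩ := hq'.exists_map hq f₁.symm f₂.symm
  refine ⟨⟨⟨⟨g, g', fun y => ?_, fun y => ?_⟩, cg, cg'⟩, pg, fg⟩, hg, fun j hj => ?_⟩
  · obtain ⟨p, rfl⟩ := hq.surjective y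
    rw [hg, hg', FiberProduct.map_symm_map]
  · obtain ⟨p, rfl⟩ := hq'.surjective y
    rw [hg', hg, FiberProduct.map_map_symm]
  · refine Iso.ext_apply fun y => ?_
    obtain ⟨p, rfl⟩ := hq.surjective y
    exact (hj p).trans (hg p).symm

end IsTensorQuotient

end FormOver

theorem ASCIR.existsUnique_op [IsManifold (𝓡 k) ∞ B] [T2Space B] [SecondCountableTopology B]
    {T : RegularTwistedPoisson k B} {P : PeriodBundle T} {Θ : MForm k 2 B}
    (hΘ : T.IsCharacteristicForm Θ) :
    ∃! op : ASCIR.IsoClasses.{u} T P → ASCIR.IsoClasses.{u} T P → ASCIR.IsoClasses.{u} T P,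
      ∀ M₁ M₂ N : ASCIR.{u} T P, ASCIR.IsTensorProduct Θ M₁ M₂ N → op M₁.cls M₂.cls = N.cls := by
  choose t ht using ASCIR.exists_isTensorProduct.{u} (P := P) hΘ
  refine ⟨Quotient.map₂ t ?_, ?_, ?_⟩
  · rintro M₁ M₁' ⟨f₁⟩ M₂ M₂' ⟨f₂⟩
    obtain ⟨q, hq⟩ := ht M₁ M₂
    obtain ⟨q', hq'⟩ := ht M₁' M₂'
    obtain ⟨g, -⟩ := hq.existsUnique_iso hq' f₁ f₂
    exact ⟨g⟩
  · rintro M₁ M₂ N ⟨q', hq'⟩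
    obtain ⟨q, hq⟩ := ht M₁ M₂
    -- Identity isomorphisms show that any two tensor products of the same pair are isomorphic, so
    -- the chosen representative does not matter.
    obtain ⟨g, -⟩ := hq.existsUnique_iso hq' (FormOver.Iso.refl _) (FormOver.Iso.refl _)
    exact Quotient.sound ⟨g⟩
  · intro op hop
    funext x y
    induction x using Quotient.ind with | _ M₁
    induction y using Quotient.ind with | _ M₂
    exact hop M₁ M₂ _ (ht M₁ M₂)

end Realization

/-- Existence of the tensor product of ASCIRs, its functoriality under isomorphisms over `B` of
either factor, and the operation induced on isomorphism classes. -/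
theorem mainTheorem9 {k : ℕ} {B : Type v} [TopologicalSpace B]
    [ChartedSpace (EuclideanSpace ℝ (Fin k)) B] [IsManifold (𝓡 k) ∞ B] [T2Space B]
    [SecondCountableTopology B] (T : RegularTwistedPoisson k B)
    (P : PeriodBundle T) (Θ : MForm k 2 B)
    (hΘ : T.IsCharacteristicForm Θ) :
    (∀ M₁ M₂ : ASCIR.{u} T P, ∃ N : ASCIR.{u} T P,
      ASCIR.IsTensorProduct Θ M₁ M₂ N) ∧
    (∀ (M₁ M₂ M₁' M₂' N N' : ASCIR.{u} T P)
      (q : FormOver.FiberProduct M₁.1 M₂.1 → N.1.carrier)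
      (q' : FormOver.FiberProduct M₁'.1 M₂'.1 → N'.1.carrier),
      FormOver.IsTensorQuotient T Θ M₁.1 M₂.1 N.1 q →
      FormOver.IsTensorQuotient T Θ M₁'.1 M₂'.1 N'.1 q' →
      ∀ (f₁ : FormOver.Iso M₁.1 M₁'.1) (f₂ : FormOver.Iso M₂.1 M₂'.1),
        ∃! g : FormOver.Iso N.1 N'.1,
          ∀ p, g.toDiffeo (q p) = q' (FormOver.FiberProduct.map f₁ f₂ p)) ∧
    (∃! op : ASCIR.IsoClasses.{u} T P → ASCIR.IsoClasses.{u} T P →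
        ASCIR.IsoClasses.{u} T P,
      ∀ M₁ M₂ N : ASCIR.{u} T P, ASCIR.IsTensorProduct Θ M₁ M₂ N →
        op M₁.cls M₂.cls = N.cls) := by
  exact ⟨ASCIR.exists_isTensorProduct hΘ,
    fun _ _ _ _ _ _ _ _ hq hq' f₁ f₂ => hq.existsUnique_iso hq' f₁ f₂,
    ASCIR.existsUnique_op hΘ⟩
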